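/- For a finite simple graph $G$ let $\alpha(G)$ be the maximum size of an independent set of $G$, and let $i(G)$ be the minimum size of an inclusion-maximal independent set of $G$. The graph $G$ is \emph{almost well-covered} if $\alpha(G)-i(G)=1$. Let $U$ be the set of vertices $u$ of $G$ such that the connected component of $G$ containing $u$ is a complete graph. A \emph{leaf} is a vertex of $G-U$ of degree $1$, and the other vertices of $G-U$ are called \emph{internal}. A vertex is \emph{of type $2$} if it is internal and adjacent to exactly two leaves. The girth of a graph is the length of a shortest cycle, and it is $\infty$ if the graph has no cycle. \textbf{Theorem.} Given a graph $G$ of girth at least $6$ with exactly one vertex of type $2$, it can be decided in polynomial time whether $G$ is almost well-covered. That is, there are a deterministic Turing machine $M$ and a polynomial $p$ such that, for every finite graph $G$ of girth at least $6$ with exactly one vertex of type $2$, the machine $M$, started on the adjacency matrix of $G$ (with respect to any ordering of the vertices), halts after at most $p(\ell)$ steps, where $\ell$ is the length of the input, and correctly outputs whether $G$ is almost well-covered. -/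

import Mathlib

namespace AlmostWellCovered

/-! ### Independence gap -/

/-- `i(G)`: the minimum size of an inclusion-maximal independent set of `G`. -/
noncomputable def minMaximalIndepNum {V : Type*} (G : SimpleGraph V) : ℕ :=
  sInf {k | ∃ s : Finset V, Maximal (fun t : Finset V => G.IsIndepSet (t : Set V)) s ∧ s.card = k}

/-- The independence gap `α(G) - i(G)` of a finite graph. -/
noncomputable def independenceGap {V : Type*} (G : SimpleGraph V) : ℕ :=
  G.indepNum - minMaximalIndepNum G

/-- A finite graph is almost well-covered if its independence gap equals one. -/
def IsAlmostWellCovered {V : Type*} (G : SimpleGraph V) : Prop :=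
  independenceGap G = 1

/-! ### Types of vertices -/

/-- The component of `G` containing `v` is a complete graph. -/
def InCompleteComponent {V : Type*} (G : SimpleGraph V) (v : V) : Prop :=
  ∀ a b : V, G.Reachable v a → G.Reachable v b → a ≠ b → G.Adj a b

/-- A leaf of `G - U`, where `U` is the set of vertices in complete components: a vertex outside
`U` of degree one. (As `U` is a union of components, degrees in `G - U` and in `G` agree.) -/
def IsLeaf {V : Type*} (G : SimpleGraph V) (v : V) : Prop :=
  ¬ InCompleteComponent G v ∧ (G.neighborSet v).ncard = 1

/-- An internal vertex: a vertex outside the complete components that is not a leaf. -/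
def IsInternal {V : Type*} (G : SimpleGraph V) (v : V) : Prop :=
  ¬ InCompleteComponent G v ∧ ¬ IsLeaf G v

/-- `v` is of type `k` in the finite graph `G`: either `v` is an internal vertex adjacent to
exactly `k` leaves, or `k = 0` and `v` lies in a complete component. Leaves have no type. -/
def HasType {V : Type*} (G : SimpleGraph V) (v : V) (k : ℕ) : Prop :=
  (IsInternal G v ∧ {u | G.Adj v u ∧ IsLeaf G u}.ncard = k) ∨ (InCompleteComponent G v ∧ k = 0)

/-! ### Polynomial-time decision problems on graphs -/

/-- The adjacency matrix of a graph on `{0, …, n-1}` as a word over the three-letter alphabet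
`Option Bool`: row by row, the bits of each row being followed by the end-of-row marker `none`. -/
noncomputable def encodeGraph {n : ℕ} (G : SimpleGraph (Fin n)) : List (Option Bool) :=
  open Classical in
  (List.finRange n).flatMap fun i =>
    (List.finRange n).map (fun j => some (decide (G.Adj i j))) ++ [none]

/-- Given a graph satisfying `C`, it can be decided in polynomial time whether it satisfies `P`:
one (multi-stack) Turing machine, started on the adjacency matrix of any finite graph that
satisfies `C`, outputs the truth value of `P`, within a number of steps that is bounded by a fixed
polynomial in the length of the input. -/
def DecidableInPolyTime (C P : ∀ n : ℕ, SimpleGraph (Fin n) → Prop) : Prop :=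
  open Classical in
  Nonempty (Turing.TM2ComputableInPolyTime
    (fun G : {G : Σ n : ℕ, SimpleGraph (Fin n) // C G.1 G.2} => encodeGraph G.1.2)
    Computability.encodeBool
    (fun G => decide (P G.1.1 G.1.2)))

end AlmostWellCovered

/-!
The proof shows that, among graphs of girth at least six with exactly one vertex of type two, the
almost well-covered graphs are described by a single first-order sentence in the language of graphs,
and that every such sentence can be evaluated in polynomial time.

**The combinatorial part.** Let `v` be the vertex of type two, with leaves `a` and `b`. The
independence gap is positive, since `v` may be exchanged for `a` and `b`; so the graph is almost
well-covered if and only if the gap is at most one. The basic tool is `GapLE.swap`: replacing an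
independent set `J` by an independent set `J'` whose closed neighbourhood is not larger gains at most
the gap. It shows that a gap of at most one has three consequences.

* The graph `H` obtained by deleting the closed neighbourhood of `v` is well-covered
  (`GapLE.del_of_twoLeaves`). In a well-covered graph of girth at least six each vertex of degree at
  least two has exactly one leaf or lies in a component that is a heptagon (`GapLE.locallyNice`, half
  of the characterization by Finbow and Hartnell). The heptagons come from an induction:
  from a vertex whose neighbours are no leaves one passes to the graph without the closed
  neighbourhood of some vertex (`Leafless.inC7`).
* Each neighbour of `v` except `a` and `b` has exactly one leaf (`GapLE.nbrsHaveLeaf`).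
* No independent set of at most `40` vertices can be exchanged for a larger one with a gain of two
  (`GapLE.noExchange`).

Conversely, these conditions imply that the gap is at most one (`GapLE.of_noExchange`). By the first
one, `H` splits into blocks (isolated vertices, vertices with their leaf, heptagons), in which all
maximal independent sets of `H` have the same size. Take a maximal independent set `S` and an
independent set `T`. If `v ∈ S`, the blocks show that `T` has at most one vertex more than `S`.
Otherwise `S` contains `a` and `b`. If `T` had two vertices more than `S`, then after the neighbours of
`v` in both sets have been replaced by their leaves, at most two blocks in which `S` is smaller than
`T` would account for an excess of two. In each of them the part of `S` can be exchanged for a set as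
large as the part of `T`, at the cost of replacing at most one neighbour of `v` by its leaf
(`Block.exists_exchange`). Together this is an exchange of boundedly many vertices of bounded degree
that gains two, and adding the vertices of `S` that dominate the neighbours of the new vertices to both
sides turns it into one that the third condition forbids (`NoExchange.false_of_exchange`).

**The algorithmic part.** Since the second and the third condition and local niceness speak about
boundedly many vertices at a time, their conjunction is first-order definable
(`FirstOrder.gapLE_one`). A first-order sentence is evaluated by a program that stores the value of
each variable in unary on a stack and tries all values for each quantifier; adjacency is tested by
scanning the adjacency matrix. Such programs are written in a small structured language that is
compiled to multi-stack machines, with running times tracked by a big-step semantics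
(`FirstOrder.exists_prog`, `FirstOrder.decidableInPolyTime`).
-/

namespace AlmostWellCovered

/-! ### A structured programming language for multi-stack machines -/

/-- The symbols on the working stacks: the alphabet of the encoding of graphs. -/
abbrev Sym : Type := Option Bool

/-- Structured programs that act on a Boolean register and on stacks indexed by `κ`. -/
inductive Prog (κ : Type) : Type
  /-- do nothing -/
  | skip : Prog κ
  /-- move the top symbol, if there is one, from the first stack to the second -/
  | move : κ → κ → Prog κ
  /-- push a fixed symbol -/
  | push : κ → Sym → Prog κ
  /-- remove the top symbol -/
  | drop : κ → Prog κ
  /-- update the register, depending on its value and on the top symbol of a stack -/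
  | test : κ → (Bool → Option Sym → Bool) → Prog κ
  /-- apply a function to the register -/
  | map : (Bool → Bool) → Prog κ
  /-- sequential composition -/
  | seq : Prog κ → Prog κ → Prog κ
  /-- run the program if the register is `true` -/
  | cond : Prog κ → Prog κ
  /-- repeat the program as long as the register and the top symbol satisfy a condition -/
  | loop : κ → (Bool → Option Sym → Bool) → Prog κ → Prog κ

namespace Prog

variable {κ : Type}

/-- The alphabets of the stacks of the machine: besides the working stacks there is an output
stack, which has index `none` and holds Booleans. -/
def Alphabet (κ : Type) : Option κ → Type
  | none => Bool
  | some _ => Sym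

/-- The internal states of the machine: the register, and a buffer that holds the symbol read last
and is empty between any two steps. -/
abbrev State : Type := Bool × Option Sym

/-- The labels of the machine code of a program. -/
def Lab : Prog κ → Type
  | seq p q => Lab p ⊕ Lab q
  | cond p => Option (Lab p)
  | loop _ _ p => Option (Lab p)
  | _ => Unit

instance fintypeLab : (p : Prog κ) → Fintype (Lab p)
  | seq p q => @instFintypeSum _ _ (fintypeLab p) (fintypeLab q)
  | cond p => @instFintypeOption _ (fintypeLab p)
  | loop _ _ p => @instFintypeOption _ (fintypeLab p)
  | skip => inferInstanceAs (Fintype Unit)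
  | move _ _ => inferInstanceAs (Fintype Unit)
  | push _ _ => inferInstanceAs (Fintype Unit)
  | drop _ => inferInstanceAs (Fintype Unit)
  | test _ _ => inferInstanceAs (Fintype Unit)
  | map _ => inferInstanceAs (Fintype Unit)

/-- The label at which the machine code of a program starts. -/
def entry : (p : Prog κ) → Lab p
  | seq p _ => Sum.inl (entry p)
  | cond _ => none
  | loop _ _ _ => none
  | skip => ()
  | move _ _ => ()
  | push _ _ => ()
  | drop _ => ()
  | test _ _ => ()
  | map _ => ()

open Turing.TM2.Stmt in
/-- The machine code of a program inside a machine with labels `Λ`: the labels of the program are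
embedded by `emb`, and `exit` is the label at which the machine continues after the program. -/
def code {Λ : Type} : (p : Prog κ) → (Lab p → Λ) → Λ → Lab p →
    Turing.TM2.Stmt (Alphabet κ) Λ State
  | skip, _, exit => fun _ => goto fun _ => exit
  | move j k, _, exit => fun _ =>
      pop (some j) (fun s o => (s.1, o))
        (branch (fun s => s.2.isSome)
          (Turing.TM2.Stmt.push (some k) (fun s => s.2.getD none)
            (load (fun s => (s.1, none)) (goto fun _ => exit)))
          (goto fun _ => exit))
  | push k a, _, exit => fun _ => Turing.TM2.Stmt.push (some k) (fun _ => a) (goto fun _ => exit)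
  | drop k, _, exit => fun _ => pop (some k) (fun s _ => s) (goto fun _ => exit)
  | test k f, _, exit => fun _ => peek (some k) (fun s o => (f s.1 o, none)) (goto fun _ => exit)
  | map f, _, exit => fun _ => load (fun s => (f s.1, none)) (goto fun _ => exit)
  | seq p q, emb, exit => Sum.elim
      (code p (fun l => emb (Sum.inl l)) (emb (Sum.inr (entry q))))
      (code q (fun l => emb (Sum.inr l)) exit)
  | cond p, emb, exit => fun l => match l with
      | none => branch (fun s => s.1) (goto fun _ => emb (some (entry p))) (goto fun _ => exit)
      | some l => code p (fun l => emb (some l)) exit l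
  | loop k c p, emb, exit => fun l => match l with
      | none => peek (some k) (fun s o => (s.1, o))
          (branch (fun s => c s.1 s.2)
            (load (fun s => (s.1, none)) (goto fun _ => emb (some (entry p))))
            (load (fun s => (s.1, none)) (goto fun _ => exit)))
      | some l => code p (fun l => emb (some l)) (emb none) l

variable [DecidableEq κ]

/-- The stacks of the machine: the working stacks and an empty output stack. -/
def toStk (S : κ → List Sym) : (k : Option κ) → List (Alphabet κ k)
  | none => ([] : List Bool)
  | some k => S k

theorem update_toStk (S : κ → List Sym) (k : κ) (l : List Sym) :
    Function.update (toStk S) (some k) l = toStk (Function.update S k l) := by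
  funext j
  cases j with
  | none => rfl
  | some j =>
    by_cases h : j = k
    · subst h
      exact (Function.update_self _ _ _).trans (Function.update_self j l S).symm
    · exact (Function.update_of_ne (by simpa using h) _ _).trans
        (Function.update_of_ne h _ _).symm

/-- The program `p` turns the store `c`, a register and stacks, into the store `c'` in at most `t`
steps, in every machine that contains its code. -/
def Run (p : Prog κ) (c c' : Bool × (κ → List Sym)) (t : ℕ) : Prop :=
  ∀ (Λ : Type) (m : Λ → Turing.TM2.Stmt (Alphabet κ) Λ State) (emb : Lab p → Λ) (exit : Λ),
    (∀ l, m (emb l) = code p emb exit l) → ∃ s ≤ t,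
      (flip bind (Turing.TM2.step m))^[s] (some ⟨some (emb (entry p)), (c.1, none), toStk c.2⟩) =
        some ⟨some exit, (c'.1, none), toStk c'.2⟩

theorem step_one {Λ : Type} {m : Λ → Turing.TM2.Stmt (Alphabet κ) Λ State} {l : Λ}
    {q : Turing.TM2.Stmt (Alphabet κ) Λ State} (h : m l = q) {v : State}
    {S : (k : Option κ) → List (Alphabet κ k)} :
    (flip bind (Turing.TM2.step m))^[1] (some ⟨some l, v, S⟩) =
      some (Turing.TM2.stepAux q v S) := by
  subst h; rfl

namespace Run

variable {p q : Prog κ} {c c' c'' : Bool × (κ → List Sym)} {t t' : ℕ}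

theorem mono (h : Run p c c' t) (ht : t ≤ t') : Run p c c' t' := fun Λ m emb exit hm => by
  obtain ⟨s, hs, e⟩ := h Λ m emb exit hm
  exact ⟨s, hs.trans ht, e⟩

theorem skip : Run (.skip : Prog κ) c c 1 := fun Λ m emb exit hm => by
  refine ⟨1, le_rfl, ?_⟩
  simp [flip, hm, code]

theorem move {j k : κ} {a : Sym} {l : List Sym} (h : c.2 j = a :: l) :
    Run (.move j k) c
      (c.1, Function.update (Function.update c.2 j l) k (a :: Function.update c.2 j l k)) 1 :=
  fun Λ m emb exit hm => by
  refine ⟨1, le_rfl, ?_⟩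
  have h1 : toStk c.2 (some j) = a :: l := h
  refine (step_one (hm _)).trans ?_
  simp only [code, Turing.TM2.stepAux]
  erw [h1]
  exact congrArg _ (congrArg _ ((congrArg (fun z => Function.update z (some k) _)
    (update_toStk c.2 j l)).trans ((congrArg (Function.update _ (some k))
      (congrArg (a :: ·) (congrFun (update_toStk c.2 j l) (some k)))).trans (update_toStk _ k _))))

theorem push {k : κ} {a : Sym} : Run (.push k a) c (c.1, Function.update c.2 k (a :: c.2 k)) 1 :=
  fun Λ m emb exit hm => by
  refine ⟨1, le_rfl, ?_⟩
  simp only [flip, hm, code, Function.iterate_one, Option.bind_eq_bind, Option.bind_some,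
    Turing.TM2.step, Turing.TM2.stepAux]
  exact congrArg _ (congrArg _ (update_toStk _ _ _))

theorem drop {k : κ} : Run (.drop k) c (c.1, Function.update c.2 k (c.2 k).tail) 1 :=
  fun Λ m emb exit hm => by
  refine ⟨1, le_rfl, ?_⟩
  simp only [flip, hm, code, Function.iterate_one, Option.bind_eq_bind, Option.bind_some,
    Turing.TM2.step, Turing.TM2.stepAux]
  exact congrArg _ (congrArg _ (update_toStk _ _ _))

theorem test {k : κ} {f : Bool → Option Sym → Bool} :
    Run (.test k f) c (f c.1 (c.2 k).head?, c.2) 1 := fun Λ m emb exit hm => by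
  refine ⟨1, le_rfl, ?_⟩
  simp only [flip, hm, code, Function.iterate_one, Option.bind_eq_bind, Option.bind_some,
    Turing.TM2.step, Turing.TM2.stepAux]
  rfl

theorem map {f : Bool → Bool} : Run (.map f) c (f c.1, c.2) 1 := fun Λ m emb exit hm => by
  refine ⟨1, le_rfl, ?_⟩
  simp only [flip, hm, code, Function.iterate_one, Option.bind_eq_bind, Option.bind_some,
    Turing.TM2.step, Turing.TM2.stepAux]

theorem seq (hp : Run p c c' t) (hq : Run q c' c'' t') : Run (.seq p q) c c'' (t + t') :=
  fun Λ m emb exit hm => by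
  obtain ⟨s, hs, e⟩ := hp Λ m (fun l => emb (Sum.inl l)) (emb (Sum.inr (entry q)))
    fun l => hm (Sum.inl l)
  obtain ⟨s', hs', e'⟩ := hq Λ m (fun l => emb (Sum.inr l)) exit fun l => hm (Sum.inr l)
  refine ⟨s' + s, by omega, ?_⟩
  rw [Function.iterate_add_apply]
  exact (congrArg _ e).trans e'

theorem cond_false (h : c.1 = false) : Run (.cond p) c c 1 := fun Λ m emb exit hm => by
  refine ⟨1, le_rfl, ?_⟩
  refine (step_one (hm none)).trans ?_
  change some (bif c.1 then _ else _) = _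
  rw [h]; rfl

theorem cond_true (h : c.1 = true) (hp : Run p c c' t) : Run (.cond p) c c' (t + 1) :=
  fun Λ m emb exit hm => by
  obtain ⟨s, hs, e⟩ := hp Λ m (fun l => emb (some l)) exit fun l => hm (some l)
  refine ⟨s + 1, by omega, ?_⟩
  rw [Function.iterate_add_apply]
  refine (congrArg _ ?_).trans e
  refine (step_one (hm none)).trans ?_
  change some (bif c.1 then _ else _) = _
  rw [h]; rfl

/-- A loop that runs through the stores `F 0`, …, `F N`. -/
theorem loop {k : κ} {g : Bool → Option Sym → Bool} (F : ℕ → Bool × (κ → List Sym)) (N : ℕ)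
    (hF : ∀ i < N, g (F i).1 ((F i).2 k).head? = true ∧ Run p (F i) (F (i + 1)) t)
    (hN : g (F N).1 ((F N).2 k).head? = false) :
    Run (.loop k g p) (F 0) (F N) (N * (t + 1) + 1) := fun Λ m emb exit hm => by
  have key : ∀ i ≤ N, ∃ s ≤ i * (t + 1),
      (flip bind (Turing.TM2.step m))^[s] (some ⟨some (emb none), ((F 0).1, none), toStk (F 0).2⟩) =
        some ⟨some (emb none), ((F i).1, none), toStk (F i).2⟩ := by
    intro i
    induction i with
    | zero => exact fun _ => ⟨0, by omega, rfl⟩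
    | succ i ih =>
      intro hi
      obtain ⟨s, hs, e⟩ := ih (by omega)
      obtain ⟨h1, h2⟩ := hF i (by omega)
      obtain ⟨s', hs', e'⟩ := h2 Λ m (fun l => emb (some l)) (emb none) fun l => hm (some l)
      refine ⟨s' + 1 + s, by linarith [Nat.succ_mul i (t + 1)], ?_⟩
      rw [Function.iterate_add_apply, e, Function.iterate_add_apply]
      refine (congrArg _ ?_).trans e'
      refine (step_one (hm none)).trans ?_
      change some (bif g (F i).1 ((F i).2 k).head? then _ else _) = _
      rw [h1]; rfl
  obtain ⟨s, hs, e⟩ := key N le_rfl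
  refine ⟨1 + s, by omega, ?_⟩
  rw [Function.iterate_add_apply]
  refine (congrArg _ e).trans ?_
  refine (step_one (hm none)).trans ?_
  change some (bif g (F N).1 ((F N).2 k).head? then _ else _) = _
  rw [hN]; rfl

end Run

end Prog

/-! ### Programs for the atomic formulas and the quantifiers -/

/-- The working stacks: the input and an auxiliary stack, which together hold the word that encodes
the graph, a stack `tmp`, and for each variable `i` a pair of stacks `X i`, `N i` that hold the value
of `i` and its difference to the order of the graph in unary. -/
inductive Stk (D : ℕ) : Type
  | inp | aux | tmp
  | X (i : Fin D)
  | N (i : Fin D)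
  deriving DecidableEq, Fintype

/-- The contents of the working stacks. -/
def mem {D : ℕ} (inp aux : List Sym) (tmp : ℕ) (X N : Fin D → ℕ) : Stk D → List Sym
  | .inp => inp
  | .aux => aux
  | .tmp => List.replicate tmp none
  | .X i => List.replicate (X i) none
  | .N i => List.replicate (N i) none

section mem

variable {D : ℕ} {inp aux l : List Sym} {tmp k : ℕ} {X N : Fin D → ℕ}

theorem update_mem_inp : Function.update (mem inp aux tmp X N) .inp l = mem l aux tmp X N := by
  funext j; cases j <;> simp [mem]

theorem update_mem_aux : Function.update (mem inp aux tmp X N) .aux l = mem inp l tmp X N := by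
  funext j; cases j <;> simp [mem]

theorem update_mem_tmp :
    Function.update (mem inp aux tmp X N) .tmp (List.replicate k none) = mem inp aux k X N := by
  funext j; cases j <;> simp [mem]

theorem update_mem_X {i : Fin D} :
    Function.update (mem inp aux tmp X N) (.X i) (List.replicate k none) =
      mem inp aux tmp (Function.update X i k) N := by
  funext j
  cases j with
  | X j => by_cases h : j = i <;> simp [mem, h]
  | _ => simp [mem]

theorem update_mem_N {i : Fin D} :
    Function.update (mem inp aux tmp X N) (.N i) (List.replicate k none) =
      mem inp aux tmp X (Function.update N i k) := by
  funext j
  cases j with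
  | N j => by_cases h : j = i <;> simp [mem, h]
  | _ => simp [mem]

end mem

namespace Prog

theorem Run.to {κ : Type} [DecidableEq κ] {p : Prog κ} {c c' c'' : Bool × (κ → List Sym)} {t : ℕ}
    (h : Run p c c' t) (e : c' = c'') : Run p c c'' t := e ▸ h

variable {D : ℕ} {b b' : Bool} {inp aux w : List Sym} {tmp k n : ℕ} {X N : Fin D → ℕ} {i : Fin D}

theorem Run.move_inp_aux (hk : k < w.length) :
    Run (.move .inp .aux) (b, mem (w.drop k) (w.take k).reverse tmp X N)
      (b, mem (w.drop (k + 1)) (w.take (k + 1)).reverse tmp X N) 1 := by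
  refine (Run.move (a := w[k]) (l := w.drop (k + 1)) ?_).to ?_
  · exact List.drop_eq_getElem_cons hk
  · rw [update_mem_inp, update_mem_aux, List.take_succ_eq_append_getElem hk, List.reverse_append]
    rfl

theorem Run.move_aux_inp (hk : k < w.length) :
    Run (.move .aux .inp) (b, mem (w.drop (k + 1)) (w.take (k + 1)).reverse tmp X N)
      (b, mem (w.drop k) (w.take k).reverse tmp X N) 1 := by
  refine (Run.move (a := w[k]) (l := (w.take k).reverse) ?_).to ?_
  · rw [List.take_succ_eq_append_getElem hk]
    simp [mem]
  · rw [update_mem_aux, update_mem_inp, List.drop_eq_getElem_cons hk]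
    simp [mem]

/-- Return to the start of the word. -/
def rewind : Prog (Stk D) := .loop .aux (fun _ o => o.isSome) (.move .aux .inp)

theorem Run.rewind (hk : k ≤ w.length) :
    Run rewind (b, mem (w.drop k) (w.take k).reverse tmp X N) (b, mem w [] tmp X N)
      (k * 2 + 1) := by
  have := Run.loop (p := .move .aux .inp) (k := Stk.aux) (g := fun _ o => o.isSome) (t := 1)
    (fun i => (b, mem (w.drop (k - i)) (w.take (k - i)).reverse tmp X N)) k ?_ ?_
  · simp only [Nat.sub_zero, Nat.sub_self, List.drop_zero, List.take_zero, List.reverse_nil] at this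
    exact this
  · intro i hi
    constructor
    · obtain ⟨m, hm⟩ : ∃ m, k - i = m + 1 := ⟨k - i - 1, by omega⟩
      have : m < w.length := by omega
      simp only [mem, hm, List.take_succ_eq_append_getElem this, List.reverse_append]
      rfl
    · have := Run.move_aux_inp (b := b) (tmp := tmp) (X := X) (N := N) (w := w) (k := k - (i + 1))
        (by omega)
      rwa [show k - (i + 1) + 1 = k - i by omega] at this
  · simp [mem]

/-- Run a program as many times as the value of the variable `i`. -/
def forX (i : Fin D) (p : Prog (Stk D)) : Prog (Stk D) :=
  .seq (.loop (.X i) (fun _ o => o.isSome) (.seq (.move (.X i) .tmp) p))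
    (.loop .tmp (fun _ o => o.isSome) (.move .tmp (.X i)))

theorem Run.forX {p : Prog (Stk D)} {x t : ℕ} (hx : X i = x) (B : ℕ → Bool) (I A : ℕ → List Sym)
    (h : ∀ s < x, ∀ X' tmp', Run p (B s, mem (I s) (A s) tmp' X' N)
      (B (s + 1), mem (I (s + 1)) (A (s + 1)) tmp' X' N) t) :
    Run (forX i p) (B 0, mem (I 0) (A 0) 0 X N) (B x, mem (I x) (A x) 0 X N)
      (x * (t + 2) + 1 + (x * 2 + 1)) := by
  have hX : Function.update X i x = X := by rw [← hx, Function.update_eq_self]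
  refine Run.seq (c' := (B x, mem (I x) (A x) x (Function.update X i 0) N)) ?_ ?_
  · have := Run.loop (p := .seq (.move (.X i) .tmp) p) (k := Stk.X i) (g := fun _ o => o.isSome)
      (t := 1 + t)
      (fun s => (B s, mem (I s) (A s) s (Function.update X i (x - s)) N)) x ?_ ?_
    · simp only [Nat.sub_zero, hX, Nat.sub_self] at this
      exact this.mono (by rw [show t + 2 = 1 + t + 1 by ring])
    · intro s hs
      obtain ⟨m, hm⟩ : ∃ m, x - s = m + 1 := ⟨x - s - 1, by omega⟩
      have hm' : x - (s + 1) = m := by omega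
      constructor
      · simp [mem, hm]
      · refine Run.seq ((Run.move (a := none) (l := List.replicate m none) ?_).to ?_)
          (h s hs (Function.update X i m) (s + 1)) |>.to ?_
        · simp [mem, hm, List.replicate_succ]
        · rw [update_mem_X]
          simp only [mem, ← List.replicate_succ, update_mem_tmp, Function.update_idem]
        · rw [hm']
    · simp [mem]
  · have := Run.loop (p := .move .tmp (.X i)) (k := Stk.tmp) (g := fun _ o => o.isSome)
      (t := 1) (fun s => (B x, mem (I x) (A x) (x - s) (Function.update X i s) N)) x ?_ ?_
    · simpa [hX] using this
    · intro s hs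
      obtain ⟨m, hm⟩ : ∃ m, x - s = m + 1 := ⟨x - s - 1, by omega⟩
      have hm' : x - (s + 1) = m := by omega
      constructor
      · simp [mem, hm, List.replicate_succ]
      · refine (Run.move (a := none) (l := List.replicate m none) ?_).to ?_
        · simp [mem, hm, List.replicate_succ]
        · rw [update_mem_tmp]
          simp only [mem, Function.update_self, ← List.replicate_succ, update_mem_X, hm',
            Function.update_idem]
    · simp [mem]

end Prog

/-! ### The word that encodes a graph -/

section encode

variable {α β : Type*} {f : α → List β} {m : ℕ}

theorem drop_flatMap {l : List α} (h : ∀ a ∈ l, (f a).length = m) (x : ℕ) :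
    (l.flatMap f).drop (x * m) = (l.drop x).flatMap f := by
  induction l generalizing x with
  | nil => simp
  | cons a l ih =>
    cases x with
    | zero => simp
    | succ x =>
      rw [List.flatMap_cons, List.drop_append, h a (by simp), List.drop_succ_cons,
        ← ih (fun b hb => h b (by simp [hb])), List.drop_of_length_le, List.nil_append]
      · congr 1; rw [Nat.succ_mul]; omega
      · rw [h a (by simp), Nat.succ_mul]; omega

open Classical in
/-- The row of the adjacency matrix that belongs to a vertex. -/
noncomputable def encodeRow {n : ℕ} (G : SimpleGraph (Fin n)) (i : Fin n) : List Sym :=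
  (List.finRange n).map (fun j => some (decide (G.Adj i j))) ++ [none]

theorem encodeGraph_eq {n : ℕ} (G : SimpleGraph (Fin n)) :
    encodeGraph G = (List.finRange n).flatMap (encodeRow G) := rfl

theorem length_encodeRow {n : ℕ} (G : SimpleGraph (Fin n)) (i : Fin n) :
    (encodeRow G i).length = n + 1 := by
  simp [encodeRow]

theorem length_encodeGraph {n : ℕ} (G : SimpleGraph (Fin n)) :
    (encodeGraph G).length = n * (n + 1) := by
  simp [encodeGraph_eq, List.length_flatMap, length_encodeRow]

theorem getElem?_encodeGraph {n : ℕ} (G : SimpleGraph (Fin n)) (x : Fin n) {y : ℕ}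
    (hy : y < n + 1) : (encodeGraph G)[(x : ℕ) * (n + 1) + y]? = (encodeRow G x)[y]? := by
  rw [← List.getElem?_drop, encodeGraph_eq, drop_flatMap fun a _ => length_encodeRow G a,
    List.drop_eq_getElem_cons (by simp), List.flatMap_cons, List.getElem?_append_left]
  · simp
  · rw [length_encodeRow]; exact hy

open Classical in
theorem getElem?_encodeGraph_of_lt {n : ℕ} (G : SimpleGraph (Fin n)) (x y : Fin n) :
    (encodeGraph G)[(x : ℕ) * (n + 1) + y]? = some (some (decide (G.Adj x y))) := by
  rw [getElem?_encodeGraph G x (by omega), encodeRow, List.getElem?_append_left (by simp)]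
  simp

theorem getElem?_encodeGraph_end {n : ℕ} (G : SimpleGraph (Fin n)) (x : Fin n) :
    (encodeGraph G)[(x : ℕ) * (n + 1) + n]? = some none := by
  rw [getElem?_encodeGraph G x (by omega), encodeRow, List.getElem?_append_right (by simp)]
  simp

end encode

namespace Prog

variable {D n : ℕ} {b : Bool} {X N : Fin D → ℕ} {i j : Fin D} {G : SimpleGraph (Fin n)}

/-- Move to the start of the next row of the adjacency matrix. -/
def skipRow : Prog (Stk D) :=
  .seq (.loop .inp (fun _ o => o.join.isSome) (.move .inp .aux)) (.move .inp .aux)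

theorem Run.skipRow {tmp : ℕ} (x : Fin n) :
    Run (skipRow (D := D))
      (b, mem ((encodeGraph G).drop (x * (n + 1))) ((encodeGraph G).take (x * (n + 1))).reverse
        tmp X N)
      (b, mem ((encodeGraph G).drop ((x + 1) * (n + 1)))
        ((encodeGraph G).take ((x + 1) * (n + 1))).reverse tmp X N) (n * 2 + 2) := by
  have hlen : (x + 1) * (n + 1) ≤ (encodeGraph G).length := by
    rw [length_encodeGraph]; exact Nat.mul_le_mul_right _ x.2
  rw [Nat.succ_mul] at hlen
  refine Run.seq (t := n * 2 + 1) (t' := 1) (c' := (b, mem ((encodeGraph G).drop (x * (n + 1) + n))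
    ((encodeGraph G).take (x * (n + 1) + n)).reverse tmp X N)) ?_ ?_
  · refine Run.loop (p := .move .inp .aux) (k := Stk.inp) (g := fun _ o => o.join.isSome) (t := 1)
      (fun s => (b, mem ((encodeGraph G).drop (x * (n + 1) + s))
        ((encodeGraph G).take (x * (n + 1) + s)).reverse tmp X N)) n ?_ ?_
    · intro s hs
      refine ⟨?_, Run.move_inp_aux (by omega)⟩
      have := getElem?_encodeGraph_of_lt G x ⟨s, hs⟩
      simp only [mem, List.head?_drop]
      simp only at this
      rw [this]; rfl
    · simp only [mem, List.head?_drop, getElem?_encodeGraph_end]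
      rfl
  · have := Run.move_inp_aux (b := b) (tmp := tmp) (X := X) (N := N) (w := encodeGraph G)
      (k := x * (n + 1) + n) (by omega)
    rwa [show (x : ℕ) * (n + 1) + n + 1 = (x + 1) * (n + 1) by ring] at this

/-- Test whether the values of two variables are adjacent. -/
def adj (i j : Fin D) : Prog (Stk D) :=
  .seq (forX i skipRow) (.seq (forX j (.move .inp .aux))
    (.seq (.test .inp fun _ o => o == some (some true)) rewind))

open Classical in
theorem Run.adj (x y : Fin n) (hx : X i = x) (hy : X j = y) :
    Run (adj i j) (b, mem (encodeGraph G) [] 0 X N)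
      (decide (G.Adj x y), mem (encodeGraph G) [] 0 X N) (4 * n ^ 2 + 15 * n + 10) := by
  have hlen : (x + 1) * (n + 1) ≤ (encodeGraph G).length := by
    rw [length_encodeGraph]; exact Nat.mul_le_mul_right _ x.2
  rw [Nat.succ_mul] at hlen
  have h1 := Run.forX (N := N) (p := Prog.skipRow) (t := n * 2 + 2) hx (fun _ => b)
    (fun s => (encodeGraph G).drop (s * (n + 1)))
    (fun s => ((encodeGraph G).take (s * (n + 1))).reverse)
    fun s hs X' tmp' => Run.skipRow (⟨s, hs.trans x.2⟩ : Fin n)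
  have h2 := Run.forX (N := N) (p := .move .inp .aux) (t := 1) hy (fun _ => b)
    (fun s => (encodeGraph G).drop (x * (n + 1) + s))
    (fun s => ((encodeGraph G).take (x * (n + 1) + s)).reverse)
    fun s hs X' tmp' => Run.move_inp_aux (by have := y.2; omega)
  simp only [Nat.zero_mul, List.drop_zero, List.take_zero, List.reverse_nil] at h1
  simp only [Nat.add_zero] at h2
  have h3 := Run.rewind (b := decide (G.Adj x y)) (tmp := 0) (X := X) (N := N)
    (w := encodeGraph G) (k := x * (n + 1) + y) (by have := y.2; omega)
  refine (Run.seq h1 (Run.seq h2 (Run.seq (Run.test.to ?_) h3))).mono ?_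
  · refine Prod.ext ?_ rfl
    simp only [mem, List.head?_drop, getElem?_encodeGraph_of_lt]
    by_cases h : G.Adj x y <;> simp [h]
  · have hx' : (x : ℕ) ≤ n := x.2.le
    have hy' : (y : ℕ) ≤ n := y.2.le
    nlinarith [Nat.mul_le_mul_right n hx']

/-- Test whether the values of two variables are equal. -/
def eq (i j : Fin D) : Prog (Stk D) :=
  .seq (forX i (.push .aux none)) (.seq (.map fun _ => true)
    (.seq (forX j (.seq (.test .aux fun b o => b && o.isSome) (.drop .aux)))
      (.seq (.test .aux fun b o => b && o.isNone) (.loop .aux (fun _ o => o.isSome) (.drop .aux)))))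

theorem Run.drop_aux {inp aux : List Sym} {tmp : ℕ} :
    Run (.drop .aux) (b, mem inp aux tmp X N) (b, mem inp aux.tail tmp X N) 1 :=
  Run.drop.to (by rw [update_mem_aux]; rfl)

theorem Run.eq {w : List Sym} {x y : ℕ} (hx : X i = x) (hy : X j = y) (hxn : x ≤ n) (hyn : y ≤ n) :
    Run (eq i j) (b, mem w [] 0 X N) (decide (x = y), mem w [] 0 X N) (15 * n + 10) := by
  have h1 := Run.forX (N := N) (p := .push .aux none) (t := 1) hx (fun _ => b)
    (fun _ => w) (fun s => List.replicate s none) fun s hs X' tmp' =>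
      Run.push.to (by rw [update_mem_aux]; rfl)
  have h2 := Run.forX (N := N) (p := .seq (.test .aux fun b o => b && o.isSome) (.drop .aux))
    (t := 2) hy (fun s => decide (s ≤ x))
    (fun _ => w) (fun s => List.replicate (x - s) none) fun s hs X' tmp' => by
      refine Run.seq (t := 1) (t' := 1) Run.test (Run.drop_aux.to ?_)
      refine Prod.ext ?_ ?_
      · simp only [mem]
        rcases Nat.lt_or_ge s x with h | h
        · obtain ⟨m, hm⟩ : ∃ m, x - s = m + 1 := ⟨x - s - 1, by omega⟩
          simp [hm, h, h.le, List.replicate_succ]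
        · simp [Nat.sub_eq_zero_of_le h, h]
      · simp only [List.tail_replicate, Nat.sub_sub]
  have h3 := Run.loop (p := .drop .aux) (k := Stk.aux) (g := fun _ o => o.isSome) (t := 1)
    (fun s => (decide (x = y), mem w (List.replicate (x - y - s) none) 0 X N)) (x - y)
    (fun s hs => by
      obtain ⟨m, hm⟩ : ∃ m, x - y - s = m + 1 := ⟨x - y - s - 1, by omega⟩
      refine ⟨by simp [mem, hm, List.replicate_succ], Run.drop_aux.to ?_⟩
      simp only [List.tail_replicate, Nat.sub_sub, Nat.add_assoc]) (by simp [mem])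
  simp only [Nat.sub_self, List.replicate_zero, Nat.sub_zero] at h1 h2 h3
  refine (Run.seq h1 (Run.seq (Run.map.to (c'' := (true, _)) rfl)
    (Run.seq (h2.to rfl) (Run.seq (Run.test.to ?_) h3)))).mono ?_
  · refine Prod.ext ?_ rfl
    simp only [mem]
    rcases lt_trichotomy x y with h | h | h
    · simp [Nat.not_le.2 h, h.ne]
    · simp [h]
    · obtain ⟨m, hm⟩ : ∃ m, x - y = m + 1 := ⟨x - y - 1, by omega⟩
      simp [hm, h.le, h.ne', List.replicate_succ]
  · have : x - y ≤ n := by omega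
    nlinarith

/-- Let the variable `i` run through the vertices until the program sets the register. -/
def ex (i : Fin D) (p : Prog (Stk D)) : Prog (Stk D) :=
  .seq (.map fun _ => false)
    (.seq (.loop (.N i) (fun b o => !b && o.isSome) (.seq p (.move (.N i) (.X i))))
      (.loop (.X i) (fun _ o => o.isSome) (.move (.X i) (.N i))))

open Classical in
theorem Run.ex {p : Prog (Stk D)} {w : List Sym} {a : Fin D → ℕ} (hi : a i = 0) {t : ℕ}
    (Q : ℕ → Prop) (hQ : ∀ x, Q x → x < n)
    (h : ∀ x < n, ∀ b, Run p
      (b, mem w [] 0 (Function.update a i x) (fun j => n - Function.update a i x j))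
      (decide (Q x), mem w [] 0 (Function.update a i x) (fun j => n - Function.update a i x j)) t) :
    Run (ex i p) (b, mem w [] 0 a (fun j => n - a j))
      (decide (∃ x, Q x), mem w [] 0 a (fun j => n - a j)) (n * (t + 4) + 3) := by
  let s (x : ℕ) : Stk D → List Sym :=
    mem w [] 0 (Function.update a i x) (fun j => n - Function.update a i x j)
  have hs0 : mem w [] 0 a (fun j => n - a j) = s 0 := by
    simp only [s]
    rw [← hi, Function.update_eq_self]
  have hX : ∀ x, s x (.X i) = List.replicate x none := fun x => by simp [s, mem]
  have hN : ∀ x, s x (.N i) = List.replicate (n - x) none := fun x => by simp [s, mem]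
  have hup : ∀ x, (fun j => n - Function.update a i x j) =
      Function.update (fun j => n - a j) i (n - x) := fun x => by
    funext j; by_cases hj : j = i <;> simp [hj]
  have hfwd : ∀ x < n, ∀ b, Run (.move (.N i) (.X i)) (b, s x) (b, s (x + 1)) 1 := by
    intro x hx b
    obtain ⟨m, hm⟩ : ∃ m, n - x = m + 1 := ⟨n - x - 1, by omega⟩
    refine (Run.move (a := none) (l := List.replicate m none) ?_).to ?_
    · simp [hN, hm, List.replicate_succ]
    · simp only [s, hup, update_mem_N, Function.update_idem]
      simp only [mem, Function.update_self, ← List.replicate_succ, update_mem_X,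
        Function.update_idem, show n - (x + 1) = m by omega]
  have hbwd : ∀ x < n, ∀ b, Run (.move (.X i) (.N i)) (b, s (x + 1)) (b, s x) 1 := by
    intro x hx b
    refine (Run.move (a := none) (l := List.replicate x none) ?_).to ?_
    · simp [hX, List.replicate_succ]
    · simp only [s, hup, update_mem_X, Function.update_idem]
      simp only [mem, Function.update_self, ← List.replicate_succ, update_mem_N,
        Function.update_idem, show n - (x + 1) + 1 = n - x by omega]
  obtain ⟨M, hMn, hM1, hM2⟩ : ∃ M ≤ n, (∀ x < M, ¬ ∃ y, x = y + 1 ∧ Q y) ∧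
      ((∃ y, M = y + 1 ∧ Q y) ↔ ∃ y, Q y) ∧ ((∃ y, Q y) ∨ M = n) := by
    by_cases hex : ∃ y, Q y
    · refine ⟨Nat.find hex + 1, hQ _ (Nat.find_spec hex), ?_, ⟨fun _ => hex,
        fun _ => ⟨_, rfl, Nat.find_spec hex⟩⟩, Or.inl hex⟩
      rintro x hx ⟨y, rfl, hy⟩
      exact absurd (Nat.find_min' hex hy) (by omega)
    · exact ⟨n, le_rfl, fun x _ ⟨y, _, hy⟩ => hex ⟨y, hy⟩,
        ⟨fun ⟨y, _, hy⟩ => ⟨y, hy⟩, fun h => absurd h hex⟩, Or.inr rfl⟩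
  have h1 := Run.loop (p := .seq p (.move (.N i) (.X i))) (k := Stk.N i)
    (g := fun b o => !b && o.isSome) (t := t + 1)
    (fun x => (decide (∃ y, x = y + 1 ∧ Q y), s x)) M
    (fun x hx => by
      constructor
      · obtain ⟨m, hm⟩ : ∃ m, n - x = m + 1 := ⟨n - x - 1, by omega⟩
        simp only [decide_eq_false (hM1 x hx), hN, hm, List.replicate_succ]
        rfl
      · refine (Run.seq (h x (by omega) _) (hfwd x (by omega) _)).to ?_
        refine Prod.ext ?_ rfl
        simp)
    (by
      rcases hM2.2 with h' | h'
      · simp [decide_eq_true (hM2.1.2 h')]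
      · simp [hN, h'])
  have h2 := Run.loop (p := .move (.X i) (.N i)) (k := Stk.X i)
    (g := fun _ o => o.isSome) (t := 1) (fun x => (decide (∃ x, Q x), s (M - x))) M
    (fun x hx => by
      obtain ⟨m, hm⟩ : ∃ m, M - x = m + 1 := ⟨M - x - 1, by omega⟩
      constructor
      · simp [hX, hm, List.replicate_succ]
      · rw [show M - (x + 1) = m by omega, hm]
        exact hbwd m (by omega) _)
    (by simp [hX])
  simp only [Nat.sub_zero, Nat.sub_self] at h2
  rw [hs0]
  refine (Run.seq (Run.map.to ?_) (Run.seq (h1.to ?_) h2)).mono ?_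
  · simp
  · simp only [hM2.1]
  · have := Nat.mul_le_mul_right (t + 1 + 1) hMn
    nlinarith

end Prog

/-! ### First-order properties of graphs -/

/-- A property of graphs `G` on `{0, …, n-1}` together with vertices indexed by `ι` is first-order
definable if it can be expressed by a formula in the language of graphs (adjacency and equality)
with free variables `ι`. -/
inductive FirstOrder :
    (ι : Type) → ((n : ℕ) → SimpleGraph (Fin n) → (ι → Fin n) → Prop) → Prop
  | adj {ι : Type} (i j : ι) : FirstOrder ι fun _ G x => G.Adj (x i) (x j)
  | eq {ι : Type} (i j : ι) : FirstOrder ι fun _ _ x => x i = x j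
  | not {ι : Type} {P} : FirstOrder ι P → FirstOrder ι fun n G x => ¬ P n G x
  | and {ι : Type} {P Q} : FirstOrder ι P → FirstOrder ι Q →
      FirstOrder ι fun n G x => P n G x ∧ Q n G x
  | ex {ι : Type} {P} : FirstOrder (Option ι) P →
      FirstOrder ι fun n G x => ∃ y, P n G fun o => o.elim y x

open Classical in
/-- A first-order formula is evaluated by a program in polynomial time. The variables of the formula
are stored in the stacks with indices below `k`, and the quantifiers of the formula, which are
nested at most `d` deep, use the next `d` indices. -/
theorem FirstOrder.exists_prog {ι : Type} {P} (h : FirstOrder ι P) :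
    ∃ d, ∀ (D k : ℕ) (e : ι → Fin D), (∀ i, (e i : ℕ) < k) → k + d ≤ D →
      ∃ (p : Prog (Stk D)) (T : Polynomial ℕ), ∀ (n : ℕ) (G : SimpleGraph (Fin n)) (x : ι → Fin n)
        (a : Fin D → ℕ) (b : Bool), (∀ i, a (e i) = x i) → (∀ j : Fin D, k ≤ j → a j = 0) →
        Prog.Run p (b, mem (encodeGraph G) [] 0 a (fun j => n - a j))
          (decide (P n G x), mem (encodeGraph G) [] 0 a (fun j => n - a j)) (T.eval n) := by
  induction h with
  | adj i j =>
    refine ⟨0, fun D k e _ _ => ⟨.adj (e i) (e j), 4 * .X ^ 2 + 15 * .X + 10, ?_⟩⟩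
    intro n G x a b ha _
    refine (Prog.Run.adj _ _ (ha i) (ha j)).mono ?_
    simp
  | eq i j =>
    refine ⟨0, fun D k e _ _ => ⟨.eq (e i) (e j), 15 * .X + 10, ?_⟩⟩
    intro n G x a b ha _
    refine ((Prog.Run.eq (ha i) (ha j) (x i).2.le (x j).2.le).mono ?_).to ?_
    · simp
    · simp only [Fin.ext_iff]
  | not _ ih =>
    obtain ⟨d, hd⟩ := ih
    refine ⟨d, fun D k e he hk => ?_⟩
    obtain ⟨p, T, hp⟩ := hd D k e he hk
    refine ⟨.seq p (.map Bool.not), T + 1, fun n G x a b ha h0 => ?_⟩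
    refine ((Prog.Run.seq (hp n G x a b ha h0) Prog.Run.map).mono ?_).to ?_
    · simp
    · simp
  | @and _ P Q _ _ ih ih' =>
    obtain ⟨d, hd⟩ := ih
    obtain ⟨d', hd'⟩ := ih'
    refine ⟨max d d', fun D k e he hk => ?_⟩
    obtain ⟨p, T, hp⟩ := hd D k e he (by omega)
    obtain ⟨p', T', hp'⟩ := hd' D k e he (by omega)
    refine ⟨.seq p (.cond p'), T + (T' + 1), fun n G x a b ha h0 => ?_⟩
    have h1 := hp n G x a b ha h0
    simp only [Polynomial.eval_add, Polynomial.eval_one]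
    by_cases hP : P n G x
    · refine (h1.seq (Prog.Run.cond_true (by simp [hP]) (hp' n G x a _ ha h0))).to ?_
      simp [hP]
    · refine (h1.seq ((Prog.Run.cond_false (by simp [hP])).mono (by omega))).to ?_
      simp [hP]
  | @ex ι P _ ih =>
    obtain ⟨d, hd⟩ := ih
    refine ⟨d + 1, fun D k e he hk => ?_⟩
    have hkD : k < D := by omega
    obtain ⟨p, T, hp⟩ := hd D (k + 1) (fun o => o.elim ⟨k, hkD⟩ e)
      (by
        rintro (_ | i)
        · simp
        · simpa using (he i).trans (Nat.lt_succ_self k))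
      (by omega)
    refine ⟨.ex ⟨k, hkD⟩ p, .X * (T + 4) + 3, fun n G x a b ha h0 => ?_⟩
    refine ((Prog.Run.ex (n := n) (h0 ⟨k, hkD⟩ le_rfl)
      (fun y => ∃ h : y < n, P n G fun o => o.elim ⟨y, h⟩ x) (fun y hy => hy.1) ?_).mono
      (t := n * (T.eval n + 4) + 3) ?_).to ?_
    · intro y hy b
      refine (hp n G (fun o => o.elim ⟨y, hy⟩ x) (Function.update a ⟨k, hkD⟩ y) b ?_ ?_).to ?_
      · rintro (_ | i)
        · simp
        · have : e i ≠ ⟨k, hkD⟩ := fun h => (he i).ne (congrArg Fin.val h)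
          simp [this, ha]
      · intro j hj
        have : j ≠ ⟨k, hkD⟩ := fun h => by
          have := congrArg Fin.val h
          simp only at this
          omega
        simp [this, h0 j (by omega)]
      · simp [hy]
    · simp
    · refine Prod.ext ?_ rfl
      simp only [decide_eq_decide]
      exact ⟨fun ⟨y, h, hP⟩ => ⟨⟨y, h⟩, hP⟩, fun ⟨y, hP⟩ => ⟨y, y.2, hP⟩⟩

/-! ### First-order properties can be decided in polynomial time -/

namespace Prog

variable {D n : ℕ} {b : Bool} {X N : Fin D → ℕ} {w inp aux : List Sym} {tmp k : ℕ}

/-- Push a symbol on the stacks `N i`, for `i` in a list. -/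
def pushN (l : List (Fin D)) : Prog (Stk D) :=
  l.foldr (fun i p => .seq (.push (.N i) none) p) .skip

theorem Run.pushN (l : List (Fin D)) :
    Run (pushN l) (b, mem inp aux tmp X N) (b, mem inp aux tmp X fun j => N j + l.count j)
      (l.length + 1) := by
  induction l generalizing N with
  | nil => exact Run.skip.mono (by simp)
  | cons i l ih =>
    refine ((Run.seq (Run.push.to (c'' := (b, mem inp aux tmp X (Function.update N i (N i + 1)))) ?_)
      ih).mono (by simp; omega)).to ?_
    · rw [← update_mem_N, List.replicate_succ]; rfl
    · refine Prod.ext rfl ?_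
      simp only
      congr 1
      funext j
      by_cases h : j = i
      · subst h; simp; omega
      · simp [h, List.count_cons_of_ne (Ne.symm h)]

/-- Empty the stacks `N i`, for `i` in a list. -/
def clearN (l : List (Fin D)) : Prog (Stk D) :=
  l.foldr (fun i p => .seq (.loop (.N i) (fun _ o => o.isSome) (.drop (.N i))) p) .skip

theorem Run.clearN (l : List (Fin D)) (hN : ∀ j, N j ≤ n) :
    Run (clearN l) (b, mem inp aux tmp X N) (b, mem inp aux tmp X fun j => if j ∈ l then 0 else N j)
      (l.length * (n * 2 + 1) + 1) := by
  induction l generalizing N with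
  | nil => exact (Run.skip.mono (by simp)).to (by simp)
  | cons i l ih =>
    have h1 := Run.loop (p := .drop (.N i)) (k := Stk.N i) (g := fun _ o => o.isSome) (t := 1)
      (fun s => (b, mem inp aux tmp X (Function.update N i (N i - s)))) (N i)
      (fun s hs => by
        obtain ⟨m, hm⟩ : ∃ m, N i - s = m + 1 := ⟨N i - s - 1, by omega⟩
        refine ⟨by simp [mem, hm, List.replicate_succ], Run.drop.to (Prod.ext rfl ?_)⟩
        simp only
        rw [show N i - (s + 1) = m by omega, ← Function.update_idem (a := i) (N i - s) m N,
          ← update_mem_N]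
        simp [hm, update_mem_N])
      (by simp [mem])
    simp only [Nat.sub_zero, Function.update_eq_self, Nat.sub_self] at h1
    refine ((Run.seq h1 (ih (N := Function.update N i 0) fun j => ?_)).mono ?_).to ?_
    · by_cases h : j = i <;> simp [h, hN]
    · have := hN i
      rw [List.length_cons, Nat.succ_mul]
      omega
    · refine Prod.ext rfl ?_
      simp only
      congr 1
      funext j
      by_cases h : j = i
      · subst h; simp
      · simp [h]

/-- Determine the order `n` of the graph, and put `n` symbols on each of the stacks `N i`. -/
def countRows : Prog (Stk D) :=
  .seq (.loop .inp (fun _ o => o.isSome)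
    (.seq (.test .inp fun _ o => o == some none)
      (.seq (.move .inp .aux) (.cond (pushN (List.finRange D)))))) rewind

theorem Run.countRows :
    ∃ b', Run (countRows (D := D)) (false, mem w [] 0 X fun _ => 0)
      (b', mem w [] 0 X fun _ => w.count none) (w.length * (D + 7) + 2) := by
  have h1 := Run.loop (p := .seq (.test .inp fun _ o => o == some none)
      (.seq (.move .inp .aux) (.cond (Prog.pushN (List.finRange D))))) (k := Stk.inp)
    (g := fun _ o => o.isSome) (t := D + 4)
    (fun k => (decide (k ≠ 0 ∧ w[k - 1]? = some none),
      mem (w.drop k) (w.take k).reverse 0 X fun _ => (w.take k).count none)) w.length ?_ ?_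
  · simp only [List.drop_zero, List.take_zero, List.reverse_nil, List.count_nil, ne_eq, not_true,
      false_and, decide_false] at h1
    have h2 := Run.seq h1 (Run.rewind (w := w) (k := w.length) le_rfl)
    rw [List.take_length] at h2
    exact ⟨_, h2.mono (by linarith [Nat.mul_add w.length (D + 4 + 1) 2])⟩
  · intro s hs
    have hw : w[s]? = some w[s] := List.getElem?_eq_getElem hs
    refine ⟨by simp [mem, hs], ?_⟩
    refine (Run.seq (t := 1) (t' := 1 + (D + 2)) (Run.test.to (c'' := (decide (w[s] = none),
        mem (w.drop s) (w.take s).reverse 0 X fun _ => (w.take s).count none)) ?_)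
      (Run.seq (Run.move_inp_aux hs) ?_)).mono (by omega)
    · refine Prod.ext ?_ rfl
      simp only [mem, List.head?_drop, hw]
      rcases w[s] with _ | _ <;> rfl
    · by_cases h : w[s] = none
      · refine (Run.cond_true (by simp [h]) (Run.pushN _)).to ?_ |>.mono (by simp)
        simp [hw, h, List.take_succ_eq_append_getElem hs,
          List.count_eq_one_of_mem (List.nodup_finRange D) (List.mem_finRange _)]
      · have ht : (w.take (s + 1)).count none = (w.take s).count none := by
          rw [List.take_succ_eq_append_getElem hs, List.count_append,
            List.count_eq_zero_of_not_mem (l := [w[s]]) (by simpa using Ne.symm h), Nat.add_zero]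
        refine (Run.cond_false (by simp [h])).mono (by omega) |>.to ?_
        rw [ht]
        simp [hw, h]
  · simp [mem]

end Prog

theorem count_none_encodeGraph {n : ℕ} (G : SimpleGraph (Fin n)) :
    (encodeGraph G).count none = n := by
  have h : ∀ i, (encodeRow G i).count none = 1 := fun i => by
    rw [encodeRow, List.count_append, List.count_eq_zero_of_not_mem (by simp)]
    rfl
  rw [encodeGraph_eq, List.count_flatMap]
  simp [Function.comp_def, h]

/-- The machine that runs a program on the input and outputs the final value of the register. -/
def Prog.machine {D : ℕ} (p : Prog (Stk D)) : Turing.FinTM2 where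
  K := Option (Stk D)
  k₀ := some .inp
  k₁ := none
  Γ := Prog.Alphabet (Stk D)
  Λ := Option (Prog.Lab p)
  main := some p.entry
  ΛFin := @instFintypeOption _ (Prog.fintypeLab p)
  σ := Prog.State
  initialState := (false, none)
  Γk₀Fin := inferInstanceAs (Fintype Sym)
  m := fun l => match l with
    | some l => p.code some none l
    | none => .push none (fun s => s.1) (.load (fun _ => (false, none)) .halt)

theorem Prog.Run.outputs {D : ℕ} {p : Prog (Stk D)} {w : List Sym} {b : Bool} {t : ℕ}
    (h : Prog.Run p (false, mem w [] 0 0 0) (b, mem [] [] 0 0 0) t) :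
    Nonempty (Turing.TM2OutputsInTime p.machine w (some [b]) (t + 1)) := by
  obtain ⟨s, hs, e⟩ := h _ p.machine.m some none fun l => rfl
  refine ⟨⟨⟨1 + s, ?_⟩, (by omega : 1 + s ≤ t + 1)⟩⟩
  have h0 : Turing.initList p.machine w =
      ⟨some (some p.entry), (false, none), Prog.toStk (mem w [] 0 0 0)⟩ := by
    unfold Turing.initList
    congr 1
    funext k
    rcases k with _ | k
    · rfl
    · cases k <;> rfl
  have h1 : Turing.haltList p.machine [b] =
      ⟨none, (false, none), Function.update (Prog.toStk (mem [] [] 0 0 0)) none [b]⟩ := by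
    unfold Turing.haltList
    congr 1
    funext k
    rcases k with _ | k
    · rfl
    · cases k <;> rfl
  rw [h0, Option.map_some, h1, Function.iterate_add_apply]
  refine (congrArg _ e).trans ?_
  rfl

theorem eval_mono (T : Polynomial ℕ) {m n : ℕ} (h : m ≤ n) : T.eval m ≤ T.eval n := by
  induction T using Polynomial.induction_on' with
  | add p q hp hq => simpa using Nat.add_le_add hp hq
  | monomial k a => simpa using Nat.mul_le_mul_left a (Nat.pow_le_pow_left h k)

/-- A property of graphs that is equivalent, under the promise `C`, to a first-order sentence can be
decided in polynomial time. -/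
theorem FirstOrder.decidableInPolyTime {C P : ∀ n : ℕ, SimpleGraph (Fin n) → Prop}
    {Q : ∀ n : ℕ, SimpleGraph (Fin n) → (Empty → Fin n) → Prop} (hQ : FirstOrder Empty Q)
    (h : ∀ n G, C n G → (P n G ↔ Q n G Empty.elim)) : DecidableInPolyTime C P := by
  classical
  obtain ⟨D, hD⟩ := hQ.exists_prog
  obtain ⟨p, T, hp⟩ := hD D 0 Empty.elim (fun i => i.elim) (by omega)
  let q : Prog (Stk D) := .seq .countRows (.seq p (.seq
    (.loop .inp (fun _ o => o.isSome) (.drop .inp)) (.clearN (List.finRange D))))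
  let T' : Polynomial ℕ := .X * (Polynomial.C D + 7) + 2 + (T + (.X * 2 + 1 +
    (Polynomial.C D * (.X * 2 + 1) + 1))) + 1
  have key : ∀ (n : ℕ) (G : SimpleGraph (Fin n)), C n G →
      Nonempty (Turing.TM2OutputsInTime q.machine (encodeGraph G) (some [decide (P n G)])
        (T'.eval (encodeGraph G).length)) := by
    intro n G hG
    set w := encodeGraph G with hw
    have hn : n ≤ w.length := by
      rw [hw, length_encodeGraph]; exact Nat.le_mul_of_pos_right n (Nat.succ_pos n)
    obtain ⟨b', h1⟩ := Prog.Run.countRows (D := D) (w := w) (X := 0)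
    rw [hw, count_none_encodeGraph, ← hw] at h1
    have h2 := hp n G Empty.elim 0 b' (fun i => i.elim) (fun j _ => rfl)
    rw [← h n G hG] at h2
    simp only [Pi.zero_apply, Nat.sub_zero] at h2
    have h3 := Prog.Run.loop (p := .drop .inp) (k := Stk.inp) (g := fun _ o => o.isSome) (t := 1)
      (fun s => (decide (P n G), mem (D := D) (w.drop s) [] 0 0 fun _ => n)) w.length
      (fun s hs => ⟨by simp [mem, hs], Prog.Run.drop.to (Prod.ext rfl (by
        rw [update_mem_inp]; simp [mem]))⟩) (by simp [mem])
    simp only [List.drop_zero, List.drop_length] at h3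
    have h4 := Prog.Run.clearN (b := decide (P n G)) (inp := []) (aux := []) (tmp := 0) (X := 0)
      (n := n) (List.finRange D) (N := fun _ => n) fun _ => le_rfl
    simp only [List.mem_finRange, if_true, List.length_finRange] at h4
    have h5 := (h1.seq (h2.seq (h3.seq h4))).outputs
    obtain ⟨h6⟩ := h5
    refine ⟨⟨h6.toEvalsTo, h6.steps_le_m.trans ?_⟩⟩
    have hT := eval_mono T hn
    have : D * (n * 2 + 1) ≤ D * (w.length * 2 + 1) := Nat.mul_le_mul_left _ (by omega)
    simp only [T', Polynomial.eval_add, Polynomial.eval_mul, Polynomial.eval_X, Polynomial.eval_C,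
      Polynomial.eval_one, Polynomial.eval_ofNat]
    omega
  refine ⟨⟨⟨q.machine, Equiv.refl _, Equiv.refl _⟩, T', fun G => ?_⟩⟩
  have := Classical.choice (key G.1.1 G.1.2 G.2)
  have e : (encodeGraph G.1.2).map (Equiv.refl Sym).invFun = encodeGraph G.1.2 := List.map_id _
  exact e.symm ▸ this

/-! ### Exchanging parts of independent sets -/

/-- There are no closed walks of length three or five, and no cycles of length four: the only
consequence of girth at least six that is used. -/
structure NoShortCycle {V : Type*} (G : SimpleGraph V) : Prop where
  tri : ∀ {a b c}, G.Adj a b → G.Adj b c → G.Adj c a → False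
  quad : ∀ {a b c d}, G.Adj a b → G.Adj b c → G.Adj c d → G.Adj d a → a ≠ c → b ≠ d → False
  pent : ∀ {a b c d e}, G.Adj a b → G.Adj b c → G.Adj c d → G.Adj d e → G.Adj e a → False

section

variable {V : Type*} (G : SimpleGraph V)

/-- A finite set of vertices is independent. -/
def Indep (J : Finset V) : Prop := ∀ x ∈ J, ∀ y ∈ J, ¬ G.Adj x y

/-- The vertex `x` lies in the closed neighbourhood of the set `J`. -/
def Dom (J : Finset V) (x : V) : Prop := x ∈ J ∨ ∃ y ∈ J, G.Adj x y

/-- In the subgraph induced by `A`, the sizes of a maximal and of any independent set differ by at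
most `g`. For `g = 0` this says that the subgraph is well-covered. -/
def GapLE (g : ℕ) (A : Finset V) : Prop :=
  ∀ S ⊆ A, ∀ T ⊆ A, Indep G S → Indep G T → (∀ x ∈ A, Dom G S x) → T.card ≤ S.card + g

variable {G} {g : ℕ} {A J J' : Finset V} {x y z : V}

theorem Dom.mono (h : Dom G J x) (hJ : J ⊆ J') : Dom G J' x :=
  h.imp (fun h => hJ h) fun ⟨y, hy, h⟩ => ⟨y, hJ hy, h⟩

variable [DecidableEq V]

theorem indep_insert : Indep G (insert x J) ↔ (∀ y ∈ J, ¬ G.Adj x y) ∧ Indep G J := by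
  constructor
  · exact fun h => ⟨fun y hy => h x (by simp) y (by simp [hy]),
      fun a ha b hb => h a (by simp [ha]) b (by simp [hb])⟩
  · rintro ⟨h1, h2⟩ a ha b hb hab
    rcases Finset.mem_insert.1 ha with rfl | ha
    · rcases Finset.mem_insert.1 hb with rfl | hb
      · exact G.loopless.irrefl _ hab
      · exact h1 b hb hab
    · rcases Finset.mem_insert.1 hb with hbx | hb
      · exact h1 a ha (hbx ▸ hab.symm)
      · exact h2 a ha b hb hab

omit [DecidableEq V] in
theorem indep_singleton : Indep G {x} := by
  intro a ha b hb
  rw [Finset.mem_singleton] at ha hb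
  subst ha hb
  exact G.loopless.irrefl _

theorem dom_insert : Dom G (insert x J) y ↔ y = x ∨ G.Adj y x ∨ Dom G J y := by
  simp only [Dom, Finset.mem_insert, exists_eq_or_imp]
  tauto

omit [DecidableEq V] in
theorem dom_singleton : Dom G {x} y ↔ y = x ∨ G.Adj y x := by
  simp [Dom]

theorem dom_union : Dom G (J ∪ J') y ↔ Dom G J y ∨ Dom G J' y := by
  simp only [Dom, Finset.mem_union, or_and_right, exists_or]
  exact or_or_or_comm

theorem Indep.exists_maximal (hJ : Indep G J) (hA : J ⊆ A) :
    ∃ S, J ⊆ S ∧ S ⊆ A ∧ Indep G S ∧ ∀ x ∈ A, Dom G S x := by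
  classical
  obtain ⟨S, hJS, hS⟩ := Finset.exists_le_maximal (A.powerset.filter fun S => Indep G S)
    (a := J) (by simp [hJ, hA])
  have hS1 := hS.prop
  simp only [Finset.mem_filter, Finset.mem_powerset] at hS1
  refine ⟨S, hJS, hS1.1, hS1.2, fun x hx => ?_⟩
  by_contra hd
  simp only [Dom, not_or, not_exists, not_and] at hd
  have : insert x S ≤ S := hS.le_of_ge
    (by simpa [Finset.insert_subset_iff, hx, hS1.1] using indep_insert.2 ⟨hd.2, hS1.2⟩)
    (Finset.subset_insert x S)
  exact hd.1 (this (by simp))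

/-- If every maximal independent set has nearly maximum size, then replacing `J` by a set `J'` whose
closed neighbourhood is not larger gains little. -/
theorem GapLE.swap (h : GapLE G g A) (hJ : Indep G J) (hJ' : Indep G J') (hJA : J ⊆ A)
    (hJA' : J' ⊆ A) (hd : ∀ x ∈ A, Dom G J' x → Dom G J x) : J'.card ≤ J.card + g := by
  obtain ⟨S, hJS, hSA, hS, hdom⟩ := hJ.exists_maximal hJA
  have hdisj : ∀ s ∈ S \ J, ¬ Dom G J' s := by
    intro s hs hs'
    rw [Finset.mem_sdiff] at hs
    rcases hd s (hSA hs.1) hs' with h | ⟨y, hy, h⟩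
    · exact hs.2 h
    · exact hS s hs.1 y (hJS hy) h
  have hind : Indep G ((S \ J) ∪ J') := by
    intro a ha b hb hab
    rw [Finset.mem_union] at ha hb
    rcases ha with ha | ha <;> rcases hb with hb | hb
    · exact hS a (Finset.sdiff_subset ha) b (Finset.sdiff_subset hb) hab
    · exact hdisj a ha (Or.inr ⟨b, hb, hab⟩)
    · exact hdisj b hb (Or.inr ⟨a, ha, hab.symm⟩)
    · exact hJ' a ha b hb hab
  have := h S hSA _ (Finset.union_subset (Finset.sdiff_subset.trans hSA) hJA') hS hind hdom
  rw [Finset.card_union_of_disjoint (Finset.disjoint_left.2 fun a ha ha' => hdisj a ha (Or.inl ha')),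
    Finset.card_sdiff_of_subset hJS] at this
  have := Finset.card_le_card hJS
  omega

variable [DecidableRel G.Adj]

variable (G A z) in
/-- The vertices of `A` outside the closed neighbourhood of `z`. -/
def del : Finset V := A.filter fun x => x ≠ z ∧ ¬ G.Adj z x

theorem mem_del : x ∈ del G A z ↔ x ∈ A ∧ x ≠ z ∧ ¬ G.Adj z x := Finset.mem_filter

theorem GapLE.remove (h : GapLE G g A) (hz : z ∈ A) : GapLE G g (del G A z) := by
  intro S hS T hT hiS hiT hd
  have key : ∀ S ⊆ del G A z, Indep G S →
      Indep G (insert z S) ∧ insert z S ⊆ A ∧ (insert z S).card = S.card + 1 := by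
    intro S hS hi
    refine ⟨indep_insert.2 ⟨fun y hy => (mem_del.1 (hS hy)).2.2, hi⟩,
      Finset.insert_subset hz fun y hy => (mem_del.1 (hS hy)).1,
      Finset.card_insert_of_notMem fun hy => (mem_del.1 (hS hy)).2.1 rfl⟩
  obtain ⟨h1, h2, h3⟩ := key S hS hiS
  obtain ⟨h1', h2', h3'⟩ := key T hT hiT
  have := h _ h2 _ h2' h1 h1' fun x hx => by
    rw [dom_insert]
    by_cases hxz : x = z
    · exact Or.inl hxz
    by_cases hxz' : G.Adj z x
    · exact Or.inr (Or.inl hxz'.symm)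
    exact Or.inr (Or.inr (hd x (mem_del.2 ⟨hx, hxz, hxz'⟩)))
  omega

end

/-! ### Well-covered graphs of girth at least six -/

section

variable {V : Type*} (G : SimpleGraph V) (A : Finset V)

/-- The vertex `w` is the only neighbour of `x` in `A`. -/
def Nb1 (x w : V) : Prop := ∀ q, q ∈ A ∧ G.Adj x q ↔ q = w

/-- The vertices `y` and `z` are the only neighbours of `x` in `A`. -/
def Nb2 (x y z : V) : Prop := y ≠ z ∧ ∀ q, q ∈ A ∧ G.Adj x q ↔ q = y ∨ q = z

/-- The vertex `x` has at least two neighbours in `A`. -/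
def Two (x : V) : Prop := ∃ y z, y ≠ z ∧ (y ∈ A ∧ G.Adj x y) ∧ z ∈ A ∧ G.Adj x z

/-- The vertex `x` of `A` has at least two neighbours in `A`, and none of its neighbours is a leaf of
the subgraph induced by `A`. -/
def Leafless (x : V) : Prop := x ∈ A ∧ Two G A x ∧ ∀ y ∈ A, G.Adj x y → Two G A y

variable {G} {A} {x y z w q : V}

theorem Nb2.symm (h : Nb2 G A x y z) : Nb2 G A x z y :=
  ⟨h.1.symm, fun q => (h.2 q).trans or_comm⟩

theorem Nb2.left (h : Nb2 G A x y z) : y ∈ A ∧ G.Adj x y := (h.2 y).2 (Or.inl rfl)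

theorem Nb2.right (h : Nb2 G A x y z) : z ∈ A ∧ G.Adj x z := (h.2 z).2 (Or.inr rfl)

theorem Nb2.two (h : Nb2 G A x y z) : Two G A x := ⟨y, z, h.1, h.left, h.right⟩

theorem Nb1.mem (h : Nb1 G A x w) : w ∈ A ∧ G.Adj x w := (h w).2 rfl

theorem Two.exists_ne (h : Two G A x) (y : V) : ∃ z ∈ A, G.Adj x z ∧ z ≠ y := by
  obtain ⟨a, b, hab, ha, hb⟩ := h
  by_cases h : a = y
  · exact ⟨b, hb.1, hb.2, fun hb => hab (h.trans hb.symm)⟩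
  · exact ⟨a, ha.1, ha.2, h⟩

theorem nb1_of_not_two (h : ¬ Two G A x) (hy : y ∈ A) (hxy : G.Adj x y) : Nb1 G A x y := by
  intro q
  constructor
  · intro hq
    by_contra hne
    exact h ⟨q, y, hne, hq, hy, hxy⟩
  · rintro rfl; exact ⟨hy, hxy⟩

theorem Nb1.not_two (h : Nb1 G A x w) : ¬ Two G A x := fun ⟨a, b, hab, ha, hb⟩ =>
  hab (((h a).1 ha).trans ((h b).1 hb).symm)

/-- In a well-covered graph, a vertex with at least two neighbours all of which have a further
neighbour has no neighbour `x₁` with a leaf `d`: otherwise one dominates all neighbours of `x` but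
`x₁` from outside, and then `x₁` may be exchanged for `x` and `d`. -/
theorem GapLE.false_of_leaf [DecidableEq V] (hG : NoShortCycle G) (hA : GapLE G 0 A) {x₁ d : V}
    (hx : x ∈ A) (hd : d ∈ A) (hxx : G.Adj x x₁) (hdx : Nb1 G A d x₁) (hne : x ≠ d)
    (h : ∀ y ∈ A, G.Adj x y → y ≠ x₁ → ∃ q ∈ A, G.Adj y q ∧ q ≠ x) : False := by
  classical
  choose! f hf using h
  set F := (A.filter fun y => G.Adj x y ∧ y ≠ x₁).image f with hF
  have hFmem : ∀ p ∈ F, ∃ y ∈ A, G.Adj x y ∧ y ≠ x₁ ∧ f y = p := by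
    intro p hp
    simp only [hF, Finset.mem_image, Finset.mem_filter] at hp
    obtain ⟨y, ⟨hy, h1, h2⟩, h3⟩ := hp
    exact ⟨y, hy, h1, h2, h3⟩
  have hdp : ∀ p ∈ A, p ≠ x₁ → ¬ G.Adj d p := fun p hp hne h => hne ((hdx p).1 ⟨hp, h⟩)
  have hx₁ := hdx.mem
  have hiF : Indep G F := by
    intro p hp q hq hpq
    obtain ⟨y, hy, hxy, hyx, rfl⟩ := hFmem p hp
    obtain ⟨y', hy', hxy', hyx', rfl⟩ := hFmem q hq
    exact hG.pent hxy (hf y hy hxy hyx).2.1 hpq (hf y' hy' hxy' hyx').2.1.symm hxy'.symm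
  have hxF : ∀ p ∈ F, ¬ G.Adj x p ∧ x ≠ p := by
    intro p hp
    obtain ⟨y, hy, hxy, hyx, rfl⟩ := hFmem p hp
    have := hf y hy hxy hyx
    exact ⟨fun h => hG.tri hxy this.2.1 h.symm, this.2.2.symm⟩
  have hx₁F : ∀ p ∈ F, ¬ G.Adj x₁ p ∧ p ≠ x₁ := by
    intro p hp
    refine ⟨fun h => ?_, fun h => (hxF p hp).1 (h ▸ hxx)⟩
    obtain ⟨y, hy, hxy, hyx, rfl⟩ := hFmem p hp
    have := hf y hy hxy hyx
    exact hG.quad hxy this.2.1 h.symm hxx.symm this.2.2.symm hyx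
  have hFA : F ⊆ A := by
    intro p hp
    obtain ⟨y, hy, hxy, hyx, rfl⟩ := hFmem p hp
    exact (hf y hy hxy hyx).1
  have hdF : ∀ p ∈ F, ¬ G.Adj d p ∧ d ≠ p := by
    intro p hp
    exact ⟨hdp p (hFA hp) (hx₁F p hp).2, fun h => (hx₁F p hp).1 (h ▸ hx₁.2.symm)⟩
  have hxd : ¬ G.Adj x d := fun h => hdp x hx hxx.ne h.symm
  have := hA.swap (J := insert x₁ F) (J' := insert x (insert d F))
    (indep_insert.2 ⟨fun p hp => (hx₁F p hp).1, hiF⟩)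
    (indep_insert.2 ⟨?_, indep_insert.2 ⟨fun p hp => (hdF p hp).1, hiF⟩⟩)
    (Finset.insert_subset hx₁.1 hFA)
    (Finset.insert_subset hx (Finset.insert_subset hd hFA)) ?_
  · rw [Finset.card_insert_of_notMem, Finset.card_insert_of_notMem] at this
    · have := Finset.card_insert_le x₁ F
      omega
    · exact fun h => (hdF d h).2 rfl
    · rw [Finset.mem_insert]
      rintro (h | h)
      · exact hne h
      · exact (hxF x h).2 rfl
  · intro p hp
    rcases Finset.mem_insert.1 hp with rfl | hp
    · exact hxd
    · exact (hxF p hp).1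
  · intro p hp
    simp only [dom_insert]
    rintro (rfl | h | rfl | h | h)
    · exact Or.inr (Or.inl hxx)
    · by_cases hpx : p = x₁
      · exact Or.inl hpx
      · refine Or.inr (Or.inr (Or.inr ⟨f p, ?_, (hf p hp h.symm hpx).2.1⟩))
        exact Finset.mem_image.2 ⟨p, Finset.mem_filter.2 ⟨hp, h.symm, hpx⟩, rfl⟩
    · exact Or.inr (Or.inl hx₁.2)
    · exact Or.inl ((hdx p).1 ⟨hp, h.symm⟩)
    · exact Or.inr (Or.inr h)

theorem Leafless.adj [DecidableEq V] (hG : NoShortCycle G) (hA : GapLE G 0 A)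
    (hx : Leafless G A x) (hy : y ∈ A) (hxy : G.Adj x y) : Leafless G A y := by
  refine ⟨hy, hx.2.2 y hy hxy, fun d hd hyd => ?_⟩
  by_contra hd2
  have hdx : x ≠ d := by rintro rfl; exact hd2 hx.2.1
  exact hA.false_of_leaf hG hx.1 hd hxy (nb1_of_not_two hd2 hy hyd.symm) hdx fun p hp hxp _ =>
    let ⟨q, hq, hpq, hne⟩ := (hx.2.2 p hp hxp).exists_ne x
    ⟨q, hq, hpq, hne⟩

end

section

variable {V : Type*} {G : SimpleGraph V} {A : Finset V} {x y z w q : V}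

variable (G A) in
/-- The vertices `c 0`, …, `c 6` form a cycle of length seven that is a component of the subgraph
induced by `A`. -/
def IsC7 (c : ZMod 7 → V) : Prop := ∀ i, Nb2 G A (c i) (c (i - 1)) (c (i + 1))

variable (G A) in
/-- The component of `x` in the subgraph induced by `A` is a cycle of length seven. -/
def InC7 (x : V) : Prop := ∃ c, IsC7 G A c ∧ ∃ i, c i = x

theorem zmod7_cases (i j : ZMod 7) : i = j ∨ (j = i + 1 ∨ i = j + 1) ∨
    (j = i + 1 + 1 ∨ i = j + 1 + 1) ∨ j = i + 1 + 1 + 1 ∨ i = j + 1 + 1 + 1 := by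
  revert i j; decide

namespace IsC7

variable {c : ZMod 7 → V}

theorem adj (h : IsC7 G A c) (i : ZMod 7) : G.Adj (c i) (c (i + 1)) := (h i).right.2

theorem mem (h : IsC7 G A c) (i : ZMod 7) : c i ∈ A := by
  simpa using (h (i - 1)).right.1

theorem shift (h : IsC7 G A c) (k : ZMod 7) : IsC7 G A fun i => c (i + k) := fun i => by
  have := h (i + k)
  rwa [show i + k - 1 = i - 1 + k by ring, show i + k + 1 = i + 1 + k by ring] at this

theorem neg (h : IsC7 G A c) : IsC7 G A fun i => c (-i) := fun i => by
  have := (h (-i)).symm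
  rwa [show -i + 1 = -(i - 1) by ring, show -i - 1 = -(i + 1) by ring] at this

theorem injective (hG : NoShortCycle G) (h : IsC7 G A c) : Function.Injective c := by
  have h2 : ∀ i, c i ≠ c (i + 1 + 1) := fun i => by simpa using (h (i + 1)).1
  have h3 : ∀ i, c i ≠ c (i + 1 + 1 + 1) := fun i e =>
    hG.tri (h.adj i) (h.adj (i + 1)) (e ▸ h.adj (i + 1 + 1))
  intro i j hij
  rcases zmod7_cases i j with h' | (rfl | rfl) | (rfl | rfl) | rfl | rfl
  · exact h'
  · exact ((h.adj i).ne hij).elim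
  · exact ((h.adj j).ne hij.symm).elim
  · exact (h2 i hij).elim
  · exact (h2 j hij.symm).elim
  · exact (h3 i hij).elim
  · exact (h3 j hij.symm).elim

/-- A vertex outside a cycle of length seven has at most one neighbour on it. -/
theorem touch (hG : NoShortCycle G) (h : IsC7 G A c) {r : V} (hr : ∀ i, r ≠ c i) {i j : ZMod 7}
    (hi : G.Adj r (c i)) (hj : G.Adj r (c j)) : i = j := by
  rcases zmod7_cases i j with h' | (rfl | rfl) | (rfl | rfl) | rfl | rfl
  · exact h'
  · exact (hG.tri hi (h.adj i) hj.symm).elim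
  · exact (hG.tri hj (h.adj j) hi.symm).elim
  · exact (hG.quad hi (h.adj i) (h.adj (i + 1)) hj.symm (hr _)
      (by simpa using (h (i + 1)).1)).elim
  · exact (hG.quad hj (h.adj j) (h.adj (j + 1)) hi.symm (hr _)
      (by simpa using (h (j + 1)).1)).elim
  · exact (hG.pent hi (h.adj i) (h.adj (i + 1)) (h.adj (i + 1 + 1)) hj.symm).elim
  · exact (hG.pent hj (h.adj j) (h.adj (j + 1)) (h.adj (j + 1 + 1)) hi.symm).elim

end IsC7

theorem InC7.adj (h : InC7 G A x) (hy : y ∈ A) (hxy : G.Adj x y) : InC7 G A y := by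
  obtain ⟨c, hc, i, rfl⟩ := h
  rcases ((hc i).2 y).1 ⟨hy, hxy⟩ with rfl | rfl
  · exact ⟨c, hc, _, rfl⟩
  · exact ⟨c, hc, _, rfl⟩

variable [DecidableEq V] [DecidableRel G.Adj]

/-- A vertex at distance two from `z` has only one common neighbour with `z`; so if it becomes a leaf
when the closed neighbourhood of `z` is removed, its degree was two. -/
theorem exists_nb2_of_del (hG : NoShortCycle G) {l : V} (hl : l ∈ del G A z) (h2 : Two G A l)
    (hd : ¬ Two G (del G A z) l) :
    ∃ r w, Nb2 G A l r w ∧ G.Adj z r ∧ Nb1 G (del G A z) l w := by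
  have hlz := (mem_del.1 hl).2
  have hu : ∀ a b, G.Adj l a → G.Adj l b → G.Adj z a → G.Adj z b → a = b := by
    intro a b hla hlb hza hzb
    by_contra hne
    exact hG.quad hza hla.symm hlb hzb.symm (Ne.symm hlz.1) hne
  have hm : ∀ q, q ∈ A ∧ G.Adj l q → G.Adj z q ∨ q ∈ del G A z ∧ G.Adj l q := by
    rintro q ⟨hq, hlq⟩
    by_cases h : G.Adj z q
    · exact Or.inl h
    · exact Or.inr ⟨mem_del.2 ⟨hq, by rintro rfl; exact hlz.2 hlq.symm, h⟩, hlq⟩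
  have key : ∀ a b, a ≠ b → G.Adj z a → a ∈ A ∧ G.Adj l a → b ∈ del G A z ∧ G.Adj l b →
      ∃ r w, Nb2 G A l r w ∧ G.Adj z r ∧ Nb1 G (del G A z) l w := by
    intro a b hab hza ha hb
    have h1 := nb1_of_not_two hd hb.1 hb.2
    refine ⟨a, b, ⟨hab, fun q => ⟨fun hq => ?_, ?_⟩⟩, hza, h1⟩
    · rcases hm q hq with h | h
      · exact Or.inl (hu q a hq.2 ha.2 h hza)
      · exact Or.inr ((h1 q).1 h)
    · rintro (rfl | rfl)
      · exact ha
      · exact ⟨(mem_del.1 hb.1).1, hb.2⟩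
  obtain ⟨a, b, hab, ha, hb⟩ := h2
  rcases hm a ha with h | h <;> rcases hm b hb with h' | h'
  · exact (hab (hu a b ha.2 hb.2 h h')).elim
  · exact key a b hab h ha h'
  · exact key b a hab.symm h' hb h
  · exact (hd ⟨a, b, hab, h, h'⟩).elim

/-- In a leafless component one finds a vertex of degree two: when a vertex `u` is removed with its
neighbours, the vertices at distance two lose one neighbour, and so a leaf of what remains has degree
two; if there is no such leaf nearby, there is a cycle of length seven by induction. -/
theorem exists_nb2_of_leafless (hG : NoShortCycle G) (hA : GapLE G 0 A)
    (ih : ∀ z ∈ A, ∀ u, Leafless G (del G A z) u → InC7 G (del G A z) u) {u : V}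
    (hu : Leafless G A u) :
    ∃ z, Leafless G A z ∧ (∃ y y', Nb2 G A z y y') ∧ (InC7 G A z → InC7 G A u) := by
  obtain ⟨r, _, -, ⟨hr, hur⟩, -⟩ := hu.2.1
  have hrL := hu.adj hG hA hr hur
  obtain ⟨d, hd, hrd, hdu⟩ := hrL.2.1.exists_ne u
  have hdL := hrL.adj hG hA hd hrd
  have hdd : d ∈ del G A u := mem_del.2 ⟨hd, hdu, fun h => hG.tri hur hrd h.symm⟩
  have hback : InC7 G A d → InC7 G A u := fun h => (h.adj hr hrd.symm).adj hu.1 hur.symm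
  by_cases h2 : Two G (del G A u) d
  · by_cases hl : ∀ l ∈ del G A u, G.Adj d l → Two G (del G A u) l
    · obtain ⟨c, hc, i, rfl⟩ := ih u hu.1 d ⟨hdd, h2, hl⟩
      have he := hc (i + 1)
      rw [add_sub_cancel_right] at he
      have heA : c (i + 1) ∈ A := (mem_del.1 (hc.mem _)).1
      refine ⟨c (i + 1), hdL.adj hG hA heA (hc.adj i), ⟨_, _, he.1, fun q => ?_⟩,
        fun h => hback (h.adj hd (hc.adj i).symm)⟩
      rw [← he.2 q]
      refine ⟨fun ⟨hq, hqe⟩ => ⟨mem_del.2 ⟨hq, ?_, fun huq => ?_⟩, hqe⟩, fun ⟨hq, hqe⟩ =>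
        ⟨(mem_del.1 hq).1, hqe⟩⟩
      · rintro rfl
        exact (mem_del.1 (hc.mem (i + 1))).2.2 hqe.symm
      · exact hG.pent hur hrd (hc.adj i) hqe huq.symm
    · push Not at hl
      obtain ⟨l, hl, hdl, h2l⟩ := hl
      have hlA := (mem_del.1 hl).1
      have hlL := hdL.adj hG hA hlA hdl
      obtain ⟨r', w, h, -⟩ := exists_nb2_of_del hG hl hlL.2.1 h2l
      exact ⟨l, hlL, ⟨_, _, h⟩, fun h => hback (h.adj hd hdl.symm)⟩
  · obtain ⟨r', w, h, -⟩ := exists_nb2_of_del hG hdd hdL.2.1 h2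
    exact ⟨d, hdL, ⟨_, _, h⟩, hback⟩

section C7

variable {c : ZMod 7 → V} {r r' : V}

theorem nb_of_isC7_del (hz : Nb2 G A z r r') (hc : IsC7 G (del G A z) c) (i j k : ZMod 7)
    (hj : i - 1 = j) (hk : i + 1 = k) (x : V) (hx : x ∈ A) (hxc : G.Adj x (c i)) :
    x = c j ∨ x = c k ∨ (x = r ∧ G.Adj r (c i)) ∨ x = r' ∧ G.Adj r' (c i) := by
  subst hj hk
  by_cases hzx : G.Adj z x
  · rcases (hz.2 x).1 ⟨hx, hzx⟩ with rfl | rfl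
    · exact Or.inr (Or.inr (Or.inl ⟨rfl, hxc⟩))
    · exact Or.inr (Or.inr (Or.inr ⟨rfl, hxc⟩))
  · have hxd : x ∈ del G A z := mem_del.2 ⟨hx, by
      rintro rfl; exact (mem_del.1 (hc.mem i)).2.2 hxc, hzx⟩
    rcases ((hc i).2 x).1 ⟨hxd, hxc.symm⟩ with h | h
    · exact Or.inl h
    · exact Or.inr (Or.inl h)

/-- Let `z` have degree two in a well-covered graph. No neighbour of `z` is adjacent to a cycle of
length seven that is a component of the graph without the closed neighbourhood of `z`. -/
theorem GapLE.false_of_isC7_del (hG : NoShortCycle G) (hA : GapLE G 0 A)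
    (hz : Nb2 G A z r r') (hr' : Two G A r') (hc : IsC7 G (del G A z) c)
    (hr : G.Adj r (c 0)) : False := by
  have hzr := hz.left
  have hzr' := hz.right
  have hrA := hzr.1
  have hrA' := hzr'.1
  have hrr' : ¬ G.Adj r r' := fun h => hG.tri hzr.2 h hzr'.2.symm
  have hrne : r ≠ r' := hz.1
  have hcA : ∀ c' : ZMod 7 → V, IsC7 G (del G A z) c' → ∀ i, c' i ∈ A ∧ r ≠ c' i ∧ r' ≠ c' i :=
    fun c' hc' i => ⟨(mem_del.1 (hc'.mem i)).1, fun h => (mem_del.1 (hc'.mem i)).2.2 (h ▸ hzr.2),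
      fun h => (mem_del.1 (hc'.mem i)).2.2 (h ▸ hzr'.2)⟩
  -- The cycle of length seven induces no further edges.
  have hcc : ∀ c' : ZMod 7 → V, IsC7 G (del G A z) c' → ∀ i j, i ≠ j + 1 → j ≠ i + 1 →
      ¬ G.Adj (c' i) (c' j) := by
    intro c' hc' i j h1 h2 h
    rcases ((hc' i).2 (c' j)).1 ⟨hc'.mem j, h⟩ with h' | h'
    · exact h1 (by rw [hc'.injective hG h']; ring)
    · exact h2 (hc'.injective hG h')
  have ht : ∀ c' : ZMod 7 → V, IsC7 G (del G A z) c' → G.Adj r (c' 0) → ∀ i, i ≠ 0 →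
      ¬ G.Adj r (c' i) := fun c' hc' h0 i hi h =>
    hi (hc'.touch hG (fun i => (hcA c' hc' i).2.1) h h0)
  have ht' : ∀ c' : ZMod 7 → V, IsC7 G (del G A z) c' → ∀ j, G.Adj r' (c' j) → ∀ i, i ≠ j →
      ¬ G.Adj r' (c' i) := fun c' hc' j hj i hi h =>
    hi (hc'.touch hG (fun i => (hcA c' hc' i).2.2) h hj)
  -- If `r'` is adjacent to `c 2`, then `r'` and `c 0` leave the path `c 3`, `c 4`, `c 5`.
  have core2 : ∀ c' : ZMod 7 → V, IsC7 G (del G A z) c' → G.Adj r (c' 0) → ¬ G.Adj r' (c' 2) := by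
    intro c' hc' h0 h2
    have hne : ∀ i j, i ≠ j → c' i ≠ c' j := fun i j h => (hc'.injective hG).ne h
    have t := ht c' hc' h0
    have t' := ht' c' hc' 2 h2
    have n3 := nb_of_isC7_del hz hc' 3 2 4 (by decide) (by decide)
    have n5 := nb_of_isC7_del hz hc' 5 4 6 (by decide) (by decide)
    have a06 : G.Adj (c' 6) (c' 0) := hc'.adj 6
    have := hA.swap (J := {r', c' 0, c' 4}) (J' := {r', c' 0, c' 3, c' 5}) ?_ ?_ ?_ ?_ ?_
    · rw [Finset.card_insert_of_notMem (by simp [(hcA c' hc' _).2.2]),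
        Finset.card_insert_of_notMem (by
          simp [hne 0 3 (by decide), hne 0 5 (by decide)]),
        Finset.card_pair (hne 3 5 (by decide))] at this
      have := Finset.card_le_three (a := r') (b := c' 0) (c := c' 4)
      omega
    · simp only [indep_insert, indep_singleton, Finset.forall_mem_insert, Finset.mem_singleton,
        forall_eq]
      exact ⟨⟨t' 0 (by decide), t' 4 (by decide)⟩, hcc c' hc' _ _ (by decide) (by decide), trivial⟩
    · simp only [indep_insert, indep_singleton, Finset.forall_mem_insert, Finset.mem_singleton,
        forall_eq]
      exact ⟨⟨t' 0 (by decide), t' 3 (by decide), t' 5 (by decide)⟩,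
        ⟨hcc c' hc' _ _ (by decide) (by decide), hcc c' hc' _ _ (by decide) (by decide)⟩,
        hcc c' hc' _ _ (by decide) (by decide), trivial⟩
    · simp [Finset.insert_subset_iff, hrA', (hcA c' hc' _).1]
    · simp [Finset.insert_subset_iff, hrA', (hcA c' hc' _).1]
    · intro x hx
      have a43 : G.Adj (c' 3) (c' 4) := hc'.adj 3
      have a45 : G.Adj (c' 4) (c' 5) := hc'.adj 4
      simp only [dom_insert, dom_singleton]
      rintro (h | h | h | h | rfl | h | rfl | h)
      · tauto
      · tauto
      · tauto
      · tauto
      · tauto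
      · rcases n3 x hx h with rfl | rfl | ⟨-, h⟩ | ⟨-, h⟩
        · exact Or.inr (Or.inl h2.symm)
        · tauto
        · exact (t 3 (by decide) h).elim
        · exact (t' 3 (by decide) h).elim
      · have := a45.symm
        tauto
      · rcases n5 x hx h with rfl | rfl | ⟨-, h⟩ | ⟨-, h⟩
        · tauto
        · tauto
        · exact (t 5 (by decide) h).elim
        · exact (t' 5 (by decide) h).elim
  -- If `r'` is adjacent to `c 3`, then `r` and `r'` leave the path `c 4`, `c 5`, `c 6`.
  have core3 : ∀ c' : ZMod 7 → V, IsC7 G (del G A z) c' → G.Adj r (c' 0) → ¬ G.Adj r' (c' 3) := by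
    intro c' hc' h0 h3
    have hne : ∀ i j, i ≠ j → c' i ≠ c' j := fun i j h => (hc'.injective hG).ne h
    have t := ht c' hc' h0
    have t' := ht' c' hc' 3 h3
    have n4 := nb_of_isC7_del hz hc' 4 3 5 (by decide) (by decide)
    have n6 := nb_of_isC7_del hz hc' 6 5 0 (by decide) (by decide)
    have := hA.swap (J := {r, r', c' 5}) (J' := {r, r', c' 4, c' 6}) ?_ ?_ ?_ ?_ ?_
    · rw [Finset.card_insert_of_notMem (by simp [(hcA c' hc' _).2.1, hrne]),
        Finset.card_insert_of_notMem (by simp [(hcA c' hc' _).2.2]),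
        Finset.card_pair (hne 4 6 (by decide))] at this
      have := Finset.card_le_three (a := r) (b := r') (c := c' 5)
      omega
    · simp only [indep_insert, indep_singleton, Finset.forall_mem_insert, Finset.mem_singleton,
        forall_eq]
      exact ⟨⟨hrr', t 5 (by decide)⟩, t' 5 (by decide), trivial⟩
    · simp only [indep_insert, indep_singleton, Finset.forall_mem_insert, Finset.mem_singleton,
        forall_eq]
      exact ⟨⟨hrr', t 4 (by decide), t 6 (by decide)⟩, ⟨t' 4 (by decide), t' 6 (by decide)⟩,
        hcc c' hc' _ _ (by decide) (by decide), trivial⟩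
    · simp [Finset.insert_subset_iff, hrA, hrA', (hcA c' hc' _).1]
    · simp [Finset.insert_subset_iff, hrA, hrA', (hcA c' hc' _).1]
    · intro x hx
      have a45 : G.Adj (c' 4) (c' 5) := hc'.adj 4
      have a56 : G.Adj (c' 6) (c' 5) := (hc'.adj 5).symm
      simp only [dom_insert, dom_singleton]
      rintro (h | h | h | h | rfl | h | rfl | h)
      · tauto
      · tauto
      · tauto
      · tauto
      · tauto
      · rcases n4 x hx h with rfl | rfl | ⟨-, h⟩ | ⟨-, h⟩
        · have := h3.symm
          tauto
        · tauto
        · exact (t 4 (by decide) h).elim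
        · exact (t' 4 (by decide) h).elim
      · tauto
      · rcases n6 x hx h with rfl | rfl | ⟨-, h⟩ | ⟨-, h⟩
        · tauto
        · have := h0.symm
          tauto
        · exact (t 6 (by decide) h).elim
        · exact (t' 6 (by decide) h).elim
  have none : ∀ i, ¬ G.Adj r' (c i) := by
    have hneg : G.Adj r (c (-0)) := by rwa [neg_zero]
    have c2 := core2 c hc hr
    have c3 := core3 c hc hr
    have c5 := core2 _ hc.neg hneg
    have c4 := core3 _ hc.neg hneg
    have c0 : ¬ G.Adj r' (c 0) := fun h =>
      hG.quad hzr.2 hr h.symm hzr'.2.symm (mem_del.1 (hc.mem 0)).2.1.symm hrne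
    have c1 : ¬ G.Adj r' (c 1) := fun h =>
      hG.pent hzr.2 hr (hc.adj 0) h.symm hzr'.2.symm
    have c6 : ¬ G.Adj r' (c 6) := fun h =>
      hG.pent hzr'.2 h (hc.adj 6) hr.symm hzr.2.symm
    intro i
    have : ∀ i : ZMod 7, i = 0 ∨ i = 1 ∨ i = 2 ∨ i = 3 ∨ i = -3 ∨ i = -2 ∨ i = 6 := by decide
    rcases this i with rfl | rfl | rfl | rfl | rfl | rfl | rfl <;> assumption
  -- Otherwise `r`, `c 5` and a further neighbour of `r'` leave the path `c 1`, `c 2`, `c 3`.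
  obtain ⟨d, hd, hrd, hdz⟩ := hr'.exists_ne z
  have hdd : d ∈ del G A z := mem_del.2 ⟨hd, hdz, fun h => hG.tri hzr'.2 hrd h.symm⟩
  have hdc : ∀ i, ¬ G.Adj d (c i) := fun i h => by
    rcases ((hc i).2 d).1 ⟨hdd, h.symm⟩ with rfl | rfl
    · exact none _ hrd
    · exact none _ hrd
  have hdc' : ∀ i, d ≠ c i := fun i h => none i (h ▸ hrd)
  have hrd' : ¬ G.Adj r d := fun h => hG.quad hzr.2 h hrd.symm hzr'.2.symm hdz.symm hrne
  have hdr : r ≠ d := fun h => hrr' (h ▸ hrd.symm)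
  have hne : ∀ i j, i ≠ j → c i ≠ c j := fun i j h => (hc.injective hG).ne h
  have t := ht c hc hr
  have n1 := nb_of_isC7_del hz hc 1 0 2 (by decide) (by decide)
  have n3 := nb_of_isC7_del hz hc 3 2 4 (by decide) (by decide)
  have := hA.swap (J := {r, d, c 5, c 2}) (J' := {r, d, c 5, c 1, c 3}) ?_ ?_ ?_ ?_ ?_
  · rw [Finset.card_insert_of_notMem (by simp [(hcA c hc _).2.1, hdr]),
      Finset.card_insert_of_notMem (by simp [hdc']),
      Finset.card_insert_of_notMem (by simp [hne 5 1 (by decide), hne 5 3 (by decide)]),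
      Finset.card_pair (hne 1 3 (by decide))] at this
    have := Finset.card_le_four (a := r) (b := d) (c := c 5) (d := c 2)
    omega
  · simp only [indep_insert, indep_singleton, Finset.forall_mem_insert, Finset.mem_singleton,
      forall_eq]
    exact ⟨⟨hrd', t 5 (by decide), t 2 (by decide)⟩, ⟨hdc _, hdc _⟩,
      hcc c hc _ _ (by decide) (by decide), trivial⟩
  · simp only [indep_insert, indep_singleton, Finset.forall_mem_insert, Finset.mem_singleton,
      forall_eq]
    exact ⟨⟨hrd', t 5 (by decide), t 1 (by decide), t 3 (by decide)⟩, ⟨hdc _, hdc _, hdc _⟩,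
      ⟨hcc c hc _ _ (by decide) (by decide), hcc c hc _ _ (by decide) (by decide)⟩,
      hcc c hc _ _ (by decide) (by decide), trivial⟩
  · simp [Finset.insert_subset_iff, hrA, hd, (hcA c hc _).1]
  · simp [Finset.insert_subset_iff, hrA, hd, (hcA c hc _).1]
  · intro x hx
    have a12 : G.Adj (c 1) (c 2) := hc.adj 1
    have a32 : G.Adj (c 3) (c 2) := (hc.adj 2).symm
    have a45 : G.Adj (c 4) (c 5) := hc.adj 4
    simp only [dom_insert, dom_singleton]
    rintro (h | h | h | h | h | h | rfl | h | rfl | h)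
    · tauto
    · tauto
    · tauto
    · tauto
    · tauto
    · tauto
    · tauto
    · rcases n1 x hx h with rfl | rfl | ⟨-, h⟩ | ⟨-, h⟩
      · have := hr.symm
        tauto
      · tauto
      · exact (t 1 (by decide) h).elim
      · exact (none 1 h).elim
    · tauto
    · rcases n3 x hx h with rfl | rfl | ⟨-, h⟩ | ⟨-, h⟩
      · tauto
      · tauto
      · exact (t 3 (by decide) h).elim
      · exact (none 3 h).elim

end C7

/-- Let `l` be adjacent to a neighbour `r` of a vertex `z` of degree two, and a leaf with neighbour
`w` once the closed neighbourhood of `z` is removed. Then `w` has just one other neighbour, which in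
turn has such a leaf, adjacent to the other neighbour of `z`. -/
theorem GapLE.exists_next (hG : NoShortCycle G) (hA : GapLE G 0 A) {r r' l : V}
    (hzL : Leafless G A z) (hz : Nb2 G A z r r') (hl : l ∈ del G A z) (hlw : Nb2 G A l r w)
    (hw : w ∈ del G A z) :
    ∃ w' l', Nb2 G A w l w' ∧ Nb2 G A l' w' r' ∧ l' ∈ del G A z ∧ w' ∈ del G A z := by
  have hzr := hz.left
  have hzr' := hz.right
  have hrl := hlw.left.2.symm
  have hlw' := hlw.right.2
  have hlA := (mem_del.1 hl).1
  have hwA := (mem_del.1 hw).1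
  have hlL : Leafless G A l := (hzL.adj hG hA hzr.1 hzr.2).adj hG hA hlA hrl
  have hwL := hlL.adj hG hA hwA hlw'
  have hrw : ¬ G.Adj r w := fun h => hG.tri hrl hlw' h.symm
  have hrw' : ¬ G.Adj r' w := fun h => hG.pent hzr.2 hrl hlw' h.symm hzr'.2.symm
  have hwdel : ∀ q ∈ A, G.Adj w q → q ∈ del G A z := by
    intro q hq hwq
    refine mem_del.2 ⟨hq, ?_, fun hzq => ?_⟩
    · rintro rfl
      exact (mem_del.1 hw).2.2 hwq.symm
    · rcases (hz.2 q).1 ⟨hq, hzq⟩ with rfl | rfl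
      · exact hrw hwq.symm
      · exact hrw' hwq.symm
  have hl1 : Nb1 G (del G A z) l w := by
    intro q
    constructor
    · rintro ⟨hq, hlq⟩
      rcases (hlw.2 q).1 ⟨(mem_del.1 hq).1, hlq⟩ with rfl | rfl
      · exact ((mem_del.1 hq).2.2 hzr.2).elim
      · rfl
    · rintro rfl
      exact ⟨hw, hlw'⟩
  have key : ∀ w' ∈ A, G.Adj w w' → w' ≠ l → ∃ l', Nb2 G A l' w' r' ∧ l' ∈ del G A z ∧ l' ≠ w := by
    intro w' hw'A hww' hne
    have hw' := hwdel w' hw'A hww'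
    by_contra hno
    refine (hA.remove (hzL.1)).false_of_leaf hG hw' hl hww'.symm hl1 hne fun y hy hw'y hyw => ?_
    by_contra hq
    have hyA := (mem_del.1 hy).1
    have hyL := (hwL.adj hG hA hw'A hww').adj hG hA hyA hw'y
    have h2 : ¬ Two G (del G A z) y := fun h2 =>
      let ⟨q, h1, h2, h3⟩ := h2.exists_ne w'
      hq ⟨q, h1, h2, h3⟩
    obtain ⟨p, v, hpv, hzp, hv⟩ := exists_nb2_of_del hG hy hyL.2.1 h2
    obtain rfl := (hv w').1 ⟨hw', hw'y.symm⟩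
    rcases (hz.2 p).1 ⟨hpv.left.1, hzp⟩ with rfl | rfl
    · exact hG.pent hrl hlw' hww' hw'y hpv.left.2
    · exact hno ⟨y, hpv.symm, hy, hyw⟩
  obtain ⟨w', hw'A, hww', hne⟩ := hwL.2.1.exists_ne l
  obtain ⟨l', hl', hl'd, hl'w⟩ := key w' hw'A hww' hne
  refine ⟨w', l', ⟨hne.symm, fun q => ⟨fun ⟨hq, hwq⟩ => ?_, ?_⟩⟩, hl', hl'd, hwdel w' hw'A hww'⟩
  · by_contra hne2
    push Not at hne2
    obtain ⟨l₂, hl₂, hl₂d, hl₂w⟩ := key q hq hwq hne2.1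
    -- Now `r` and `r'` can be exchanged for `z`, `l'` and `l₂`.
    have hll : l' ≠ l₂ := by
      rintro rfl
      rcases (hl'.2 q).1 hl₂.left with h | rfl
      · exact hne2.2 h
      · exact hrw' hwq.symm
    have hadj : ∀ {l' w'}, Nb2 G A l' w' r' → l' ∈ del G A z → l' ≠ w → G.Adj w w' →
        ¬ G.Adj w l' := by
      intro l' w' hl' hl'd hl'w hww' h
      rcases (hl'.2 w).1 ⟨hwA, h.symm⟩ with rfl | rfl
      · exact hww'.ne rfl
      · exact (mem_del.1 hw).2.2 hzr'.2
    have := hA.swap (J := {w, r, r'}) (J' := {w, z, l', l₂}) ?_ ?_ ?_ ?_ ?_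
    · rw [Finset.card_insert_of_notMem
          (by simp [(mem_del.1 hw).2.1, hl'w.symm, hl₂w.symm]),
        Finset.card_insert_of_notMem
          (by simp [(mem_del.1 hl'd).2.1.symm, (mem_del.1 hl₂d).2.1.symm]),
        Finset.card_pair hll] at this
      have := Finset.card_le_three (a := w) (b := r) (c := r')
      omega
    · simp only [indep_insert, indep_singleton, Finset.forall_mem_insert, Finset.mem_singleton,
        forall_eq]
      exact ⟨⟨fun h => hrw h.symm, fun h => hrw' h.symm⟩,
        fun h => hG.tri hzr.2 h hzr'.2.symm, trivial⟩
    · simp only [indep_insert, indep_singleton, Finset.forall_mem_insert, Finset.mem_singleton,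
        forall_eq]
      exact ⟨⟨fun h => (mem_del.1 hw).2.2 h.symm, hadj hl' hl'd hl'w hww', hadj hl₂ hl₂d hl₂w hwq⟩,
        ⟨(mem_del.1 hl'd).2.2, (mem_del.1 hl₂d).2.2⟩,
        fun h => hG.tri hl'.right.2.symm h hl₂.right.2, trivial⟩
    · simp [Finset.insert_subset_iff, hwA, hzr.1, hzr'.1]
    · simp [Finset.insert_subset_iff, hwA, hzL.1, (mem_del.1 hl'd).1, (mem_del.1 hl₂d).1]
    · intro x hx
      have e1 := hzr.2
      have e2 := hzr'.2
      have e3 := hl'.right.2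
      have e4 := hl₂.right.2
      simp only [dom_insert, dom_singleton]
      rintro (h | h | rfl | h | rfl | h | rfl | h)
      · exact Or.inl h
      · exact Or.inr (Or.inl h)
      · exact Or.inr (Or.inr (Or.inr (Or.inl e1)))
      · rcases (hz.2 x).1 ⟨hx, h.symm⟩ with rfl | rfl <;> simp
      · simp [e3]
      · rcases (hl'.2 x).1 ⟨hx, h.symm⟩ with rfl | rfl
        · simp [hww'.symm]
        · simp
      · simp [e4]
      · rcases (hl₂.2 x).1 ⟨hx, h.symm⟩ with rfl | rfl
        · simp [hwq.symm]
        · simp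
  · rintro (rfl | rfl)
    · exact ⟨hlA, hlw'.symm⟩
    · exact ⟨hw'A, hww'⟩

variable (G A) in
/-- A closed walk `z`, `r`, `l`, `w`, `w'`, `l'`, `r'` of length seven, all of whose vertices except
possibly `r` and `r'` have degree two. -/
structure Heptagon (z r r' l w w' l' : V) : Prop where
  hz : Nb2 G A z r r'
  hl : Nb2 G A l r w
  hw : Nb2 G A w l w'
  hw' : Nb2 G A w' w l'
  hl' : Nb2 G A l' w' r'
  hlz : l ∈ del G A z
  hlz' : l' ∈ del G A z

/-- By induction and `GapLE.false_of_isC7_del`, removing the closed neighbourhood of `z` creates a leaf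
at distance two from `z`. Going on from it in both directions around the cycle closes the cycle. -/
theorem GapLE.exists_heptagon (hG : NoShortCycle G) (hA : GapLE G 0 A)
    (ih : ∀ z ∈ A, ∀ u, Leafless G (del G A z) u → InC7 G (del G A z) u) {p p' : V}
    (hzL : Leafless G A z) (hp : Nb2 G A z p p') :
    ∃ r r' l w w' l', Heptagon G A z r r' l w w' l' := by
  obtain ⟨l, hl, hlL, hl2⟩ : ∃ l ∈ del G A z, Leafless G A l ∧ ¬ Two G (del G A z) l := by
    by_contra! hno
    have hpL := hzL.adj hG hA hp.left.1 hp.left.2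
    have hpL' := hzL.adj hG hA hp.right.1 hp.right.2
    obtain ⟨d, hd, hpd, hdz⟩ := hpL.2.1.exists_ne z
    have hdL := hpL.adj hG hA hd hpd
    have hdd : d ∈ del G A z := mem_del.2 ⟨hd, hdz, fun h => hG.tri hp.left.2 hpd h.symm⟩
    obtain ⟨c, hc, i, rfl⟩ := ih z hzL.1 d ⟨hdd, hno _ hdd hdL, fun y hy hdy =>
      hno _ hy (hdL.adj hG hA (mem_del.1 hy).1 hdy)⟩
    exact hA.false_of_isC7_del hG hp hpL'.2.1 (hc.shift i) (by simpa using hpd)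
  obtain ⟨r, w, hlw, hzr, hl1⟩ := exists_nb2_of_del hG hl hlL.2.1 hl2
  obtain ⟨r', hz⟩ : ∃ r', Nb2 G A z r r' := by
    rcases (hp.2 r).1 ⟨hlw.left.1, hzr⟩ with rfl | rfl
    · exact ⟨_, hp⟩
    · exact ⟨_, hp.symm⟩
  obtain ⟨w', l', hw, hl', hl'd, hw'd⟩ := hA.exists_next hG hzL hz hl hlw hl1.mem.1
  obtain ⟨v, _, hw', -⟩ := hA.exists_next hG hzL hz.symm hl'd hl'.symm hw'd
  refine ⟨r, r', l, w, w', l', hz, hlw, hw, ?_, hl', hl, hl'd⟩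
  rcases (hw'.2 w).1 ⟨hlw.right.1, hw.right.2.symm⟩ with rfl | rfl
  · rcases (hl'.2 l).1 ⟨hw.left.1, hw.left.2⟩ with rfl | rfl
    · exact (hw.1 rfl).elim
    · exact ((mem_del.1 hl).2.2 hz.right.2).elim
  · exact hw'.symm

/-- A heptagon with base vertex `w` passes through `z`, `r` and `l` as well, so that `r` is one of
its vertices of degree two. -/
theorem Heptagon.nb2 (hG : NoShortCycle G) (hA : GapLE G 0 A)
    (ih : ∀ z ∈ A, ∀ u, Leafless G (del G A z) u → InC7 G (del G A z) u) {r r' l w w' l' : V}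
    (hzL : Leafless G A z) (h : Heptagon G A z r r' l w w' l') : Nb2 G A r z l := by
  have hlL := (hzL.adj hG hA h.hz.left.1 h.hz.left.2).adj hG hA (mem_del.1 h.hlz).1
    h.hl.left.2.symm
  have hwL := hlL.adj hG hA h.hl.right.1 h.hl.right.2
  have hrz := h.hz.left.2.symm
  have hlz := (mem_del.1 h.hlz).2.1
  have key : ∀ q v, q ∈ del G A w → Nb2 G A q l v → Nb2 G A r z l := by
    intro q v hq hqv
    have : q = r := by
      rcases (h.hl.2 q).1 ⟨(mem_del.1 hq).1, hqv.left.2.symm⟩ with h' | h'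
      · exact h'
      · exact ((mem_del.1 hq).2.1 h').elim
    subst this
    rcases (hqv.2 z).1 ⟨hzL.1, hrz⟩ with rfl | rfl
    · exact (hlz rfl).elim
    · exact hqv.symm
  obtain ⟨p, p', q, v, v', q', h'⟩ := hA.exists_heptagon hG ih hwL h.hw
  rcases (h'.hz.2 l).1 h.hw.left with rfl | rfl
  · exact key q v h'.hlz h'.hl
  · exact key q' v' h'.hlz' h'.hl'.symm

/-- In a well-covered graph of girth at least six, a component without leaves that has at least two
edges at each vertex is a cycle of length seven. -/
theorem Leafless.inC7 (hG : NoShortCycle G) : ∀ (n : ℕ) (A : Finset V), A.card = n → GapLE G 0 A →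
    ∀ u, Leafless G A u → InC7 G A u := by
  intro n
  induction n using Nat.strong_induction_on with
  | _ n ihn =>
    intro A hn hA u hu
    have ih : ∀ z ∈ A, ∀ u, Leafless G (del G A z) u → InC7 G (del G A z) u := by
      intro z hz
      refine ihn _ ?_ _ rfl (hA.remove hz)
      rw [← hn]
      exact Finset.card_lt_card ⟨Finset.filter_subset _ _, fun h => (mem_del.1 (h hz)).2.1 rfl⟩
    obtain ⟨z, hzL, ⟨y, y', hy⟩, hback⟩ := exists_nb2_of_leafless hG hA ih hu
    refine hback ?_
    obtain ⟨r, r', l, w, w', l', h⟩ := hA.exists_heptagon hG ih hzL hy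
    have h' : Heptagon G A z r' r l' w' w l :=
      ⟨h.hz.symm, h.hl'.symm, h.hw'.symm, h.hw.symm, h.hl.symm, h.hlz', h.hlz⟩
    refine ⟨fun i => (![z, r, l, w, w', l', r'] : Fin 7 → V) i, fun i => ?_, 0, rfl⟩
    fin_cases i
    · exact h.hz.symm
    · exact h.nb2 hG hA ih hzL
    · exact h.hl
    · exact h.hw
    · exact h.hw'
    · exact h.hl'
    · exact (h'.nb2 hG hA ih hzL).symm

end

/-! ### The structure of well-covered graphs of girth at least six -/

section

variable {V : Type*} {G : SimpleGraph V} {A b b' : Finset V} {x y z w q : V}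

variable (G A) in
/-- `l` is the only leaf at the vertex `w` of the subgraph induced by `A`. -/
def IsUniqueLeaf (l w : V) : Prop := l ∈ A ∧ Nb1 G A l w ∧ ∀ l' ∈ A, Nb1 G A l' w → l' = l

variable (G A) in
/-- Each vertex of degree at least two in the subgraph induced by `A` either has exactly one leaf or
lies in a component that is a cycle of length seven. -/
def LocallyNice : Prop := ∀ x ∈ A, Two G A x → InC7 G A x ∨ ∃ l, IsUniqueLeaf G A l x

/-- One half of the Finbow–Hartnell characterization of well-covered graphs of girth at least six. -/
theorem GapLE.locallyNice [DecidableEq V] [DecidableRel G.Adj] (hG : NoShortCycle G)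
    (hA : GapLE G 0 A) : LocallyNice G A := by
  intro x hx h2
  by_cases hL : ∀ y ∈ A, G.Adj x y → Two G A y
  · exact Or.inl (Leafless.inC7 hG _ A rfl hA x ⟨hx, h2, hL⟩)
  · push Not at hL
    obtain ⟨l, hl, hxl, hl2⟩ := hL
    have h1 := nb1_of_not_two hl2 hx hxl.symm
    refine Or.inr ⟨l, hl, h1, fun l' hl' h1' => ?_⟩
    by_contra hne
    have := hA.swap (J := {x}) (J' := {l', l}) indep_singleton ?_ (by simpa using hx)
      (by simp [Finset.insert_subset_iff, hl, hl']) ?_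
    · rw [Finset.card_pair hne, Finset.card_singleton] at this
      omega
    · simp only [indep_insert, Finset.mem_singleton, forall_eq]
      exact ⟨fun h => hne (((h1 l').1 ⟨hl', h.symm⟩).trans ((h1' l).1 ⟨hl, h⟩).symm),
        indep_singleton⟩
    · intro p hp
      simp only [dom_insert, dom_singleton]
      rintro (rfl | h | rfl | h)
      · exact Or.inr h1'.mem.2
      · exact Or.inl ((h1' p).1 ⟨hp, h.symm⟩)
      · exact Or.inr h1.mem.2
      · exact Or.inl ((h1 p).1 ⟨hp, h.symm⟩)

theorem IsC7.two {c : ZMod 7 → V} (h : IsC7 G A c) (i : ZMod 7) : Two G A (c i) := (h i).two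

theorem IsC7.not_adj {c : ZMod 7 → V} (hG : NoShortCycle G) (h : IsC7 G A c) {i j : ZMod 7}
    (h1 : i ≠ j + 1) (h2 : j ≠ i + 1) : ¬ G.Adj (c i) (c j) := by
  intro hij
  rcases ((h i).2 (c j)).1 ⟨h.mem j, hij⟩ with h' | h'
  · exact h1 (by rw [h.injective hG h']; ring)
  · exact h2 (h.injective hG h')

variable [DecidableEq V]

variable (G A) in
/-- The parts of the partition of `A` that is induced by a locally nice structure: isolated vertices,
vertices together with their leaf, and components that are cycles of length seven. -/
inductive Block : Finset V → Prop
  | single {x : V} : x ∈ A → (∀ y ∈ A, ¬ G.Adj x y) → Block {x}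
  | pair {l w : V} : IsUniqueLeaf G A l w → Block {l, w}
  | seven {c : ZMod 7 → V} : IsC7 G A c → Block (Finset.univ.image c)

theorem Block.subset (h : Block G A b) : b ⊆ A := by
  cases h with
  | single hx _ => simpa using hx
  | pair h => simpa [Finset.insert_subset_iff] using ⟨h.1, h.2.1.mem.1⟩
  | seven hc =>
    intro x hx
    obtain ⟨i, -, rfl⟩ := Finset.mem_image.1 hx
    exact hc.mem i

theorem LocallyNice.exists_block (h : LocallyNice G A) (hx : x ∈ A) : ∃ b, Block G A b ∧ x ∈ b := by
  by_cases h2 : Two G A x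
  · rcases h x hx h2 with ⟨c, hc, i, rfl⟩ | ⟨l, hl⟩
    · exact ⟨_, .seven hc, by simp⟩
    · exact ⟨_, .pair hl, by simp⟩
  · by_cases hn : ∀ y ∈ A, ¬ G.Adj x y
    · exact ⟨_, .single hx hn, by simp⟩
    · push Not at hn
      obtain ⟨y, hy, hxy⟩ := hn
      have h1 := nb1_of_not_two h2 hy hxy
      by_cases hy2 : Two G A y
      · rcases h y hy hy2 with hc | ⟨l, hl⟩
        · obtain ⟨c, hc, i, rfl⟩ := hc.adj hx hxy.symm
          exact (h2 (hc.two i)).elim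
        · obtain rfl := hl.2.2 x hx h1
          exact ⟨_, .pair hl, by simp⟩
      · have h1' := nb1_of_not_two hy2 hx hxy.symm
        exact ⟨_, .pair ⟨hx, h1, fun l' hl' h => (h1' l').1 ⟨hl', h.mem.2.symm⟩⟩, by simp⟩

theorem IsC7.image_subset {c c' : ZMod 7 → V} (h : IsC7 G A c) (h' : IsC7 G A c') {i j : ZMod 7}
    (hij : c i = c' j) : Finset.univ.image c ⊆ Finset.univ.image c' := by
  have key : ∀ k : ℕ, ∃ j, c' j = c (i + k) := by
    intro k
    induction k with
    | zero => exact ⟨j, by simp [hij]⟩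
    | succ k ih =>
      obtain ⟨j, hj⟩ := ih
      have := h.adj (i + k)
      rw [← hj] at this
      rcases ((h' j).2 _).1 ⟨h.mem _, this⟩ with e | e
      · exact ⟨_, by rw [← e, Nat.cast_succ, add_assoc]⟩
      · exact ⟨_, by rw [← e, Nat.cast_succ, add_assoc]⟩
  intro x hx
  obtain ⟨k, -, rfl⟩ := Finset.mem_image.1 hx
  obtain ⟨j, hj⟩ := key (k - i).val
  rw [ZMod.natCast_zmod_val, add_sub_cancel] at hj
  exact Finset.mem_image.2 ⟨j, Finset.mem_univ _, hj⟩

theorem Block.eq_of_mem (hb : Block G A b) (hb' : Block G A b') (hx : x ∈ b) (hx' : x ∈ b') :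
    b = b' := by
  have single_pair : ∀ {x l w : V}, (∀ y ∈ A, ¬ G.Adj x y) → IsUniqueLeaf G A l w →
      x ∈ ({l, w} : Finset V) → False := by
    intro x l w hn hl hx
    rcases Finset.mem_insert.1 hx with rfl | hx
    · exact hn w hl.2.1.mem.1 hl.2.1.mem.2
    · obtain rfl := Finset.mem_singleton.1 hx
      exact hn l hl.1 hl.2.1.mem.2.symm
  have pair_seven : ∀ {x l w : V} {c : ZMod 7 → V}, IsC7 G A c → IsUniqueLeaf G A l w →
      x ∈ ({l, w} : Finset V) → x ∈ Finset.univ.image c → False := by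
    intro x l w c hc hl hx hx'
    obtain ⟨i, -, rfl⟩ := Finset.mem_image.1 hx'
    have hl2 := hl.2.1.not_two
    rcases Finset.mem_insert.1 hx with h | h
    · exact hl2 (h ▸ hc.two i)
    · rw [Finset.mem_singleton] at h
      subst h
      rcases ((hc i).2 l).1 ⟨hl.1, hl.2.1.mem.2.symm⟩ with h | h
      · exact hl2 (h ▸ hc.two _)
      · exact hl2 (h ▸ hc.two _)
  have pair_eq : ∀ {l w l' w'}, IsUniqueLeaf G A l w → IsUniqueLeaf G A l' w' → l = w' →
      ({l, w} : Finset V) = {l', w'} := by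
    rintro l w l' w' hl hl' rfl
    obtain rfl := (hl.2.1 l').1 ⟨hl'.1, hl'.2.1.mem.2.symm⟩
    exact Finset.pair_comm _ _
  cases hb with
  | @single x₀ hx₀ hn =>
    obtain rfl := Finset.mem_singleton.1 hx
    cases hb' with
    | single hx₁ hn' => rw [Finset.mem_singleton.1 hx']
    | pair h => exact (single_pair hn h hx').elim
    | seven hc =>
      obtain ⟨i, -, rfl⟩ := Finset.mem_image.1 hx'
      exact (hn _ (hc.mem _) (hc.adj i)).elim
  | @pair l w hl =>
    cases hb' with
    | single hx₁ hn' =>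
      obtain rfl := Finset.mem_singleton.1 hx'
      exact (single_pair hn' hl hx).elim
    | @pair l' w' hl' =>
      rcases Finset.mem_insert.1 hx with rfl | hx <;> rcases Finset.mem_insert.1 hx' with h | hx'
      · subst h
        obtain rfl := (hl.2.1 w').1 hl'.2.1.mem
        rfl
      · exact pair_eq hl hl' (Finset.mem_singleton.1 hx')
      · subst h
        exact (pair_eq hl' hl (Finset.mem_singleton.1 hx)).symm
      · obtain rfl := Finset.mem_singleton.1 hx
        obtain rfl := Finset.mem_singleton.1 hx'
        rw [hl.2.2 l' hl'.1 hl'.2.1]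
    | seven hc => exact (pair_seven hc hl hx hx').elim
  | seven hc =>
    cases hb' with
    | single hx₁ hn' =>
      obtain rfl := Finset.mem_singleton.1 hx'
      obtain ⟨i, -, rfl⟩ := Finset.mem_image.1 hx
      exact (hn' _ (hc.mem _) (hc.adj i)).elim
    | pair hl => exact (pair_seven hc hl hx' hx).elim
    | seven hc' =>
      obtain ⟨i, -, hi⟩ := Finset.mem_image.1 hx
      obtain ⟨j, -, hj⟩ := Finset.mem_image.1 hx'
      exact (hc.image_subset hc' (hi.trans hj.symm)).antisymm
        (hc'.image_subset hc (hj.trans hi.symm))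

/-- A set is at most as large as another one plus the excess in at most two blocks. -/
theorem LocallyNice.exists_blocks (h : LocallyNice G A) {M T : Finset V} (hM : M ⊆ A) (hT : T ⊆ A) :
    (M.card < T.card → ∃ b, Block G A b ∧ (M ∩ b).card < (T ∩ b).card) ∧
    (M.card + 2 ≤ T.card → ∃ B : Finset (Finset V), B.card ≤ 2 ∧
      (∀ b ∈ B, Block G A b ∧ (M ∩ b).card < (T ∩ b).card) ∧
      ∑ b ∈ B, (M ∩ b).card + 2 ≤ ∑ b ∈ B, (T ∩ b).card) := by
  classical
  set P := A.powerset.filter (Block G A) with hP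
  have hPB : ∀ b ∈ P, Block G A b := fun b hb => (Finset.mem_filter.1 hb).2
  have hsum : ∀ S ⊆ A, S.card = ∑ b ∈ P, (S ∩ b).card := by
    intro S hS
    rw [← Finset.card_biUnion]
    · congr 1
      ext x
      simp only [Finset.mem_biUnion, Finset.mem_inter]
      constructor
      · intro hx
        obtain ⟨b, hb, hxb⟩ := h.exists_block (hS hx)
        exact ⟨b, Finset.mem_filter.2 ⟨Finset.mem_powerset.2 hb.subset, hb⟩, hx, hxb⟩
      · rintro ⟨b, -, hx, -⟩
        exact hx
    · intro b hb b' hb' hne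
      refine Finset.disjoint_left.2 fun x hx hx' => hne ?_
      exact (hPB b hb).eq_of_mem (hPB b' hb') (Finset.mem_inter.1 hx).2 (Finset.mem_inter.1 hx').2
  rw [hsum M hM, hsum T hT]
  constructor
  · intro hlt
    obtain ⟨b, hb, hlt⟩ := Finset.exists_lt_of_sum_lt hlt
    exact ⟨b, hPB b hb, hlt⟩
  · intro hle
    obtain ⟨b, hb, hlt⟩ := Finset.exists_lt_of_sum_lt (s := P) (f := fun b => (M ∩ b).card)
      (g := fun b => (T ∩ b).card) (by omega)
    by_cases h2 : (M ∩ b).card + 2 ≤ (T ∩ b).card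
    · exact ⟨{b}, by simp, by simpa using ⟨hPB b hb, hlt⟩, by simpa using h2⟩
    · rw [← Finset.add_sum_erase P _ hb, ← Finset.add_sum_erase P (fun b => (T ∩ b).card) hb] at hle
      obtain ⟨b', hb', hlt'⟩ := Finset.exists_lt_of_sum_lt (s := P.erase b)
        (f := fun b => (M ∩ b).card) (g := fun b => (T ∩ b).card) (by omega)
      have hne : b ≠ b' := (Finset.ne_of_mem_erase hb').symm
      refine ⟨{b, b'}, Finset.card_le_two, ?_, ?_⟩
      · simpa using ⟨⟨hPB b hb, hlt⟩, hPB b' (Finset.mem_of_mem_erase hb'), hlt'⟩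
      · rw [Finset.sum_pair hne, Finset.sum_pair hne]
        omega

theorem card_inter_pair_le (hS : Indep G b) (h : G.Adj x y) : (b ∩ {x, y}).card ≤ 1 := by
  rw [Finset.card_le_one]
  intro p hp q hq
  simp only [Finset.mem_inter, Finset.mem_insert, Finset.mem_singleton] at hp hq
  obtain ⟨hp, rfl | rfl⟩ := hp <;> obtain ⟨hq, rfl | rfl⟩ := hq
  · rfl
  · exact (hS _ hp _ hq h).elim
  · exact (hS _ hp _ hq h.symm).elim
  · rfl

theorem card_inter_image_univ {c : ZMod 7 → V} (hc : Function.Injective c) (S : Finset V) :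
    (S ∩ Finset.univ.image c).card = (Finset.univ.filter fun i => c i ∈ S).card := by
  rw [← Finset.card_image_of_injective _ hc]
  congr 1
  ext x
  simp only [Finset.mem_inter, Finset.mem_image, Finset.mem_univ, true_and, Finset.mem_filter]
  constructor
  · rintro ⟨hx, i, rfl⟩
    exact ⟨i, hx, rfl⟩
  · rintro ⟨i, hx, rfl⟩
    exact ⟨hx, i, rfl⟩

set_option maxRecDepth 100000 in
theorem zmod7_card_le : ∀ s : Finset (ZMod 7), (∀ i ∈ s, i + 1 ∉ s) → s.card ≤ 3 := by
  decide

set_option maxRecDepth 100000 in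
theorem zmod7_le_card : ∀ s : Finset (ZMod 7), (∀ i, i ∈ s ∨ i - 1 ∈ s ∨ i + 1 ∈ s) →
    3 ≤ s.card := by
  decide

set_option maxRecDepth 100000 in
theorem zmod7_exists : ∀ s : Finset (ZMod 7), (∀ i ∈ s, i + 1 ∉ s) →
    ∃ i, i ∉ s ∧ i + 2 ∉ s ∧ i + 4 ∉ s := by
  decide

theorem IsC7.card_inter_le {c : ZMod 7 → V} (hG : NoShortCycle G) (hc : IsC7 G A c)
    {T : Finset V} (hT : Indep G T) : (T ∩ Finset.univ.image c).card ≤ 3 := by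
  rw [card_inter_image_univ (hc.injective hG)]
  refine zmod7_card_le _ fun i hi hi' => ?_
  simp only [Finset.mem_filter, Finset.mem_univ, true_and] at hi hi'
  exact hT _ hi _ hi' (hc.adj i)

/-- The other half of the Finbow–Hartnell characterization: a maximal independent set is as large as
possible in each block. -/
theorem LocallyNice.gapLE (hG : NoShortCycle G) (h : LocallyNice G A) : GapLE G 0 A := by
  intro S hS T hT hiS hiT hd
  by_contra hlt
  obtain ⟨b, hb, hlt⟩ := (h.exists_blocks hS hT).1 (by omega)
  cases hb with
  | @single x hx hn =>
    have : x ∈ S := by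
      rcases hd x hx with h | ⟨y, hy, h⟩
      · exact h
      · exact (hn y (hS hy) h).elim
    rw [Finset.inter_singleton_of_mem this] at hlt
    have := Finset.card_le_card (Finset.inter_subset_right : T ∩ {x} ⊆ {x})
    omega
  | @pair l w hl =>
    have h1 := card_inter_pair_le hiT hl.2.1.mem.2
    have : (S ∩ {l, w}).Nonempty := by
      rcases hd l hl.1 with h | ⟨y, hy, h⟩
      · exact ⟨l, by simp [h]⟩
      · obtain rfl := (hl.2.1 y).1 ⟨hS hy, h⟩
        exact ⟨y, by simp [hy]⟩
    have := this.card_pos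
    omega
  | @seven c hc =>
    have h1 := hc.card_inter_le hG hiT
    rw [card_inter_image_univ (hc.injective hG)] at hlt
    have : 3 ≤ (Finset.univ.filter fun i => c i ∈ S).card := by
      refine zmod7_le_card _ fun i => ?_
      simp only [Finset.mem_filter, Finset.mem_univ, true_and]
      rcases hd _ (hc.mem i) with h | ⟨y, hy, h⟩
      · exact Or.inl h
      · rcases ((hc i).2 y).1 ⟨hS hy, h⟩ with rfl | rfl
        · exact Or.inr (Or.inl hy)
        · exact Or.inr (Or.inr hy)
    omega

end

/-! ### Graphs with a vertex of type two -/

section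

variable {V : Type*} [Fintype V] [DecidableEq V] {G : SimpleGraph V} {v a b : V}

variable (G v a b) in
/-- The vertex `v` has exactly two leaves, `a` and `b`. -/
structure TwoLeaves : Prop where
  ne : a ≠ b
  left : Nb1 G Finset.univ a v
  right : Nb1 G Finset.univ b v
  unique : ∀ x, Nb1 G Finset.univ x v → x = a ∨ x = b

variable (G v a b) in
/-- Each neighbour of `v` except `a` and `b` has exactly one leaf. -/
def NbrsHaveLeaf : Prop :=
  ∀ r, G.Adj v r → r ≠ a → r ≠ b → ∃ l, IsUniqueLeaf G Finset.univ l r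

variable (G) in
/-- No independent set of at most `k` vertices can be exchanged for an independent set that has at
least two more vertices and whose closed neighbourhood is not larger. -/
def NoExchange (k : ℕ) : Prop :=
  ∀ J J' : Finset V, Indep G J → Indep G J' → J.card ≤ k → J.card + 2 ≤ J'.card →
    ∃ x, Dom G J' x ∧ ¬ Dom G J x

omit [Fintype V] in
/-- If an exchange of at most eight vertices of bounded degree gains two vertices, then the vertices
that dominate the closed neighbourhoods of the new vertices may be added to both sides. -/
theorem NoExchange.false_of_exchange (h : NoExchange G 40) {S T T' : Finset V} (hS : Indep G S)
    (hdom : ∀ x, Dom G S x) (hTS : T ⊆ S) (hT' : Indep G T') (hcard : T.card + 2 ≤ T'.card)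
    (hcard' : T'.card ≤ 8)
    (hdeg : ∀ t ∈ T', ∃ W : Finset V, W.card ≤ 4 ∧ ∀ x, x = t ∨ G.Adj x t → x ∈ W)
    (hadj : ∀ t ∈ T', ∀ s ∈ S, s ∉ T → s ≠ t ∧ ¬ G.Adj t s) : False := by
  have hex : ∀ x, ∃ s ∈ S, x = s ∨ G.Adj x s := fun x => by
    rcases hdom x with h | ⟨s, hs, h⟩
    · exact ⟨x, h, Or.inl rfl⟩
    · exact ⟨s, hs, Or.inr h⟩
  choose f hfS hf using hex
  choose! W hW hWt using hdeg
  set J := T ∪ (T'.biUnion W).image f with hJ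
  have hJS : J ⊆ S := by
    refine Finset.union_subset hTS fun x hx => ?_
    obtain ⟨y, -, rfl⟩ := Finset.mem_image.1 hx
    exact hfS y
  have hTJ : T ⊆ J := Finset.subset_union_left
  have hJT : ∀ s ∈ J \ T, s ∈ S ∧ s ∉ T := fun s hs =>
    ⟨hJS (Finset.mem_sdiff.1 hs).1, (Finset.mem_sdiff.1 hs).2⟩
  have hdisj : Disjoint (J \ T) T' := Finset.disjoint_left.2 fun s hs hs' =>
    (hadj s hs' s (hJT s hs).1 (hJT s hs).2).1 rfl
  have hind : Indep G (J \ T ∪ T') := by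
    intro x hx y hy hxy
    rcases Finset.mem_union.1 hx with hx | hx <;> rcases Finset.mem_union.1 hy with hy | hy
    · exact hS x (hJT x hx).1 y (hJT y hy).1 hxy
    · exact (hadj y hy x (hJT x hx).1 (hJT x hx).2).2 hxy.symm
    · exact (hadj x hx y (hJT y hy).1 (hJT y hy).2).2 hxy
    · exact hT' x hx y hy hxy
  -- As `T` has at most six vertices and at most `8 * 4` vertices are added, the bound `40` suffices.
  have hJ40 : J.card ≤ 40 := by
    have h1 : (T'.biUnion W).card ≤ T'.card * 4 := Finset.card_biUnion_le_card_mul _ _ _ hW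
    have h2 : ((T'.biUnion W).image f).card ≤ (T'.biUnion W).card := Finset.card_image_le
    have h3 : J.card ≤ T.card + _ := Finset.card_union_le T ((T'.biUnion W).image f)
    omega
  have hJ2 : J.card + 2 ≤ (J \ T ∪ T').card := by
    rw [Finset.card_union_of_disjoint hdisj, Finset.card_sdiff_of_subset hTJ]
    have := Finset.card_le_card hTJ
    omega
  obtain ⟨x, hx, hx'⟩ := h J (J \ T ∪ T') (fun x hx y hy => hS x (hJS hx) y (hJS hy)) hind hJ40 hJ2
  refine hx' ?_
  rcases dom_union.1 hx with hx | hx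
  · exact hx.mono Finset.sdiff_subset
  · obtain ⟨t, ht, hxt⟩ : ∃ t ∈ T', x = t ∨ G.Adj x t := by
      rcases hx with h | ⟨t, ht, h⟩
      · exact ⟨x, h, Or.inl rfl⟩
      · exact ⟨t, ht, Or.inr h⟩
    have hfJ : f x ∈ J := Finset.mem_union_right _ (Finset.mem_image_of_mem _
      (Finset.mem_biUnion.2 ⟨t, ht, hWt t ht x hxt⟩))
    rcases hf x with h | h
    · exact Or.inl (h ▸ hfJ)
    · exact Or.inr ⟨_, hfJ, h⟩

omit [DecidableEq V] in
theorem TwoLeaves.ne_leaf (h : TwoLeaves G v a b) {l r : V} (hl : Nb1 G Finset.univ l r)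
    (hra : r ≠ a) : l ≠ v := by
  rintro rfl
  exact hra ((hl a).1 ⟨Finset.mem_univ _, h.left.mem.2.symm⟩).symm

variable [DecidableRel G.Adj]

/-- Let `S` be a maximal independent set that does not contain `v`, and `b₀` a block of the graph
without the closed neighbourhood of `v` in which `S`, after replacing neighbours of `v` by their leaves,
is smaller than the independent set `T`. Then the vertices of `S` in `b₀` can be exchanged for a set
`Q` of the size of `T ∩ b₀`, provided that at most one neighbour of `v` is replaced by its leaf. -/
theorem Block.exists_exchange (hG : NoShortCycle G) (h : TwoLeaves G v a b) {S M T b₀ : Finset V}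
    (hdom : ∀ x, Dom G S x) (hSM : S ∩ del G Finset.univ v ⊆ M)
    (hM : ∀ r ∈ S, G.Adj v r → r ≠ a → r ≠ b → ∀ l, Nb1 G Finset.univ l r → l ∈ M)
    (hT : Indep G T) (hb : Block G (del G Finset.univ v) b₀)
    (hlt : (M ∩ b₀).card < (T ∩ b₀).card) :
    ∃ Q R : Finset V, Q ⊆ b₀ ∧ Indep G Q ∧ (T ∩ b₀).card ≤ Q.card ∧ Q.card ≤ 3 ∧ R.card ≤ 1 ∧
      (∀ r ∈ R, r ∈ S ∧ G.Adj v r ∧ r ≠ a ∧ r ≠ b) ∧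
      (∀ q ∈ Q, ∀ s ∈ S, G.Adj q s → s ∈ b₀ ∨ s ∈ R) ∧
      (∀ q ∈ Q, ∀ y ∈ del G Finset.univ v, G.Adj q y → y ∈ b₀) ∧
      (∀ q ∈ Q, ∃ y ∈ del G Finset.univ v, G.Adj q y) ∧
      ∀ q ∈ Q, ∃ W : Finset V, W.card ≤ 4 ∧ ∀ x, x = q ∨ G.Adj x q → x ∈ W := by
  -- Outside the block, a vertex has at most one neighbour, a neighbour of `v` with a further leaf.
  have hout : ∀ q ∈ del G Finset.univ v, ∀ s, G.Adj q s → s ∉ del G Finset.univ v →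
      G.Adj v s ∧ s ≠ a ∧ s ≠ b := by
    intro q hq s hqs hs
    have hsv : s ≠ v := by rintro rfl; exact (mem_del.1 hq).2.2 hqs.symm
    have hvs : G.Adj v s := by
      by_contra hvs
      exact hs (mem_del.2 ⟨Finset.mem_univ _, hsv, hvs⟩)
    have hqv := (mem_del.1 hq).2.1
    refine ⟨hvs, ?_, ?_⟩
    · rintro rfl
      exact hqv ((h.left q).1 ⟨Finset.mem_univ _, hqs.symm⟩)
    · rintro rfl
      exact hqv ((h.right q).1 ⟨Finset.mem_univ _, hqs.symm⟩)
  have huniq : ∀ q ∈ del G Finset.univ v, ∀ s s', G.Adj q s → G.Adj q s' → G.Adj v s →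
      G.Adj v s' → s = s' := by
    intro q hq s s' hqs hqs' hvs hvs'
    by_contra hne
    exact hG.quad hvs hqs.symm hqs' hvs'.symm (mem_del.1 hq).2.1.symm hne
  cases hb with
  | @single x hx hn =>
    have hxM : x ∉ M := fun hxM => by
      rw [Finset.inter_singleton_of_mem hxM] at hlt
      have := Finset.card_le_card (Finset.inter_subset_right : T ∩ {x} ⊆ {x})
      omega
    refine (hxM ?_).elim
    rcases hdom x with hxS | ⟨s, hs, hxs⟩
    · exact hSM (Finset.mem_inter.2 ⟨hxS, hx⟩)
    · obtain ⟨hvs, hsa, hsb⟩ := hout x hx s hxs fun hs' => hn s hs' hxs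
      refine hM s hs hvs hsa hsb x fun q => ⟨fun ⟨_, hxq⟩ => ?_, ?_⟩
      · exact huniq x hx q s hxq hxs (hout x hx q hxq fun hq => hn q hq hxq).1 hvs
      · rintro rfl; exact ⟨Finset.mem_univ _, hxs⟩
  | @pair l w hl =>
    have h1 := card_inter_pair_le hT hl.2.1.mem.2
    have hM0 : M ∩ {l, w} = ∅ := Finset.card_eq_zero.1 (by omega)
    have hS0 : ∀ x ∈ ({l, w} : Finset V), x ∈ del G Finset.univ v → x ∉ S := by
      intro x hx hxd hxS
      have : x ∈ M ∩ {l, w} := Finset.mem_inter.2 ⟨hSM (Finset.mem_inter.2 ⟨hxS, hxd⟩), hx⟩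
      rw [hM0] at this
      simp at this
    have hlS := hS0 l (by simp) hl.1
    have hwS := hS0 w (by simp) hl.2.1.mem.1
    obtain ⟨s, hs, hls⟩ : ∃ s ∈ S, G.Adj l s := by
      rcases hdom l with h | h
      · exact (hlS h).elim
      · exact h
    have hsd : s ∉ del G Finset.univ v := fun hsd =>
      hwS ((hl.2.1 s).1 ⟨hsd, hls⟩ ▸ hs)
    have hvs := hout l hl.1 s hls hsd
    have hnb : ∀ x, G.Adj l x → x = w ∨ x = s := by
      intro x hlx
      by_cases hx : x ∈ del G Finset.univ v
      · exact Or.inl ((hl.2.1 x).1 ⟨hx, hlx⟩)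
      · exact Or.inr (huniq l hl.1 x s hlx hls (hout l hl.1 x hlx hx).1 hvs.1)
    refine ⟨{l}, {s}, by simp, indep_singleton, by simpa using h1, by simp, by simp,
      by simpa using ⟨hs, hvs⟩, ?_, ?_, ?_, ?_⟩
    · simp only [Finset.mem_singleton, forall_eq]
      intro x hx hlx
      rcases hnb x hlx with rfl | rfl <;> simp
    · simp only [Finset.mem_singleton, forall_eq]
      intro y hy hly
      rw [(hl.2.1 y).1 ⟨hy, hly⟩]
      simp
    · simp only [Finset.mem_singleton, forall_eq]
      exact ⟨w, hl.2.1.mem⟩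
    · simp only [Finset.mem_singleton, forall_eq]
      refine ⟨{l, w, s}, Finset.card_le_three.trans (by omega), ?_⟩
      rintro x (rfl | hx)
      · simp
      · rcases hnb x hx.symm with rfl | rfl <;> simp
  | @seven c hc =>
    classical
    have hinj := hc.injective hG
    -- The vertices of the cycle that have a neighbour in `S` outside of it.
    set F : Finset (ZMod 7) := Finset.univ.filter fun i =>
      ∃ s ∈ S, G.Adj (c i) s ∧ s ∉ del G Finset.univ v with hF
    obtain ⟨i, hi0, hi2, hi4⟩ := zmod7_exists F (by
      intro i hi hi'
      obtain ⟨s, hs, his, hsd⟩ := (Finset.mem_filter.1 hi).2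
      obtain ⟨s', hs', his', hsd'⟩ := (Finset.mem_filter.1 hi').2
      exact hG.pent (hout _ (hc.mem _) s his hsd).1 his.symm (hc.adj i) his'
        (hout _ (hc.mem _) s' his' hsd').1.symm)
    have hQF : ∀ q ∈ ({c i, c (i + 2), c (i + 4)} : Finset V), ∃ j, j ∉ F ∧ q = c j := by
      simp only [Finset.mem_insert, Finset.mem_singleton]
      rintro q (rfl | rfl | rfl)
      · exact ⟨_, hi0, rfl⟩
      · exact ⟨_, hi2, rfl⟩
      · exact ⟨_, hi4, rfl⟩
    have hclosed : ∀ j, ∀ y ∈ del G Finset.univ v, G.Adj (c j) y →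
        y ∈ Finset.univ.image c := by
      intro j y hy hjy
      rcases ((hc j).2 y).1 ⟨hy, hjy⟩ with rfl | rfl <;> simp
    have hne : ∀ j k : ZMod 7, j ≠ k → i + j ≠ i + k + 1 → i + k ≠ i + j + 1 →
        c (i + j) ≠ c (i + k) ∧ ¬ G.Adj (c (i + j)) (c (i + k)) := fun j k h0 h1 h2 =>
      ⟨hinj.ne fun h => h0 (add_left_cancel h), hc.not_adj hG h1 h2⟩
    have e : ∀ j k l : ZMod 7, j ≠ k → j ≠ k + 1 → i + j ≠ i + k + 1 := fun j k l _ h h' =>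
      h (by rw [add_assoc] at h'; exact add_left_cancel h')
    have h02 := hne 0 2 (by decide) (e 0 2 0 (by decide) (by decide)) (e 2 0 0 (by decide) (by decide))
    have h04 := hne 0 4 (by decide) (e 0 4 0 (by decide) (by decide)) (e 4 0 0 (by decide) (by decide))
    have h24 := hne 2 4 (by decide) (e 2 4 0 (by decide) (by decide)) (e 4 2 0 (by decide) (by decide))
    rw [add_zero] at h02 h04
    have hQ3 : ({c i, c (i + 2), c (i + 4)} : Finset V).card = 3 := by
      rw [Finset.card_eq_three]
      exact ⟨_, _, _, h02.1, h04.1, h24.1, rfl⟩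
    refine ⟨{c i, c (i + 2), c (i + 4)}, ∅, by simp [Finset.insert_subset_iff], ?_, ?_, hQ3.le,
      by simp, by simp, ?_, ?_, ?_, ?_⟩
    · simp only [indep_insert, indep_singleton, Finset.forall_mem_insert, Finset.mem_singleton,
        forall_eq]
      exact ⟨⟨h02.2, h04.2⟩, h24.2, trivial⟩
    · rw [hQ3]
      exact hc.card_inter_le hG hT
    · intro q hq s hs hqs
      obtain ⟨j, hj, rfl⟩ := hQF q hq
      refine Or.inl (hclosed j s ?_ hqs)
      by_contra hsd
      exact hj (Finset.mem_filter.2 ⟨Finset.mem_univ _, s, hs, hqs, hsd⟩)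
    · intro q hq y hy hqy
      obtain ⟨j, -, rfl⟩ := hQF q hq
      exact hclosed j y hy hqy
    · intro q hq
      obtain ⟨j, -, rfl⟩ := hQF q hq
      exact ⟨_, hc.mem (j + 1), hc.adj j⟩
    · intro q hq
      obtain ⟨j, -, rfl⟩ := hQF q hq
      have hin : ∀ y ∈ del G Finset.univ v, G.Adj y (c j) → y = c (j - 1) ∨ y = c (j + 1) :=
        fun y hy hyj => ((hc j).2 y).1 ⟨hy, hyj.symm⟩
      by_cases hs : ∃ s, G.Adj (c j) s ∧ s ∉ del G Finset.univ v
      · obtain ⟨s, hjs, hsd⟩ := hs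
        refine ⟨{c j, c (j - 1), c (j + 1), s}, Finset.card_le_four, ?_⟩
        rintro x (rfl | hx)
        · simp
        · by_cases hxd : x ∈ del G Finset.univ v
          · rcases hin x hxd hx with rfl | rfl <;> simp
          · rw [huniq _ (hc.mem j) x s hx.symm hjs (hout _ (hc.mem j) x hx.symm hxd).1
              (hout _ (hc.mem j) s hjs hsd).1]
            simp
      · refine ⟨{c j, c (j - 1), c (j + 1)}, Finset.card_le_three.trans (by omega), ?_⟩
        rintro x (rfl | hx)
        · simp
        · by_cases hxd : x ∈ del G Finset.univ v
          · rcases hin x hxd hx with rfl | rfl <;> simp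
          · exact (hs ⟨x, hx.symm, hxd⟩).elim

/-- The local conditions bound the gap: if some independent set `T` had two vertices more than a
maximal independent set `S`, then the exchanges in at most two blocks in which `S` is smaller than `T`
would together gain two vertices. -/
theorem GapLE.of_noExchange (hG : NoShortCycle G) (h : TwoLeaves G v a b)
    (h1 : LocallyNice G (del G Finset.univ v)) (h2 : NbrsHaveLeaf G v a b)
    (h3 : NoExchange G 40) : GapLE G 1 Finset.univ := by
  choose! f hf using h2
  -- Replace the neighbours of `v` that are not leaves by their leaves.
  set p : V → Prop := fun x => G.Adj v x ∧ x ≠ a ∧ x ≠ b with hp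
  set φ : V → V := fun x => if p x then f x else x with hφ
  have hφp : ∀ {x}, p x → φ x = f x := fun hx => if_pos hx
  have hφn : ∀ {x}, ¬ p x → φ x = x := fun hx => if_neg hx
  have hleaf : ∀ {r}, p r → Nb1 G Finset.univ (f r) r := fun hr => (hf _ hr.1 hr.2.1 hr.2.2).2.1
  have hadj : ∀ {r q}, p r → G.Adj (f r) q → q = r := fun hr h =>
    (hleaf hr _).1 ⟨Finset.mem_univ _, h⟩
  have hfr : ∀ {r}, p r → G.Adj (f r) r := fun hr => (hleaf hr).mem.2
  have hfd : ∀ {r}, p r → f r ∈ del G Finset.univ v := by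
    intro r hr
    refine mem_del.2 ⟨Finset.mem_univ _, h.ne_leaf (hleaf hr) hr.2.1, fun hv => ?_⟩
    exact hr.1.ne (hadj hr hv.symm)
  have hpd : ∀ {x}, x ∈ del G Finset.univ v → ¬ p x := fun hx hpx => (mem_del.1 hx).2.2 hpx.1
  have hva := h.left.mem.2.symm
  have hvb := h.right.mem.2.symm
  have hdel : ∀ {x}, x ∉ ({v, a, b} : Finset V) → φ x ∈ del G Finset.univ v := by
    intro x hx
    simp only [Finset.mem_insert, Finset.mem_singleton, not_or] at hx
    by_cases hpx : p x
    · rw [hφp hpx]; exact hfd hpx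
    · rw [hφn hpx]
      exact mem_del.2 ⟨Finset.mem_univ _, hx.1, fun hv => hpx ⟨hv, hx.2.1, hx.2.2⟩⟩
  have hinj : ∀ {T : Finset V}, Indep G T → ∀ x ∈ T, ∀ y ∈ T, φ x = φ y → x = y := by
    intro T hT x hx y hy hxy
    by_cases hpx : p x <;> by_cases hpy : p y
    · rw [hφp hpx, hφp hpy] at hxy
      exact (hadj hpx (hxy ▸ hfr hpy)).symm
    · rw [hφp hpx, hφn hpy] at hxy
      exact (hT y hy x hx (hxy ▸ hfr hpx)).elim
    · rw [hφn hpx, hφp hpy] at hxy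
      exact (hT x hx y hy (hxy ▸ hfr hpy)).elim
    · rwa [hφn hpx, hφn hpy] at hxy
  let ψ : Finset V → Finset V := fun T => (T \ {v, a, b}).image φ
  have hψA : ∀ T, ψ T ⊆ del G Finset.univ v := by
    intro T x hx
    obtain ⟨y, hy, rfl⟩ := Finset.mem_image.1 hx
    exact hdel (Finset.mem_sdiff.1 hy).2
  have hψi : ∀ {T}, Indep G T → Indep G (ψ T) := by
    intro T hT x hx y hy hxy
    have hxd := hψA T hx
    have hyd := hψA T hy
    obtain ⟨x, hx', rfl⟩ := Finset.mem_image.1 hx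
    obtain ⟨y, hy', rfl⟩ := Finset.mem_image.1 hy
    by_cases hpx : p x
    · rw [hφp hpx] at hxy
      exact hpd hyd (hadj hpx hxy ▸ hpx)
    by_cases hpy : p y
    · rw [hφp hpy] at hxy
      exact hpd hxd (hadj hpy hxy.symm ▸ hpy)
    rw [hφn hpx, hφn hpy] at hxy
    exact hT x (Finset.mem_sdiff.1 hx').1 y (Finset.mem_sdiff.1 hy').1 hxy
  have hψc : ∀ {T}, Indep G T → (ψ T).card = (T \ {v, a, b}).card := fun hT =>
    Finset.card_image_of_injOn fun x hx y hy => hinj hT x (Finset.mem_sdiff.1 hx).1 y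
      (Finset.mem_sdiff.1 hy).1
  have hcard : ∀ T : Finset V, T.card = (T \ {v, a, b}).card + (T ∩ {v, a, b}).card := fun T =>
    (Finset.card_sdiff_add_card_inter T _).symm
  have hvab : ∀ {T : Finset V}, Indep G T → (T ∩ {v, a, b}).card ≤ 2 := by
    intro T hT
    by_cases hv : v ∈ T
    · refine (Finset.card_le_card (t := {v, b}) fun x hx => ?_).trans Finset.card_le_two
      simp only [Finset.mem_inter, Finset.mem_insert, Finset.mem_singleton] at hx ⊢
      rcases hx with ⟨hx, rfl | rfl | rfl⟩
      · exact Or.inl rfl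
      · exact (hT v hv x hx hva).elim
      · exact Or.inr rfl
    · refine (Finset.card_le_card (t := {a, b}) fun x hx => ?_).trans Finset.card_le_two
      simp only [Finset.mem_inter, Finset.mem_insert, Finset.mem_singleton] at hx ⊢
      rcases hx with ⟨hx, rfl | h⟩
      · exact (hv hx).elim
      · exact h
  intro S _ T _ hS hT hd
  replace hd := fun x => hd x (Finset.mem_univ x)
  have hTc : T.card ≤ (ψ T).card + 2 := by
    rw [hcard T, hψc hT]
    exact Nat.add_le_add_left (hvab hT) _
  by_cases hvS : v ∈ S
  · -- The rest of `S` is a maximal independent set of a well-covered graph.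
    have := h1.gapLE hG (S ∩ del G Finset.univ v) Finset.inter_subset_right (ψ T) (hψA T)
      (fun x hx y hy => hS x (Finset.mem_inter.1 hx).1 y (Finset.mem_inter.1 hy).1) (hψi hT)
      (fun x hx => by
        rcases hd x with hxS | ⟨s, hs, hxs⟩
        · exact Or.inl (Finset.mem_inter.2 ⟨hxS, hx⟩)
        · refine Or.inr ⟨s, Finset.mem_inter.2
            ⟨hs, mem_del.2 ⟨Finset.mem_univ _, ?_, hS v hvS s hs⟩⟩, hxs⟩
          rintro rfl
          exact (mem_del.1 hx).2.2 hxs.symm)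
    have h4 : (S ∩ del G Finset.univ v).card + 1 ≤ S.card := by
      rw [← Finset.card_insert_of_notMem (a := v) fun hv =>
        (mem_del.1 (Finset.mem_inter.1 hv).2).2.1 rfl]
      exact Finset.card_le_card (Finset.insert_subset hvS Finset.inter_subset_left)
    omega
  · have haS : a ∈ S := by
      rcases hd a with h' | ⟨s, hs, h'⟩
      · exact h'
      · exact (hvS ((h.left s).1 ⟨Finset.mem_univ _, h'⟩ ▸ hs)).elim
    have hbS : b ∈ S := by
      rcases hd b with h' | ⟨s, hs, h'⟩
      · exact h'
      · exact (hvS ((h.right s).1 ⟨Finset.mem_univ _, h'⟩ ▸ hs)).elim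
    have hSc : (ψ S).card + 2 ≤ S.card := by
      rw [hcard S, hψc hS, ← Finset.card_pair h.ne]
      refine Nat.add_le_add_left (Finset.card_le_card fun x hx => ?_) _
      simp only [Finset.mem_inter, Finset.mem_insert, Finset.mem_singleton] at hx ⊢
      rcases hx with rfl | rfl
      · exact ⟨haS, Or.inr (Or.inl rfl)⟩
      · exact ⟨hbS, Or.inr (Or.inr rfl)⟩
    by_contra hlt
    obtain ⟨B, hB2, hB, hBsum⟩ := (h1.exists_blocks (hψA S) (hψA T)).2 (by omega)
    have hSψ : S ∩ del G Finset.univ v ⊆ ψ S := by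
      intro x hx
      obtain ⟨hx, hxd⟩ := Finset.mem_inter.1 hx
      refine Finset.mem_image.2 ⟨x, Finset.mem_sdiff.2 ⟨hx, ?_⟩, hφn (hpd hxd)⟩
      simp only [Finset.mem_insert, Finset.mem_singleton, not_or]
      refine ⟨(mem_del.1 hxd).2.1, ?_, ?_⟩
      · rintro rfl; exact (mem_del.1 hxd).2.2 hva
      · rintro rfl; exact (mem_del.1 hxd).2.2 hvb
    have hMψ : ∀ r ∈ S, G.Adj v r → r ≠ a → r ≠ b → ∀ l, Nb1 G Finset.univ l r → l ∈ ψ S := by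
      intro r hr hvr hra hrb l hl
      have hpr : p r := ⟨hvr, hra, hrb⟩
      refine Finset.mem_image.2 ⟨r, Finset.mem_sdiff.2 ⟨hr, ?_⟩, ?_⟩
      · simp [hvr.ne', hra, hrb]
      · rw [hφp hpr]
        exact ((hf r hvr hra hrb).2.2 l (Finset.mem_univ _) hl).symm
    have hex := fun b₀ hb₀ => (hB b₀ hb₀).1.exists_exchange hG h hd hSψ hMψ (hψi hT)
      (hB b₀ hb₀).2
    choose! Q R hQb hQi hTQ hQ3 hR1 hR hQS hQd hQn hQW using hex
    -- Exchange the chosen neighbours of `v` for their leaves, and `S` for `Q` in each block.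
    set R' := B.biUnion R with hR'
    have hRp : ∀ r ∈ R', r ∈ S ∧ p r := by
      intro r hr
      obtain ⟨b₀, hb₀, hr⟩ := Finset.mem_biUnion.1 hr
      exact ⟨(hR b₀ hb₀ r hr).1, (hR b₀ hb₀ r hr).2⟩
    have hQdel : ∀ b₀ ∈ B, ∀ q ∈ Q b₀, q ∈ del G Finset.univ v := fun b₀ hb₀ q hq =>
      (hB b₀ hb₀).1.subset (hQb b₀ hb₀ hq)
    have hdisj : (B : Set (Finset V)).PairwiseDisjoint Q := fun b₀ hb₀ b₁ hb₁ hne =>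
      Finset.disjoint_left.2 fun x hx hx' =>
        hne ((hB b₀ hb₀).1.eq_of_mem (hB b₁ hb₁).1 (hQb b₀ hb₀ hx) (hQb b₁ hb₁ hx'))
    have hdisj' : Disjoint (R'.image f) (B.biUnion Q) := by
      refine Finset.disjoint_left.2 fun x hx hx' => ?_
      obtain ⟨r, hr, rfl⟩ := Finset.mem_image.1 hx
      obtain ⟨b₀, hb₀, hq⟩ := Finset.mem_biUnion.1 hx'
      obtain ⟨y, hy, hxy⟩ := hQn b₀ hb₀ _ hq
      exact hpd hy (hadj (hRp r hr).2 hxy ▸ (hRp r hr).2)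
    have hRc : (R'.image f).card = R'.card := Finset.card_image_of_injOn fun r hr r' hr' hrr =>
      (hadj (hRp r hr).2 (hrr ▸ hfr (hRp r' hr').2)).symm
    have hQc : (B.biUnion Q).card = ∑ b₀ ∈ B, (Q b₀).card := Finset.card_biUnion hdisj
    have hR2 : R'.card ≤ 2 := (Finset.card_biUnion_le_card_mul B R 1 hR1).trans (by omega)
    have hQ6 : (B.biUnion Q).card ≤ 6 :=
      (Finset.card_biUnion_le_card_mul B Q 3 hQ3).trans (by omega)
    refine h3.false_of_exchange (S := S) (T := R' ∪ B.biUnion fun b₀ => S ∩ b₀)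
      (T' := R'.image f ∪ B.biUnion Q) hS hd ?_ ?_ ?_ ?_ ?_ ?_
    · refine Finset.union_subset (fun r hr => (hRp r hr).1) fun x hx => ?_
      obtain ⟨b₀, -, hx⟩ := Finset.mem_biUnion.1 hx
      exact (Finset.mem_inter.1 hx).1
    · intro x hx y hy hxy
      rcases Finset.mem_union.1 hx with hx | hx
      · obtain ⟨r, hr, rfl⟩ := Finset.mem_image.1 hx
        have hyr := hadj (hRp r hr).2 hxy
        have hyd : y ∈ del G Finset.univ v := by
          rcases Finset.mem_union.1 hy with hy | hy
          · obtain ⟨r', hr', rfl⟩ := Finset.mem_image.1 hy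
            exact hfd (hRp r' hr').2
          · obtain ⟨b₀, hb₀, hq⟩ := Finset.mem_biUnion.1 hy
            exact hQdel b₀ hb₀ y hq
        exact hpd hyd (hyr ▸ (hRp r hr).2)
      · obtain ⟨b₀, hb₀, hx⟩ := Finset.mem_biUnion.1 hx
        rcases Finset.mem_union.1 hy with hy | hy
        · obtain ⟨r, hr, rfl⟩ := Finset.mem_image.1 hy
          exact hpd (hQdel b₀ hb₀ x hx) (hadj (hRp r hr).2 hxy.symm ▸ (hRp r hr).2)
        · obtain ⟨b₁, hb₁, hy⟩ := Finset.mem_biUnion.1 hy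
          have hyb := hQd b₀ hb₀ x hx y (hQdel b₁ hb₁ y hy) hxy
          obtain rfl := (hB b₀ hb₀).1.eq_of_mem (hB b₁ hb₁).1 hyb (hQb b₁ hb₁ hy)
          exact hQi b₀ hb₀ x hx y hy hxy
    · rw [Finset.card_union_of_disjoint hdisj', hRc, hQc]
      have e1 := Finset.card_union_le R' (B.biUnion fun b₀ => S ∩ b₀)
      have e2 : (B.biUnion fun b₀ => S ∩ b₀).card ≤ ∑ b₀ ∈ B, (S ∩ b₀).card :=
        Finset.card_biUnion_le
      have e3 : ∑ b₀ ∈ B, (S ∩ b₀).card ≤ ∑ b₀ ∈ B, (ψ S ∩ b₀).card := by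
        refine Finset.sum_le_sum fun b₀ hb₀ => Finset.card_le_card fun x hx => ?_
        obtain ⟨hx, hxb⟩ := Finset.mem_inter.1 hx
        exact Finset.mem_inter.2 ⟨hSψ (Finset.mem_inter.2 ⟨hx, (hB b₀ hb₀).1.subset hxb⟩), hxb⟩
      have e4 : ∑ b₀ ∈ B, (ψ T ∩ b₀).card ≤ ∑ b₀ ∈ B, (Q b₀).card := Finset.sum_le_sum hTQ
      omega
    · have := Finset.card_union_le (R'.image f) (B.biUnion Q)
      omega
    · intro t ht
      rcases Finset.mem_union.1 ht with ht | ht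
      · obtain ⟨r, hr, rfl⟩ := Finset.mem_image.1 ht
        refine ⟨{f r, r}, Finset.card_le_two.trans (by omega), ?_⟩
        rintro x (rfl | hx)
        · simp
        · rw [hadj (hRp r hr).2 hx.symm]; simp
      · obtain ⟨b₀, hb₀, hq⟩ := Finset.mem_biUnion.1 ht
        exact hQW b₀ hb₀ t hq
    · intro t ht s hs hsT
      have hsT' : ∀ b₀ ∈ B, s ∉ b₀ ∧ s ∉ R b₀ := fun b₀ hb₀ =>
        ⟨fun hsb => hsT (Finset.mem_union_right _ (Finset.mem_biUnion.2
          ⟨b₀, hb₀, Finset.mem_inter.2 ⟨hs, hsb⟩⟩)),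
        fun hsR => hsT (Finset.mem_union_left _ (Finset.mem_biUnion.2 ⟨b₀, hb₀, hsR⟩))⟩
      rcases Finset.mem_union.1 ht with ht | ht
      · obtain ⟨r, hr, rfl⟩ := Finset.mem_image.1 ht
        refine ⟨?_, fun h => hsT (Finset.mem_union_left _ (hadj (hRp r hr).2 h ▸ hr))⟩
        rintro rfl
        exact hS _ hs r (hRp r hr).1 (hfr (hRp r hr).2)
      · obtain ⟨b₀, hb₀, hq⟩ := Finset.mem_biUnion.1 ht
        refine ⟨?_, fun h => ?_⟩
        · rintro rfl
          exact (hsT' b₀ hb₀).1 (hQb b₀ hb₀ hq)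
        · rcases hQS b₀ hb₀ t hq s hs h with h | h
          · exact (hsT' b₀ hb₀).1 h
          · exact (hsT' b₀ hb₀).2 h

omit [DecidableRel G.Adj] [DecidableEq V] in
theorem TwoLeaves.eq_of_adj_left (h : TwoLeaves G v a b) {x : V} (hx : G.Adj a x) : x = v :=
  (h.left x).1 ⟨Finset.mem_univ _, hx⟩

omit [DecidableRel G.Adj] [DecidableEq V] in
theorem TwoLeaves.eq_of_adj_right (h : TwoLeaves G v a b) {x : V} (hx : G.Adj b x) : x = v :=
  (h.right x).1 ⟨Finset.mem_univ _, hx⟩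

omit [DecidableRel G.Adj] [DecidableEq V] in
theorem TwoLeaves.not_adj (h : TwoLeaves G v a b) : ¬ G.Adj a b := fun hab =>
  h.right.mem.2.ne (h.eq_of_adj_left hab)

/-- A maximal independent set that contains `v` gains one vertex when `v` is replaced by its two
leaves, so nothing more can be gained elsewhere. -/
theorem GapLE.del_of_twoLeaves (hG : GapLE G 1 Finset.univ) (h : TwoLeaves G v a b) :
    GapLE G 0 (del G Finset.univ v) := by
  intro S hS T hT hiS hiT hd
  have hva := h.left.mem.2.symm
  have hvb := h.right.mem.2.symm
  have haT : a ∉ T := fun ha => (mem_del.1 (hT ha)).2.2 hva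
  have hbT : b ∉ T := fun hb => (mem_del.1 (hT hb)).2.2 hvb
  have hvT : v ∉ T := fun hv => (mem_del.1 (hT hv)).2.1 rfl
  have hvS : v ∉ S := fun hv => (mem_del.1 (hS hv)).2.1 rfl
  have := hG (insert v S) (Finset.subset_univ _) (insert a (insert b T)) (Finset.subset_univ _)
    (indep_insert.2 ⟨fun y hy => (mem_del.1 (hS hy)).2.2, hiS⟩)
    (indep_insert.2 ⟨fun y hy hay => ?_, indep_insert.2
      ⟨fun y hy hby => hvT (h.eq_of_adj_right hby ▸ hy), hiT⟩⟩) fun x _ => ?_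
  · rw [Finset.card_insert_of_notMem hvS, Finset.card_insert_of_notMem,
      Finset.card_insert_of_notMem hbT] at this
    · omega
    · simpa using ⟨h.ne, haT⟩
  · rcases Finset.mem_insert.1 hy with rfl | hy
    · exact h.not_adj hay
    · exact hvT (h.eq_of_adj_left hay ▸ hy)
  · rw [dom_insert]
    by_cases hxv : x = v
    · exact Or.inl hxv
    by_cases hvx : G.Adj v x
    · exact Or.inr (Or.inl hvx.symm)
    exact Or.inr (Or.inr (hd x (mem_del.2 ⟨Finset.mem_univ _, hxv, hvx⟩)))

/-- A neighbour `r` of `v` with three leaves could be exchanged for its leaves. If it had none, then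
one could dominate its other neighbours from a distance, and exchange `v` for `r` and the leaves of
`v`. -/
theorem GapLE.nbrsHaveLeaf (hG : NoShortCycle G) (hgap : GapLE G 1 Finset.univ)
    (h : TwoLeaves G v a b) (hu : ∀ r c d, TwoLeaves G r c d → r = v) : NbrsHaveLeaf G v a b := by
  intro r hvr hra hrb
  by_cases hl : ∃ l, Nb1 G Finset.univ l r
  · obtain ⟨l, hl⟩ := hl
    by_contra hcon
    obtain ⟨l', hl', hne⟩ : ∃ l', Nb1 G Finset.univ l' r ∧ l' ≠ l := by
      by_contra! h'
      exact hcon ⟨l, Finset.mem_univ _, hl, fun l' _ => h' l'⟩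
    obtain ⟨m, hm, hml, hml'⟩ : ∃ m, Nb1 G Finset.univ m r ∧ m ≠ l ∧ m ≠ l' := by
      by_contra! h'
      exact hvr.ne (hu r l l' ⟨hne.symm, hl, hl', fun x hx => or_iff_not_imp_left.2 (h' x hx)⟩).symm
    have hadj : ∀ {x y}, Nb1 G Finset.univ x r → G.Adj x y → y = r := fun hx hxy =>
      (hx _).1 ⟨Finset.mem_univ _, hxy⟩
    have hnot : ∀ {x y}, Nb1 G Finset.univ x r → Nb1 G Finset.univ y r → ¬ G.Adj x y :=
      fun hx hy hxy => hy.mem.2.ne (hadj hx hxy)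
    have := hgap.swap (J := {r}) (J' := {m, l, l'}) indep_singleton ?_ (Finset.subset_univ _)
      (Finset.subset_univ _) ?_
    · rw [Finset.card_singleton, Finset.card_eq_three.2 ⟨m, l, l', hml, hml', hne.symm, rfl⟩] at this
      omega
    · simp only [indep_insert, indep_singleton, Finset.forall_mem_insert, Finset.mem_singleton,
        forall_eq]
      exact ⟨⟨hnot hm hl, hnot hm hl'⟩, hnot hl hl', trivial⟩
    · intro x _
      simp only [dom_insert, dom_singleton]
      rintro (rfl | hx | rfl | hx | rfl | hx)
      · exact Or.inr hm.mem.2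
      · exact Or.inl (hadj hm hx.symm)
      · exact Or.inr hl.mem.2
      · exact Or.inl (hadj hl hx.symm)
      · exact Or.inr hl'.mem.2
      · exact Or.inl (hadj hl' hx.symm)
  · have hex : ∀ d, G.Adj r d → ∃ e, G.Adj d e ∧ e ≠ r := by
      intro d hd
      by_contra! h'
      refine hl ⟨d, fun q => ⟨fun hq => h' q hq.2, ?_⟩⟩
      rintro rfl
      exact ⟨Finset.mem_univ _, hd.symm⟩
    choose! e he her using hex
    set F := (Finset.univ.filter fun d => G.Adj r d ∧ d ≠ v).image e with hF
    have hFm : ∀ y ∈ F, ∃ d, G.Adj r d ∧ d ≠ v ∧ e d = y := by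
      intro y hy
      obtain ⟨d, hd, rfl⟩ := Finset.mem_image.1 hy
      exact ⟨d, (Finset.mem_filter.1 hd).2.1, (Finset.mem_filter.1 hd).2.2, rfl⟩
    have hFi : Indep G F := by
      intro x hx y hy hxy
      obtain ⟨d, hd, -, rfl⟩ := hFm x hx
      obtain ⟨d', hd', -, rfl⟩ := hFm y hy
      exact hG.pent hd (he d hd) hxy (he d' hd').symm hd'.symm
    have hrF : ∀ y ∈ F, ¬ G.Adj r y := by
      intro y hy hry
      obtain ⟨d, hd, -, rfl⟩ := hFm y hy
      exact hG.tri hd (he d hd) hry.symm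
    have hvF : v ∉ F := fun hv => hrF v hv hvr.symm
    have hvF' : ∀ y ∈ F, ¬ G.Adj v y := by
      intro y hy hvy
      obtain ⟨d, hd, hdv, rfl⟩ := hFm y hy
      exact hG.quad hd (he d hd) hvy.symm hvr (her d hd).symm hdv
    have hrF' : r ∉ F := fun hr => hvF' r hr hvr
    have haF : a ∉ F := fun ha => hvF' a ha h.left.mem.2.symm
    have hbF : b ∉ F := fun hb => hvF' b hb h.right.mem.2.symm
    have := hgap.swap (J := insert v F) (J' := insert a (insert b (insert r F)))
      (indep_insert.2 ⟨hvF', hFi⟩) (indep_insert.2 ⟨?_, indep_insert.2 ⟨?_, indep_insert.2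
        ⟨hrF, hFi⟩⟩⟩) (Finset.subset_univ _) (Finset.subset_univ _) ?_
    · rw [Finset.card_insert_of_notMem, Finset.card_insert_of_notMem,
        Finset.card_insert_of_notMem hrF', Finset.card_insert_of_notMem hvF] at this
      · omega
      · simpa using ⟨hrb.symm, hbF⟩
      · simpa using ⟨h.ne, hra.symm, haF⟩
    · intro y hy hay
      rw [h.eq_of_adj_left hay] at hy
      rcases Finset.mem_insert.1 hy with hy | hy
      · exact h.right.mem.2.ne hy.symm
      · rcases Finset.mem_insert.1 hy with hy | hy
        · exact hvr.ne hy
        · exact hvF hy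
    · intro y hy hby
      rw [h.eq_of_adj_right hby] at hy
      rcases Finset.mem_insert.1 hy with hy | hy
      · exact hvr.ne hy
      · exact hvF hy
    · intro x _
      simp only [dom_insert]
      rintro (rfl | hx | rfl | hx | rfl | hx | hx)
      · exact Or.inr (Or.inl h.left.mem.2)
      · exact Or.inl (h.eq_of_adj_left hx.symm)
      · exact Or.inr (Or.inl h.right.mem.2)
      · exact Or.inl (h.eq_of_adj_right hx.symm)
      · exact Or.inr (Or.inl hvr.symm)
      · by_cases hxv : x = v
        · exact Or.inl hxv
        · exact Or.inr (Or.inr (Or.inr ⟨e x, Finset.mem_image_of_mem _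
            (Finset.mem_filter.2 ⟨Finset.mem_univ _, hx.symm, hxv⟩), he x hx.symm⟩))
      · exact Or.inr (Or.inr hx)

omit [DecidableRel G.Adj] in
theorem GapLE.noExchange (hgap : GapLE G 1 Finset.univ) (k : ℕ) : NoExchange G k := by
  intro J J' hJ hJ' _ hcard
  by_contra! h
  have := hgap.swap hJ hJ' (Finset.subset_univ _) (Finset.subset_univ _) fun x _ => h x
  omega

/-- The local conditions that characterize almost well-covered graphs with one vertex of type two. -/
theorem gapLE_one_iff (hG : NoShortCycle G) (h : TwoLeaves G v a b)
    (hu : ∀ r c d, TwoLeaves G r c d → r = v) :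
    GapLE G 1 Finset.univ ↔ LocallyNice G (del G Finset.univ v) ∧ NbrsHaveLeaf G v a b ∧
      NoExchange G 40 :=
  ⟨fun hgap => ⟨(hgap.del_of_twoLeaves h).locallyNice hG, hgap.nbrsHaveLeaf hG h hu,
    hgap.noExchange 40⟩, fun hh => GapLE.of_noExchange hG h hh.1 hh.2.1 hh.2.2⟩

end

/-! ### First-order definability -/

namespace FirstOrder

section

variable {ι κ : Type} {P Q : (n : ℕ) → SimpleGraph (Fin n) → (ι → Fin n) → Prop}

theorem congr (h : FirstOrder ι P) (hPQ : ∀ n G x, Q n G x ↔ P n G x) : FirstOrder ι Q := by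
  obtain rfl : Q = P := by
    funext n G x
    exact propext (hPQ n G x)
  exact h

theorem or (hP : FirstOrder ι P) (hQ : FirstOrder ι Q) :
    FirstOrder ι fun n G x => P n G x ∨ Q n G x :=
  (hP.not.and hQ.not).not.congr fun _ _ _ => or_iff_not_and_not

theorem imp (hP : FirstOrder ι P) (hQ : FirstOrder ι Q) :
    FirstOrder ι fun n G x => P n G x → Q n G x :=
  (hP.and hQ.not).not.congr fun _ _ _ => by tauto

theorem iff (hP : FirstOrder ι P) (hQ : FirstOrder ι Q) :
    FirstOrder ι fun n G x => P n G x ↔ Q n G x :=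
  ((hP.imp hQ).and (hQ.imp hP)).congr fun _ _ _ => iff_iff_implies_and_implies

/-- The constructor `FirstOrder.ex` in a form in which the predicate can be found by unification. -/
theorem exists' {R : (n : ℕ) → SimpleGraph (Fin n) → (ι → Fin n) → Fin n → Prop}
    (h : FirstOrder (Option ι) fun n G x => R n G (fun i => x (some i)) (x none)) :
    FirstOrder ι fun n G x => ∃ y, R n G x y :=
  h.ex

theorem forall' {R : (n : ℕ) → SimpleGraph (Fin n) → (ι → Fin n) → Fin n → Prop}
    (h : FirstOrder (Option ι) fun n G x => R n G (fun i => x (some i)) (x none)) :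
    FirstOrder ι fun n G x => ∀ y, R n G x y :=
  (h.not.exists' (R := fun n G x y => ¬ R n G x y)).not.congr fun _ _ _ => not_exists_not.symm

/-- Renaming of variables. -/
theorem comp (h : FirstOrder ι P) : ∀ {κ : Type} (f : ι → κ),
    FirstOrder κ fun n G x => P n G fun i => x (f i) := by
  induction h with
  | adj i j => exact fun f => .adj _ _
  | eq i j => exact fun f => .eq _ _
  | not _ ih => exact fun f => (ih f).not
  | and _ _ ih₁ ih₂ => exact fun f => (ih₁ f).and (ih₂ f)
  | ex _ ih =>
    refine fun f => (ih (Option.map f)).ex.congr fun n G x => exists_congr fun y => iff_of_eq ?_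
    congr 1
    funext o
    cases o <;> rfl

variable (ι) in
/-- The formula for falsity may not use a vertex, since the graph may be empty. -/
theorem const (p : Prop) : FirstOrder ι fun _ _ _ => p := by
  have h : FirstOrder ι fun _ _ _ => False := by
    have h1 : FirstOrder ι fun n _ _ => ∃ y : Fin n, y = y := (FirstOrder.eq none none).exists'
    exact (h1.and h1.not).congr fun _ _ _ => by tauto
  by_cases hp : p
  · exact h.not.congr fun _ _ _ => by simp [hp]
  · exact h.congr fun _ _ _ => by simp [hp]

theorem forall_finite [Finite κ] {R : κ → (n : ℕ) → SimpleGraph (Fin n) → (ι → Fin n) → Prop}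
    (h : ∀ k, FirstOrder ι (R k)) : FirstOrder ι fun n G x => ∀ k, R k n G x := by
  classical
  have := Fintype.ofFinite κ
  have key : ∀ s : Finset κ, FirstOrder ι fun n G x => ∀ k ∈ s, R k n G x := by
    intro s
    induction s using Finset.induction_on with
    | empty => exact (const ι True).congr fun _ _ _ => by simp
    | insert k s _ ih => exact ((h k).and ih).congr fun _ _ _ => by simp
  exact (key Finset.univ).congr fun _ _ _ => by simp

theorem exists_finite [Finite κ] {R : κ → (n : ℕ) → SimpleGraph (Fin n) → (ι → Fin n) → Prop}
    (h : ∀ k, FirstOrder ι (R k)) : FirstOrder ι fun n G x => ∃ k, R k n G x :=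
  (forall_finite fun k => (h k).not).not.congr fun _ _ _ => not_forall_not.symm

theorem exists_fun [Finite κ] :
    ∀ {ι : Type} {R : (n : ℕ) → SimpleGraph (Fin n) → (ι → Fin n) → (κ → Fin n) → Prop},
      (FirstOrder (ι ⊕ κ) fun n G x => R n G (fun i => x (.inl i)) fun k => x (.inr k)) →
      FirstOrder ι fun n G x => ∃ f, R n G x f := by
  induction κ using Finite.induction_empty_option with
  | of_equiv e ih =>
    intro ι R h
    refine (ih (R := fun n G x f => R n G x fun k => f (e.symm k))
      (h.comp (Sum.map id e.symm))).congr fun n G x => ?_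
    exact ⟨fun ⟨f, hf⟩ => ⟨fun k => f (e k), by simpa using hf⟩, fun ⟨f, hf⟩ => ⟨_, hf⟩⟩
  | h_empty =>
    intro ι R h
    refine (h.comp (Sum.elim id PEmpty.elim)).congr fun n G x => ?_
    exact ⟨fun ⟨f, hf⟩ => (Subsingleton.elim f fun k => x k.elim) ▸ hf, fun hf => ⟨_, hf⟩⟩
  | h_option ih =>
    intro ι R h
    let e : ∀ {α : Type}, ι ⊕ Option α → Option (ι ⊕ α) :=
      Sum.elim (fun i => some (.inl i)) (Option.map .inr)
    refine (ih (R := fun n G x f => ∃ y, R n G x fun o => o.elim y f) ?_).congr fun n G x => ?_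
    · refine exists' ((h.comp e).congr fun n G x => iff_of_eq ?_)
      simp only [e]
      congr 1
      funext o
      cases o <;> rfl
    · exact ⟨fun ⟨f, hf⟩ => ⟨fun k => f (some k), f none, by
        convert hf using 1
        funext o
        cases o <;> rfl⟩, fun ⟨f, y, hf⟩ => ⟨_, hf⟩⟩

theorem forall_fun [Finite κ]
    {R : (n : ℕ) → SimpleGraph (Fin n) → (ι → Fin n) → (κ → Fin n) → Prop}
    (h : FirstOrder (ι ⊕ κ) fun n G x => R n G (fun i => x (.inl i)) fun k => x (.inr k)) :
    FirstOrder ι fun n G x => ∀ f, R n G x f :=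
  (h.not.exists_fun (R := fun n G x f => ¬ R n G x f)).not.congr
    fun _ _ _ => not_exists_not.symm

end

section

/-- A set of vertices that is first-order definable from one vertex. -/
abbrev IsDefinable (A : (n : ℕ) → SimpleGraph (Fin n) → Fin n → Finset (Fin n)) : Prop :=
  ∀ {ι : Type} (i j : ι), FirstOrder ι fun n G x => x j ∈ A n G (x i)

variable {ι : Type} {A : (n : ℕ) → SimpleGraph (Fin n) → Fin n → Finset (Fin n)}

theorem mem_univ : IsDefinable fun _ _ _ => Finset.univ := fun _ _ =>
  (const _ True).congr fun _ _ _ => by simp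

open Classical in
theorem mem_del : IsDefinable fun _ G v => del G Finset.univ v := fun i j =>
  ((FirstOrder.eq j i).not.and (FirstOrder.adj i j).not).congr fun _ _ _ => by
    simp [AlmostWellCovered.mem_del]

variable (hA : IsDefinable A)
include hA

theorem nb1 (i j k : ι) : FirstOrder ι fun n G x => Nb1 G (A n G (x i)) (x j) (x k) :=
  forall' (((hA _ _).and (.adj _ _)).iff (.eq _ _))

theorem nb2 (i j k l : ι) : FirstOrder ι fun n G x => Nb2 G (A n G (x i)) (x j) (x k) (x l) :=
  (FirstOrder.eq k l).not.and
    (forall' (((hA _ _).and (.adj _ _)).iff ((FirstOrder.eq _ _).or (.eq _ _))))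

theorem two (i j : ι) : FirstOrder ι fun n G x => Two G (A n G (x i)) (x j) :=
  exists' (exists' ((FirstOrder.eq _ _).not.and (((hA _ _).and (.adj _ _)).and
    ((hA _ _).and (.adj _ _)))))

theorem isUniqueLeaf (i j k : ι) :
    FirstOrder ι fun n G x => IsUniqueLeaf G (A n G (x i)) (x j) (x k) :=
  (hA i j).and ((nb1 hA i j k).and (forall' ((hA (some i) none).imp
    ((nb1 hA (some i) none (some k)).imp (.eq none (some j))))))

theorem inC7 (i j : ι) : FirstOrder ι fun n G x => InC7 G (A n G (x i)) (x j) :=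
  exists_fun (κ := ZMod 7) ((forall_finite fun k => nb2 hA (Sum.inl i) (Sum.inr k)
    (Sum.inr (k - 1)) (Sum.inr (k + 1))).and
    (exists_finite fun k => .eq (Sum.inr k) (Sum.inl j)))

theorem locallyNice (i : ι) : FirstOrder ι fun n G x => LocallyNice G (A n G (x i)) :=
  forall' ((hA (some i) none).imp ((two hA (some i) none).imp ((inC7 hA (some i) none).or
    (exists' (isUniqueLeaf hA (some (some i)) none (some none))))))

end

section

variable {ι : Type}

theorem nb1_univ (i j : ι) : FirstOrder ι fun _ G x => Nb1 G Finset.univ (x i) (x j) :=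
  nb1 (A := fun _ _ _ => Finset.univ) mem_univ i i j

theorem twoLeaves (i j k : ι) : FirstOrder ι fun _ G x => TwoLeaves G (x i) (x j) (x k) :=
  ((FirstOrder.eq j k).not.and ((nb1_univ j i).and ((nb1_univ k i).and
    (forall' (R := fun _ G x y => Nb1 G Finset.univ y (x i) → y = x j ∨ y = x k)
      ((nb1_univ none (some i)).imp
        ((FirstOrder.eq none (some j)).or (.eq none (some k)))))))).congr
    fun _ _ _ => ⟨fun h => ⟨h.ne, h.left, h.right, h.unique⟩,
      fun h => ⟨h.1, h.2.1, h.2.2.1, h.2.2.2⟩⟩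

open Classical in
theorem locallyNice_del (i : ι) :
    FirstOrder ι fun _ G x => LocallyNice G (del G Finset.univ (x i)) :=
  locallyNice (A := fun _ G v => del G Finset.univ v) mem_del i

theorem nbrsHaveLeaf (i j k : ι) : FirstOrder ι fun _ G x => NbrsHaveLeaf G (x i) (x j) (x k) :=
  forall' ((FirstOrder.adj (some i) none).imp ((FirstOrder.eq none (some j)).not.imp
    ((FirstOrder.eq none (some k)).not.imp
      (exists' (isUniqueLeaf (A := fun _ _ _ => Finset.univ) mem_univ none none (some none))))))

end

end FirstOrder

/-- In an exchange it suffices to consider enumerated sets of the sizes `p` and `p + 2`. -/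
theorem noExchange_iff {V : Type*} {G : SimpleGraph V} {k : ℕ} :
    NoExchange G k ↔ ∀ (p : Fin (k + 1)) (f : Fin p → V) (g : Fin (p + 2) → V),
      (∀ i j, ¬ G.Adj (f i) (f j)) → (∀ i j, ¬ G.Adj (g i) (g j)) → (∀ i j, g i = g j → i = j) →
      ∃ x, (∃ i, x = g i ∨ G.Adj x (g i)) ∧ ¬ ∃ i, x = f i ∨ G.Adj x (f i) := by
  classical
  have hdom : ∀ {q : ℕ} (f : Fin q → V) (x : V),
      Dom G (Finset.univ.image f) x ↔ ∃ i, x = f i ∨ G.Adj x (f i) := by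
    intro q f x
    simp [Dom, exists_or, eq_comm]
  constructor
  · intro h p f g hf hg hinj
    have hg' : (Finset.univ.image g).card = p + 2 := by
      rw [Finset.card_image_of_injective _ fun i j => hinj i j, Finset.card_fin]
    have hf' : (Finset.univ.image f).card ≤ p := by
      simpa using Finset.card_image_le (s := Finset.univ) (f := f)
    simp only [← hdom]
    exact h _ _ (by simpa [Indep] using hf) (by simpa [Indep] using hg) (by omega) (by omega)
  · intro h J J' hJ hJ' hk hc
    obtain ⟨K, hKJ, hK⟩ := Finset.exists_subset_card_eq hc
    have hf : Finset.univ.image (fun i => (J.equivFin.symm i : V)) = J := by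
      ext x
      simp only [Finset.mem_image, Finset.mem_univ, true_and]
      exact ⟨by rintro ⟨i, rfl⟩; exact (J.equivFin.symm i).2, fun hx => ⟨J.equivFin ⟨x, hx⟩, by simp⟩⟩
    let e := K.equivFinOfCardEq hK
    have hg : Finset.univ.image (fun i => (e.symm i : V)) = K := by
      ext x
      simp only [Finset.mem_image, Finset.mem_univ, true_and]
      exact ⟨by rintro ⟨i, rfl⟩; exact (e.symm i).2, fun hx => ⟨e ⟨x, hx⟩, by simp⟩⟩
    obtain ⟨x, hx, hx'⟩ := h ⟨J.card, by omega⟩ (fun i => J.equivFin.symm i) (fun i => e.symm i)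
      (fun i j => hJ _ (J.equivFin.symm i).2 _ (J.equivFin.symm j).2)
      (fun i j => hJ' _ (hKJ (e.symm i).2) _ (hKJ (e.symm j).2))
      (fun i j hij => e.symm.injective (Subtype.ext hij))
    rw [← hdom, hg] at hx
    rw [← hdom, hf] at hx'
    exact ⟨x, hx.mono hKJ, hx'⟩

theorem FirstOrder.noExchange (ι : Type) (k : ℕ) : FirstOrder ι fun _ G _ => NoExchange G k := by
  refine FirstOrder.congr ?_ fun _ _ _ => noExchange_iff
  refine forall_finite fun p => forall_fun (forall_fun ?_)
  refine (forall_finite fun i => forall_finite fun j =>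
    (FirstOrder.adj (Sum.inl (Sum.inr i)) (Sum.inl (Sum.inr j))).not).imp
    ((forall_finite fun i => forall_finite fun j =>
      (FirstOrder.adj (Sum.inr i) (Sum.inr j)).not).imp
    ((forall_finite fun i => forall_finite fun j =>
      (FirstOrder.eq (Sum.inr i) (Sum.inr j)).imp (const _ _)).imp (exists' (.and ?_ (.not ?_)))))
  · exact exists_finite fun i => (FirstOrder.eq none (some (Sum.inr i))).or (.adj _ _)
  · exact exists_finite fun i => (FirstOrder.eq none (some (Sum.inl (Sum.inr i)))).or (.adj _ _)

/-! ### Girth, types of vertices and the independence gap -/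

section

variable {V : Type*} {G : SimpleGraph V}

theorem noShortCycle_of_le_egirth (h : 6 ≤ G.egirth) : NoShortCycle G := by
  rw [SimpleGraph.le_egirth] at h
  have tri : ∀ {a b c}, G.Adj a b → G.Adj b c → G.Adj c a → False := by
    intro a b c hab hbc hca
    have := h a (.cons hab (.cons hbc (.cons hca .nil))) (by
      simp [SimpleGraph.Walk.cons_isCycle_iff, hab.ne, hab.ne', hbc.ne, hca.ne, hca.ne'])
    norm_num at this
  refine ⟨tri, ?_, ?_⟩
  · intro a b c d hab hbc hcd hda hac hbd
    have := h a (.cons hab (.cons hbc (.cons hcd (.cons hda .nil)))) (by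
      simp [SimpleGraph.Walk.cons_isCycle_iff, hab.ne, hab.ne', hbc.ne, hcd.ne, hda.ne, hda.ne',
        hac.symm, hbd, hac])
    norm_num at this
  · intro a b c d e hab hbc hcd hde hea
    have hac : a ≠ c := by rintro rfl; exact tri hcd hde hea
    have had : a ≠ d := by rintro rfl; exact tri hab hbc hcd
    have hbd : b ≠ d := by rintro rfl; exact tri hab hde hea
    have hbe : b ≠ e := by rintro rfl; exact tri hbc hcd hde
    have hce : c ≠ e := by rintro rfl; exact tri hab hbc hea
    have := h a (.cons hab (.cons hbc (.cons hcd (.cons hde (.cons hea .nil))))) (by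
      simp [SimpleGraph.Walk.cons_isCycle_iff, hab.ne, hab.ne', hbc.ne, hcd.ne, hde.ne, hea.ne,
        hea.ne', hac.symm, had.symm, hbd, hbe, hce, hac, had])
    norm_num at this

variable [Fintype V]

theorem ncard_neighborSet_eq_one_iff {u x : V} (h : G.Adj x u) :
    (G.neighborSet u).ncard = 1 ↔ Nb1 G Finset.univ u x := by
  rw [Set.ncard_eq_one]
  constructor
  · rintro ⟨y, hy⟩ q
    have hq : ∀ q, G.Adj u q ↔ q = y := fun q => by
      rw [← SimpleGraph.mem_neighborSet, hy, Set.mem_singleton_iff]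
    rw [(hq x).1 h.symm, hq]
    simp
  · intro hu
    refine ⟨x, Set.ext fun q => ?_⟩
    simpa using hu q

/-- The conditions on complete components hold automatically at a vertex with two leaves. -/
theorem hasType_two_iff {x : V} : HasType G x 2 ↔ ∃ a b, TwoLeaves G x a b := by
  -- Two leaves at `x` are not adjacent, so that the component of `x` is not complete.
  have hcomp : ∀ {a b u}, Nb1 G Finset.univ a x → Nb1 G Finset.univ b x → a ≠ b →
      G.Reachable u x → ¬ InCompleteComponent G u := by
    intro a b u ha hb hne hux hu
    have hab := hu a b (hux.trans ha.mem.2.symm.reachable) (hux.trans hb.mem.2.symm.reachable) hne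
    exact hb.mem.2.ne ((ha b).1 ⟨Finset.mem_univ _, hab⟩)
  have hleaf : ∀ {a b}, Nb1 G Finset.univ a x → Nb1 G Finset.univ b x → a ≠ b → IsLeaf G a :=
    fun ha hb hne => ⟨hcomp ha hb hne ha.mem.2.reachable,
      (ncard_neighborSet_eq_one_iff ha.mem.2.symm).2 ha⟩
  simp only [HasType, OfNat.ofNat_ne_zero, and_false, or_false]
  constructor
  · rintro ⟨-, h⟩
    obtain ⟨a, b, hne, hab⟩ := Set.ncard_eq_two.1 h
    have hmem : ∀ u, (G.Adj x u ∧ IsLeaf G u) ↔ u = a ∨ u = b := fun u => Set.ext_iff.1 hab u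
    have hn : ∀ u, u = a ∨ u = b → Nb1 G Finset.univ u x := fun u hu =>
      (ncard_neighborSet_eq_one_iff ((hmem u).2 hu).1).1 ((hmem u).2 hu).2.2
    have ha := hn a (Or.inl rfl)
    refine ⟨a, b, hne, ha, hn b (Or.inr rfl), fun u hu => ?_⟩
    by_cases hua : u = a
    · exact Or.inl hua
    · exact (hmem u).1 ⟨hu.mem.2.symm, hleaf hu ha hua⟩
  · rintro ⟨a, b, h⟩
    refine ⟨⟨hcomp h.left h.right h.ne .rfl, fun hx => ?_⟩, Set.ncard_eq_two.2 ⟨a, b, h.ne, ?_⟩⟩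
    · have := (ncard_neighborSet_eq_one_iff h.left.mem.2).1 hx.2
      exact h.ne ((this b).1 ⟨Finset.mem_univ _, h.right.mem.2.symm⟩).symm
    · refine Set.ext fun u => ⟨fun hu => h.unique u ?_, ?_⟩
      · exact (ncard_neighborSet_eq_one_iff hu.1).1 hu.2.2
      · rintro (rfl | rfl)
        · exact ⟨h.left.mem.2.symm, hleaf h.left h.right h.ne⟩
        · exact ⟨h.right.mem.2.symm, hleaf h.right h.left h.ne.symm⟩

variable [DecidableEq V]

omit [Fintype V] [DecidableEq V] in
theorem isIndepSet_iff_indep {S : Finset V} : G.IsIndepSet (S : Set V) ↔ Indep G S := by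
  refine ⟨fun h x hx y hy hxy => h hx hy hxy.ne hxy, fun h x hx y hy _ => h x hx y hy⟩

omit [Fintype V] in
theorem maximal_isIndepSet_iff {S : Finset V} :
    Maximal (fun t : Finset V => G.IsIndepSet (t : Set V)) S ↔ Indep G S ∧ ∀ x, Dom G S x := by
  simp only [isIndepSet_iff_indep]
  constructor
  · refine fun h => ⟨h.prop, fun x => ?_⟩
    by_contra hd
    simp only [Dom, not_or, not_exists, not_and] at hd
    exact hd.1 (h.le_of_ge (indep_insert.2 ⟨hd.2, h.prop⟩) (Finset.subset_insert x S)
      (Finset.mem_insert_self x S))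
  · refine fun h => ⟨h.1, fun T hT hST x hx => ?_⟩
    rcases h.2 x with hxS | ⟨y, hy, hxy⟩
    · exact hxS
    · exact (hT x hx y (hST hy) hxy).elim

/-- The independence gap is positive, since a vertex with two leaves may be exchanged for them. -/
theorem isAlmostWellCovered_iff {v a b : V} (h : TwoLeaves G v a b) :
    IsAlmostWellCovered G ↔ GapLE G 1 Finset.univ := by
  have hα : ∀ {T}, Indep G T → T.card ≤ G.indepNum := fun hT =>
    (isIndepSet_iff_indep.2 hT).card_le_indepNum
  have hi : ∀ {S}, Indep G S → (∀ x, Dom G S x) → minMaximalIndepNum G ≤ S.card := fun hS hd =>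
    Nat.sInf_le ⟨_, maximal_isIndepSet_iff.2 ⟨hS, hd⟩, rfl⟩
  obtain ⟨S₁, hS₁, hS₁c⟩ : ∃ S, (Indep G S ∧ ∀ x, Dom G S x) ∧
      S.card = minMaximalIndepNum G := by
    have hne : {k | ∃ s : Finset V, Maximal (fun t : Finset V => G.IsIndepSet (t : Set V)) s ∧
        s.card = k}.Nonempty := by
      obtain ⟨S, -, -, hS, hd⟩ := (indep_singleton (G := G) (x := v)).exists_maximal
        (Finset.subset_univ _)
      exact ⟨_, S, maximal_isIndepSet_iff.2 ⟨hS, fun x => hd x (Finset.mem_univ x)⟩, rfl⟩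
    obtain ⟨S, hS, hc⟩ := Nat.sInf_mem hne
    exact ⟨S, maximal_isIndepSet_iff.1 hS, hc⟩
  obtain ⟨T₁, hT₁⟩ := G.exists_isNIndepSet_indepNum
  have hlt : minMaximalIndepNum G + 1 ≤ G.indepNum := by
    obtain ⟨S, hvS, -, hS, hd⟩ := (indep_singleton (G := G) (x := v)).exists_maximal
      (Finset.subset_univ _)
    rw [Finset.singleton_subset_iff] at hvS
    have haS : a ∉ S := fun ha => hS a ha v hvS h.left.mem.2
    have hbS : b ∉ S := fun hb => hS b hb v hvS h.right.mem.2
    have h1 := hi hS fun x => hd x (Finset.mem_univ x)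
    have h2 := hα (T := insert a (insert b (S.erase v))) (indep_insert.2 ⟨fun y hy hay => ?_,
      indep_insert.2 ⟨fun y hy hby => ?_, fun x hx y hy => hS x (Finset.mem_of_mem_erase hx) y
        (Finset.mem_of_mem_erase hy)⟩⟩)
    · rw [Finset.card_insert_of_notMem (by simp [h.ne, haS]),
        Finset.card_insert_of_notMem (by simp [hbS]), Finset.card_erase_of_mem hvS] at h2
      have := Finset.card_pos.2 ⟨v, hvS⟩
      omega
    · rw [h.eq_of_adj_left hay] at hy
      simp [h.right.mem.2.ne'] at hy
    · rw [h.eq_of_adj_right hby] at hy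
      simp at hy
  unfold IsAlmostWellCovered independenceGap
  constructor
  · intro hgap S _ T _ hS hT hd
    have := hα hT
    have := hi hS fun x => hd x (Finset.mem_univ x)
    omega
  · intro hgap
    have := hgap S₁ (Finset.subset_univ _) T₁ (Finset.subset_univ _) hS₁.1
      (isIndepSet_iff_indep.1 hT₁.isIndepSet) fun x _ => hS₁.2 x
    rw [hT₁.card_eq] at this
    omega

end

open Classical in
theorem FirstOrder.gapLE_one : FirstOrder Empty fun _ G _ => ∃ v a b, TwoLeaves G v a b ∧
    LocallyNice G (del G Finset.univ v) ∧ NbrsHaveLeaf G v a b ∧ NoExchange G 40 :=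
  exists' (exists' (exists' ((twoLeaves (some (some none)) (some none) none).and
    ((locallyNice_del (some (some none))).and
    ((nbrsHaveLeaf (some (some none)) (some none) none).and (noExchange _ 40))))))

end AlmostWellCovered

theorem mainTheorem4 :
    AlmostWellCovered.DecidableInPolyTime
      (fun n (G : SimpleGraph (Fin n)) =>
        6 ≤ G.egirth ∧ ∃! x : Fin n, AlmostWellCovered.HasType G x 2)
      (fun n (G : SimpleGraph (Fin n)) => AlmostWellCovered.IsAlmostWellCovered G) := by
  classical
  refine AlmostWellCovered.FirstOrder.gapLE_one.decidableInPolyTime fun n G ⟨hG, v, hv, hu⟩ => ?_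
  replace hG := AlmostWellCovered.noShortCycle_of_le_egirth hG
  have hu' : ∀ r c d, AlmostWellCovered.TwoLeaves G r c d → r = v := fun r c d h =>
    hu r (AlmostWellCovered.hasType_two_iff.2 ⟨c, d, h⟩)
  obtain ⟨a, b, h⟩ := AlmostWellCovered.hasType_two_iff.1 hv
  rw [AlmostWellCovered.isAlmostWellCovered_iff h]
  constructor
  · exact fun hgap => ⟨v, a, b, h, (AlmostWellCovered.gapLE_one_iff hG h hu').1 hgap⟩
  · rintro ⟨w, c, d, h', hh⟩
    obtain rfl := hu' w c d h'
    exact (AlmostWellCovered.gapLE_one_iff hG h' hu').2 hh
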